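/- **Setting.** On $\ell^2(\mathbb Z^2)$ let $|n\rangle$, $n=(n_1,n_2)\in\mathbb Z^2$, be the standard basis, $X_1,X_2$ the position operators ($X_j|n\rangle=n_j|n\rangle$), $e_1=(1,0)$, $e_2=(0,1)$. For $B\in\mathbb R$ let $$S_1^B=\sum_n e^{\imath \frac B2 n_2}\,|n-e_1\rangle\langle n|\,,\qquad S_2^B=\sum_n e^{-\imath \frac B2 n_1}\,|n-e_2\rangle\langle n|$$ be the magnetic translations in the symmetric gauge. Consider a Hamiltonian of finite range $R\in\mathbb N$, $$H=\sum_{|n_1|\le R,\,|n_2|\le R} t_n\,(S_1^B)^{n_1}(S_2^B)^{n_2}+V ,$$ where $V=\sum_n v_n|n\rangle\langle n|$ with $(v_n)$ real and bounded, and each $t_n$ is a complex multiple of the identity or, more generally, the sum of such a multiple and a compact operator, with $\langle k|t_n|l\rangle=0$ whenever $|k_1-l_1|>R$ or $|k_2-l_2|>R$; moreover $t_{-n}=(S_2^B)^{-n_2}(S_1^B)^{-n_1}t_n^*(S_2^B)^{n_2}(S_1^B)^{n_1}$, so that $H=H^*$. Let $\widehat H$ be the restriction (compression) of $H$ to the half-plane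 space $\ell^2(\mathbb Z\times\mathbb N)$, $\mathbb N=\{1,2,\dots\}$ (Dirichlet boundary condition), and let $\Pi_<=\sum_{n_1<0}\sum_{n_2>0}|n_1,n_2\rangle\langle n_1,n_2|$. For $m\in\mathbb Z^2$ put $m'=m+(\frac12,\frac12)$ and $$F=-\frac{(X_1-m_1')+\imath(X_2-m_2')}{|(X_1-m_1')+\imath(X_2-m_2')|}.$$ **Theorem.** Suppose that the closed interval $\Delta\subset\mathbb R$ lies in a gap of $H$ (that is, $\Delta\cap\sigma(H)=\emptyset$), let $\mu\in\Delta$ and let $P_\mu=\chi(H\le\mu)$ be the Fermi projection. Let $g:\mathbb R\to[0,1]$ be any smooth non-increasing function which is equal to $1$ on the left of $\Delta$ and $0$ on the right of $\Delta$. Then $P_\mu FP_\mu$ is a Fredholm operator on $P_\mu\ell^2(\mathbb Z^2)$, the operator $g'(\widehat H)\,\imath[\Pi_<,\widehat H]$ is trace class, and $$\mathrm{Tr}\bigl(g'(\widehat H)\,\imath\,[\Pi_<,\widehat H]\bigr)=\frac1{2\pi}\,\mathrm{Ind}(P_\mu FP_\mu),$$ where $\mathrm{Ind}(T)=\dim\mathrm{Ker}(T)-\dim\mathrm{Ker}(T^*)$.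 -/

import Mathlib

open scoped ENNReal lp ContDiff InnerProductSpace

noncomputable section

namespace BulkEdge

/-! ### Hilbert spaces and elementary operators -/

/-- The sites of the square lattice. -/
abbrev Site : Type := ℤ × ℤ

/-- The sites of the upper half-plane `ℤ × {1, 2, 3, …}`. -/
abbrev UpperSite : Type := {n : ℤ × ℤ // 0 < n.2}

/-- The Hilbert space `ℓ²(I)` of complex square-summable functions on `I`. -/
abbrev Hil (I : Type) : Type := ℓ²(I, ℂ)

/-- The vector `|n⟩` of the standard orthonormal basis. -/
abbrev ket {I : Type} [DecidableEq I] (n : I) : Hil I := lp.single 2 n (1 : ℂ)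

theorem memTwo_iff {I : Type} (f : I → ℂ) :
    Memℓp f 2 ↔ Summable fun n => ‖f n‖ ^ 2 := by
  rw [memℓp_gen_iff (by norm_num)]
  norm_num

theorem hil_norm_sq {I : Type} (ψ : Hil I) : ‖ψ‖ ^ 2 = ∑' n, ‖ψ n‖ ^ 2 := by
  have h := lp.norm_rpow_eq_tsum (p := 2) (by norm_num) ψ
  norm_num at h
  exact h

theorem hil_summable {I : Type} (ψ : Hil I) : Summable fun n => ‖ψ n‖ ^ 2 :=
  (memTwo_iff _).1 ψ.2

theorem summable_mul_sq {I : Type} (f : I → ℂ) (C : ℝ) (hC : ∀ n, ‖f n‖ ≤ C) (ψ : Hil I) :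
    Summable fun n => ‖f n * ψ n‖ ^ 2 := by
  refine Summable.of_nonneg_of_le (fun n => by positivity) (fun n => ?_)
    ((hil_summable ψ).mul_left (C ^ 2))
  rw [norm_mul, mul_pow]
  gcongr
  exact hC n

/-- The multiplication operator `f(X)`, `(f(X) ψ)(n) = f(n) ψ(n)`, of a bounded function. -/
def mulOp {I : Type} (f : I → ℂ) (hf : ∃ C : ℝ, ∀ n, ‖f n‖ ≤ C) : Hil I →L[ℂ] Hil I :=
  LinearMap.mkContinuousOfExistsBound
    { toFun := fun ψ => ⟨fun n => f n * ψ n,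
        (memTwo_iff _).2 (hf.elim fun C hC => summable_mul_sq f C hC ψ)⟩
      map_add' := fun ψ φ => by
        ext n
        exact mul_add (f n) (ψ n) (φ n)
      map_smul' := fun c ψ => by
        ext n
        exact mul_left_comm (f n) c (ψ n) }
    (by
      obtain ⟨C, hC⟩ := hf
      refine ⟨|C|, fun ψ => ?_⟩
      refine (sq_le_sq₀ (norm_nonneg _) (by positivity)).1 ?_
      rw [mul_pow, hil_norm_sq, hil_norm_sq, ← tsum_mul_left]
      refine Summable.tsum_le_tsum (fun n => ?_) (summable_mul_sq f C hC ψ)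
        ((hil_summable ψ).mul_left _)
      show ‖f n * ψ n‖ ^ 2 ≤ _
      rw [norm_mul, mul_pow]
      gcongr
      exact (hC n).trans (le_abs_self C))

theorem mulOp_apply {I : Type} (f : I → ℂ) (hf : ∃ C : ℝ, ∀ n, ‖f n‖ ≤ C) (ψ : Hil I) (n : I) :
    mulOp f hf ψ n = f n * ψ n := rfl

/-- The unitary `(U ψ)(n) = u(n) ψ(σ n)` for a phase function `u` and a bijection `σ`. -/
def phaseShift {I : Type} (u : I → Circle) (σ : I ≃ I) : Hil I ≃ₗᵢ[ℂ] Hil I where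
  toFun ψ := ⟨fun n => u n * ψ (σ n), (memTwo_iff _).2 (by
    simpa only [norm_mul, Circle.norm_coe, one_mul, Function.comp_def] using
      (σ.summable_iff (f := fun n => ‖ψ n‖ ^ 2)).2 (hil_summable ψ))⟩
  invFun ψ := ⟨fun n => ((u (σ.symm n))⁻¹ : Circle) * ψ (σ.symm n), (memTwo_iff _).2 (by
    simpa only [norm_mul, Circle.norm_coe, one_mul, Function.comp_def] using
      (σ.symm.summable_iff (f := fun n => ‖ψ n‖ ^ 2)).2 (hil_summable ψ))⟩
  map_add' ψ φ := by
    ext n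
    exact mul_add _ (ψ (σ n)) (φ (σ n))
  map_smul' c ψ := by
    ext n
    exact mul_left_comm _ c (ψ (σ n))
  left_inv ψ := by
    ext n
    show ((u (σ.symm n))⁻¹ : Circle) * ((u (σ.symm n) : ℂ) * ψ (σ (σ.symm n))) = ψ n
    rw [← mul_assoc, ← Circle.coe_mul]
    simp
  right_inv ψ := by
    ext n
    show (u n : ℂ) * (((u (σ.symm (σ n)))⁻¹ : Circle) * ψ (σ.symm (σ n))) = ψ n
    rw [← mul_assoc, σ.symm_apply_apply, ← Circle.coe_mul]
    simp
  norm_map' ψ := by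
    refine (sq_eq_sq₀ (norm_nonneg _) (norm_nonneg _)).1 ?_
    rw [hil_norm_sq, hil_norm_sq, ← σ.tsum_eq fun n => ‖ψ n‖ ^ 2]
    refine tsum_congr fun n => ?_
    show ‖(u n : ℂ) * ψ (σ n)‖ ^ 2 = _
    rw [norm_mul, Circle.norm_coe, one_mul]

theorem phaseShift_apply {I : Type} (u : I → Circle) (σ : I ≃ I) (ψ : Hil I) (n : I) :
    phaseShift u σ ψ n = u n * ψ (σ n) := rfl

/-- The restriction `ℓ²(ℤ²) → ℓ²(ℤ × {1, 2, …})` of functions to the upper half-plane. -/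
def restrictUpper : Hil Site →L[ℂ] Hil UpperSite :=
  LinearMap.mkContinuous
    { toFun := fun ψ => ⟨fun n => ψ n.1,
        (memTwo_iff _).2 ((hil_summable ψ).subtype _)⟩
      map_add' := fun _ _ => rfl
      map_smul' := fun _ _ => rfl } 1
    (fun ψ => by
      refine (sq_le_sq₀ (norm_nonneg _) (by positivity)).1 ?_
      rw [one_mul, hil_norm_sq, hil_norm_sq]
      exact (hil_summable ψ).tsum_subtype_le _ {n : Site | 0 < n.2} fun n => by positivity)

theorem restrictUpper_apply (ψ : Hil Site) (n : UpperSite) : restrictUpper ψ n = ψ n.1 := rfl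

/-! ### Magnetic translations and Hamiltonians -/

/-- The unit vectors `e₁ = (1,0)`, `e₂ = (0,1)` (indexed by `0` and `1`). -/
def unitVec (j : Fin 2) : Site := if j = 0 then (1, 0) else (0, 1)

/-- The magnetic translation
`S_j^A = ∑ₙ exp(-i A(n - e_j, n)) |n - e_j⟩⟨n|` of a magnetic potential, which is
given by its values `A n j = A(n, n + e_j)` on the oriented edges `[n, n + e_j]`. -/
def magTranslation (A : Site → Fin 2 → ℝ) (j : Fin 2) : Hil Site ≃ₗᵢ[ℂ] Hil Site :=
  phaseShift (fun n => Circle.exp (-A n j)) (Equiv.addRight (unitVec j))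

/-- The symmetric gauge of a constant magnetic field `B`. -/
def symGauge (B : ℝ) (n : Site) (j : Fin 2) : ℝ :=
  if j = 0 then -(1 / 2) * B * n.2 else (1 / 2) * B * n.1

/-- The operator `(S_j^B)^k`, `k ∈ ℤ`, for the magnetic translations in the symmetric gauge. -/
def S (B : ℝ) (j : Fin 2) (k : ℤ) : Hil Site →L[ℂ] Hil Site :=
  ((magTranslation (symGauge B) j ^ k).toContinuousLinearEquiv : Hil Site →L[ℂ] Hil Site)

/-- The index set `|n₁| ≤ R`, `|n₂| ≤ R`. -/
def box (R : ℕ) : Finset Site := Finset.Icc (-(R : ℤ)) R ×ˢ Finset.Icc (-(R : ℤ)) R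

/-- The data of a finite-range Hamiltonian on `ℓ²(ℤ²)` in a constant magnetic field `B`: hopping
coefficients `t n` in the unitization of the compact operators, of finite range (for instance
scalars), subject to the symmetry condition which makes the Hamiltonian
self-adjoint, and a bounded real potential `v`. -/
structure FiniteRangeModel (B : ℝ) where
  /-- the range -/
  R : ℕ
  /-- the hopping coefficients -/
  t : Site → (Hil Site →L[ℂ] Hil Site)
  /-- the potential -/
  v : Site → ℝ
  t_scalar_add_compact : ∀ n ∈ box R, ∃ c : ℂ,
    IsCompactOperator (t n - c • (1 : Hil Site →L[ℂ] Hil Site))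
  t_finite_range : ∀ n ∈ box R, ∀ k l : Site, k - l ∉ box R → ⟪ket k, t n (ket l)⟫_ℂ = 0
  t_symm : ∀ n ∈ box R, t (-n) =
    S B 1 (-n.2) * S B 0 (-n.1) * ContinuousLinearMap.adjoint (t n) * S B 1 n.2 * S B 0 n.1
  v_bounded : ∃ C : ℝ, ∀ n, ‖(v n : ℂ)‖ ≤ C

/-- The Hamiltonian `H = ∑_{|n| ≤ R} t_n (S_1^B)^{n₁} (S_2^B)^{n₂} + V` on `ℓ²(ℤ²)`. -/
def FiniteRangeModel.H {B : ℝ} (M : FiniteRangeModel B) : Hil Site →L[ℂ] Hil Site :=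
  (∑ n ∈ box M.R, M.t n * S B 0 n.1 * S B 1 n.2) + mulOp (fun n => (M.v n : ℂ)) M.v_bounded

/-- The half-plane restriction (Dirichlet boundary condition) `Ĥ` of `H` on `ℓ²(ℤ × {1, 2, …})`:
the adjoint of the restriction map is the extension of functions by zero. -/
def FiniteRangeModel.Hhat {B : ℝ} (M : FiniteRangeModel B) : Hil UpperSite →L[ℂ] Hil UpperSite :=
  restrictUpper ∘L M.H ∘L ContinuousLinearMap.adjoint restrictUpper

/-- The quarter plane projection `Π_< = ∑_{n₁ < 0} ∑_{n₂ > 0} |n₁,n₂⟩⟨n₁,n₂|`. -/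
def quarterProj : Hil UpperSite →L[ℂ] Hil UpperSite :=
  mulOp (fun n => if n.1.1 < 0 then 1 else 0)
    ⟨1, fun n => by split_ifs <;> simp⟩

/-- The edge current density operator `i [Π_<, Ĥ]`. -/
def FiniteRangeModel.edgeCurrent {B : ℝ} (M : FiniteRangeModel B) :
    Hil UpperSite →L[ℂ] Hil UpperSite :=
  Complex.I • (quarterProj * M.Hhat - M.Hhat * quarterProj)

/-! ### Fermi projection and index -/

/-- The operator `f(T)` given by the continuous functional calculus of a bounded self-adjoint
operator `T` on a Hilbert space. -/
def funcCalc {E : Type} [NormedAddCommGroup E] [InnerProductSpace ℂ E] [CompleteSpace E]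
    (f : ℝ → ℝ) (T : E →L[ℂ] E) : E →L[ℂ] E := cfc f T

/-- The Fermi projection `χ(H ≤ μ)`, for `μ` outside the spectrum of the self-adjoint operator `H`:
the indicator function is then continuous on the spectrum, and the continuous functional
calculus applies. -/
def fermiProjection {I : Type} (H : Hil I →L[ℂ] Hil I) (μ : ℝ) : Hil I →L[ℂ] Hil I :=
  funcCalc (Set.indicator (Set.Iic μ) (1 : ℝ → ℝ)) H

/-- The complex number `(n₁ - m₁') + i (n₂ - m₂')`, where `m' = m + (1/2, 1/2)` is the centre of the
cell attached to `m`. It does not vanish. -/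
def fluxCoord (m n : Site) : ℂ :=
  ((n.1 : ℂ) - (m.1 + 1 / 2)) + Complex.I * ((n.2 : ℂ) - (m.2 + 1 / 2))

/-- The phase operator `F = -(X₁ - m₁' + i (X₂ - m₂')) / |X₁ - m₁' + i (X₂ - m₂')|`. -/
def phaseOp (m : Site) : Hil Site →L[ℂ] Hil Site :=
  mulOp (fun n => -(fluxCoord m n / (‖fluxCoord m n‖ : ℂ)))
    ⟨1, fun n => by simpa using div_self_le_one _⟩

/-- For a projection `P`, the operator `P A P` seen as an operator on the range of `P`. -/
def compression {I : Type} (P A : Hil I →L[ℂ] Hil I) : P.range →L[ℂ] P.range :=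
  ((P ∘L A).codRestrict P.range fun ψ => ⟨A ψ, rfl⟩) ∘L P.range.subtypeL

/-! ### Trace class operators -/

/-- `T` is trace class: `T = ∑ₖ ⟨xₖ, ·⟩ yₖ` with `∑ₖ ‖xₖ‖ ‖yₖ‖ < ∞`. -/
def IsTraceClass {I : Type} (T : Hil I →L[ℂ] Hil I) : Prop :=
  ∃ x y : ℕ → Hil I, (Summable fun k => ‖x k‖ * ‖y k‖) ∧
    ∀ ψ, HasSum (fun k => ⟪x k, ψ⟫_ℂ • y k) (T ψ)

/-- `T` is trace class and its trace, computed in any orthonormal basis, is `z`. -/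
def HasTrace {I : Type} (T : Hil I →L[ℂ] Hil I) (z : ℂ) : Prop :=
  IsTraceClass T ∧ ∀ (ι : Type) (b : HilbertBasis ι ℂ (Hil I)),
    HasSum (fun i => ⟪b i, T (b i)⟫_ℂ) z

end BulkEdge

end

/-! Write K for the half-plane operator, G for g(K) extended by zero to the plane, P = g(H), and ∂A
= `dL A` for the commutator of A with the indicator of {n₁ ≤ -1}. On the spectrum of H the function
g takes only the values 0 and 1, so P is the Fermi projection. Both sides of the formula are
compared with `hall L P`, half the trace of [∂P, ∂'P] P, where ∂' is the commutator with the
indicator of {n₂ ≤ L}.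

Analysis. A smooth function of a finite-range operator has matrix entries decaying faster than any
power of the distance, because smooth functions are rapidly approximable by polynomials
(`exists_polynomial_approx`). G and P differ only near the edge (`loc_lift_sub`), and functions
vanishing on the spectrum of H give operators living near the edge (`loc_lift_of_gap`). A commutator
with the indicator of a half-plane lives near its boundary line. Localization near two transverse
lines makes the entries absolutely summable, so the operator is nuclear and its trace is cyclic.

Edge. The trace of k'(K) ∂K vanishes for smooth k supported in the gap. With k = 3g² - 2g³ - g this
turns the trace of g'(K) ∂K into -6 tr((G² - G) ∂G) (`tr_edge`).

From edge to bulk. In the half-plane the cut {n₂ ≤ L} leaves a strip of finite height, so the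
commutator with it can be expanded under the trace; as L grows, `hall L G` tends to 3 tr((G² - G)
∂G) (`tendsto_hall_lift`). At height L the operators G and P nearly agree, so `hall L G - hall L P`
tends to 0 (`tendsto_hall_sub`).

Index. Fedosov's formula gives the index as tr((P - F*PF)³) (`index_compression`), a sum over
triangles of sites of P_jk P_kl P_lj times a sum of sines of angle differences. Up to coboundaries,
which cancel around a triangle, and localized antisymmetric terms, which sum to zero because P² = P,
the sine is 2π times the function `corner` that represents `hall L P` (`cohom_sin`, `hasSum_hall`).
Hence the index is -4πi `hall L P` for every L (`index_phaseOp`), and `hall L P` does not depend on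
L. Together, the edge trace is i · (-6) · (1/3) `hall L P`, that is 1/(2π) times the index. -/

noncomputable section

namespace BulkEdge

set_option linter.unusedSectionVars false

/-! ### Nuclear operators and their trace -/

section Nuclear

variable {E : Type*} [NormedAddCommGroup E] [InnerProductSpace ℂ E] [CompleteSpace E]

/-- `T = ∑ₖ ⟨xₖ, ·⟩ yₖ` with `∑ₖ ‖xₖ‖ ‖yₖ‖ < ∞` and `∑ₖ ⟨xₖ, yₖ⟩ = z`. -/
def NucTr (T : E →L[ℂ] E) (z : ℂ) : Prop :=
  ∃ (κ : Type) (x y : κ → E), (Summable fun k => ‖x k‖ * ‖y k‖) ∧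
    (∀ ψ, HasSum (fun k => ⟪x k, ψ⟫_ℂ • y k) (T ψ)) ∧ HasSum (fun k => ⟪x k, y k⟫_ℂ) z

theorem nucTr_of_hasSum {κ : Type} {T : E →L[ℂ] E} {x y : κ → E}
    (hs : Summable fun k => ‖x k‖ * ‖y k‖)
    (hT : ∀ ψ, HasSum (fun k => ⟪x k, ψ⟫_ℂ • y k) (T ψ)) :
    NucTr T (∑' k, ⟪x k, y k⟫_ℂ) :=
  ⟨κ, x, y, hs, hT, (Summable.of_norm_bounded hs fun _ => norm_inner_le_norm _ _).hasSum⟩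

theorem sum_norm_inner_mul_inner_le {ι : Type*} {v : ι → E} (hv : Orthonormal ℂ v) (x y : E)
    (s : Finset ι) : ∑ i ∈ s, ‖⟪x, v i⟫_ℂ * ⟪v i, y⟫_ℂ‖ ≤ ‖x‖ * ‖y‖ := by
  have hb : ∀ x : E, √(∑ i ∈ s, ‖⟪v i, x⟫_ℂ‖ ^ 2) ≤ ‖x‖ := fun x => by
    rw [Real.sqrt_le_left (norm_nonneg _)]
    exact hv.sum_inner_products_le x
  calc ∑ i ∈ s, ‖⟪x, v i⟫_ℂ * ⟪v i, y⟫_ℂ‖ = ∑ i ∈ s, ‖⟪v i, x⟫_ℂ‖ * ‖⟪v i, y⟫_ℂ‖ := by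
        refine Finset.sum_congr rfl fun i _ => ?_
        rw [norm_mul, norm_inner_symm]
    _ ≤ √(∑ i ∈ s, ‖⟪v i, x⟫_ℂ‖ ^ 2) * √(∑ i ∈ s, ‖⟪v i, y⟫_ℂ‖ ^ 2) :=
        Real.sum_mul_le_sqrt_mul_sqrt _ _ _
    _ ≤ ‖x‖ * ‖y‖ := by
        gcongr
        · exact hb x
        · exact hb y

/-- By Bessel and Cauchy–Schwarz the double family ⟨x_k, b_i⟩⟨b_i, y_k⟩ is absolutely summable.
Summing over i first gives z, summing over k first gives the diagonal entries. In particular z does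
not depend on the representation of T. -/
theorem NucTr.hasSum_basis {T : E →L[ℂ] E} {z : ℂ} (h : NucTr T z) {ι : Type*}
    (b : HilbertBasis ι ℂ E) : HasSum (fun i => ⟪b i, T (b i)⟫_ℂ) z := by
  obtain ⟨κ, x, y, hs, hT, hz⟩ := h
  have hrow : ∀ k, Summable fun i => ‖⟪x k, b i⟫_ℂ * ⟪b i, y k⟫_ℂ‖ := fun k =>
    summable_of_sum_le (fun _ => norm_nonneg _) (sum_norm_inner_mul_inner_le b.orthonormal _ _)
  have hsum : Summable fun p : κ × ι => ⟪x p.1, b p.2⟫_ℂ * ⟪b p.2, y p.1⟫_ℂ := by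
    refine Summable.of_norm ((summable_prod_of_nonneg fun _ => norm_nonneg _).2 ⟨hrow, ?_⟩)
    refine Summable.of_nonneg_of_le (fun k => tsum_nonneg fun _ => norm_nonneg _) (fun k => ?_) hs
    exact (hrow k).tsum_le_of_sum_le fun s =>
      sum_norm_inner_mul_inner_le b.orthonormal (x k) (y k) s
  have htot : ∑' p : κ × ι, ⟪x p.1, b p.2⟫_ℂ * ⟪b p.2, y p.1⟫_ℂ = z :=
    (hsum.hasSum.prod_fiberwise fun k => b.hasSum_inner_mul_inner (x k) (y k)).unique hz
  have hswap : HasSum (fun p : ι × κ => ⟪x p.2, b p.1⟫_ℂ * ⟪b p.1, y p.2⟫_ℂ) z := by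
    rw [← htot]
    exact (Equiv.prodComm ι κ).hasSum_iff (f := fun p : κ × ι => ⟪x p.1, b p.2⟫_ℂ * ⟪b p.2, y p.1⟫_ℂ)
      |>.2 hsum.hasSum
  refine hswap.prod_fiberwise fun i => ?_
  simpa only [inner_smul_right, innerSL_apply_apply] using (innerSL ℂ (b i)).hasSum (hT (b i))

theorem NucTr.unique {T : E →L[ℂ] E} {z z' : ℂ} (h : NucTr T z) (h' : NucTr T z') : z = z' := by
  obtain ⟨w, b, -⟩ := exists_hilbertBasis ℂ E
  exact (h.hasSum_basis b).unique (h'.hasSum_basis b)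

theorem NucTr.zero : NucTr (0 : E →L[ℂ] E) 0 :=
  ⟨PEmpty, PEmpty.elim, PEmpty.elim, summable_empty, fun ψ => by simp,
    hasSum_empty⟩

theorem NucTr.add {T T' : E →L[ℂ] E} {z z' : ℂ} (h : NucTr T z) (h' : NucTr T' z') :
    NucTr (T + T') (z + z') := by
  obtain ⟨κ, x, y, hs, hT, hz⟩ := h
  obtain ⟨κ', x', y', hs', hT', hz'⟩ := h'
  refine ⟨κ ⊕ κ', Sum.elim x x', Sum.elim y y', ?_, fun ψ => ?_, ?_⟩
  · exact (HasSum.sum (f := fun k => ‖Sum.elim x x' k‖ * ‖Sum.elim y y' k‖) hs.hasSum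
      hs'.hasSum).summable
  · exact HasSum.sum (f := fun k => ⟪Sum.elim x x' k, ψ⟫_ℂ • Sum.elim y y' k) (hT ψ) (hT' ψ)
  · exact HasSum.sum (f := fun k => ⟪Sum.elim x x' k, Sum.elim y y' k⟫_ℂ) hz hz'

/-- Cyclicity of the trace: X may act on y_k, or its adjoint on x_k, and the pairing is ⟨x_k, X y_k⟩
in both cases. The bound, linear in ‖X‖, makes traces against a fixed nuclear operator norm
continuous. -/
theorem NucTr.mul_left {T : E →L[ℂ] E} {z : ℂ} (h : NucTr T z) :
    ∃ C : ℝ, ∀ X : E →L[ℂ] E, ∃ w : ℂ, NucTr (X * T) w ∧ NucTr (T * X) w ∧ ‖w‖ ≤ C * ‖X‖ := by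
  obtain ⟨κ, x, y, hs, hT, hz⟩ := h
  refine ⟨∑' k, ‖x k‖ * ‖y k‖, fun X => ⟨∑' k, ⟪x k, X (y k)⟫_ℂ, ?_, ?_, ?_⟩⟩
  · refine nucTr_of_hasSum (Summable.of_nonneg_of_le (fun _ => by positivity) (fun k => ?_)
      (hs.mul_left ‖X‖)) fun ψ => by simpa using X.hasSum (hT ψ)
    calc ‖x k‖ * ‖X (y k)‖ ≤ ‖x k‖ * (‖X‖ * ‖y k‖) := by gcongr; exact X.le_opNorm _
      _ = _ := by ring
  · simp_rw [← ContinuousLinearMap.adjoint_inner_left]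
    refine nucTr_of_hasSum (Summable.of_nonneg_of_le (fun _ => by positivity) (fun k => ?_)
      (hs.mul_left ‖X‖)) fun ψ => ?_
    · calc ‖X.adjoint (x k)‖ * ‖y k‖ ≤ (‖X.adjoint‖ * ‖x k‖) * ‖y k‖ := by
            gcongr; exact X.adjoint.le_opNorm _
        _ = _ := by rw [LinearIsometryEquiv.norm_map]; ring
    · simp_rw [ContinuousLinearMap.adjoint_inner_left]
      exact hT (X ψ)
  · rw [← tsum_mul_right]
    refine tsum_of_norm_bounded (hs.mul_right ‖X‖).hasSum fun k => ?_
    calc ‖⟪x k, X (y k)⟫_ℂ‖ ≤ ‖x k‖ * ‖X (y k)‖ := norm_inner_le_norm _ _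
      _ ≤ ‖x k‖ * (‖X‖ * ‖y k‖) := by gcongr; exact X.le_opNorm _
      _ = _ := by ring

theorem NucTr.smul {T : E →L[ℂ] E} {z : ℂ} (h : NucTr T z) (c : ℂ) : NucTr (c • T) (c * z) := by
  obtain ⟨κ, x, y, hs, hT, hz⟩ := h
  refine ⟨κ, x, fun k => c • y k, ?_, fun ψ => ?_, ?_⟩
  · refine (hs.mul_left ‖c‖).congr fun k => ?_
    rw [norm_smul]; ring
  · simpa [smul_comm c] using (hT ψ).const_smul c
  · simpa [inner_smul_right] using hz.mul_left c

/-- A nuclear operator. -/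
def IsNuc (T : E →L[ℂ] E) : Prop := ∃ z, NucTr T z

open Classical in
/-- The trace of a nuclear operator. -/
def tr (T : E →L[ℂ] E) : ℂ := if h : IsNuc T then h.choose else 0

theorem IsNuc.nucTr {T : E →L[ℂ] E} (h : IsNuc T) : NucTr T (tr T) := by
  rw [tr, dif_pos h]
  exact h.choose_spec

theorem NucTr.isNuc {T : E →L[ℂ] E} {z : ℂ} (h : NucTr T z) : IsNuc T := ⟨z, h⟩

theorem NucTr.tr_eq {T : E →L[ℂ] E} {z : ℂ} (h : NucTr T z) : tr T = z :=
  h.isNuc.nucTr.unique h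

@[simp] theorem tr_zero : tr (0 : E →L[ℂ] E) = 0 := NucTr.zero.tr_eq

theorem IsNuc.add {T T' : E →L[ℂ] E} (h : IsNuc T) (h' : IsNuc T') : IsNuc (T + T') :=
  (h.nucTr.add h'.nucTr).isNuc

theorem tr_add {T T' : E →L[ℂ] E} (h : IsNuc T) (h' : IsNuc T') : tr (T + T') = tr T + tr T' :=
  (h.nucTr.add h'.nucTr).tr_eq

theorem IsNuc.smul {T : E →L[ℂ] E} (h : IsNuc T) (c : ℂ) : IsNuc (c • T) := (h.nucTr.smul c).isNuc

theorem tr_smul {T : E →L[ℂ] E} (h : IsNuc T) (c : ℂ) : tr (c • T) = c * tr T :=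
  (h.nucTr.smul c).tr_eq

theorem IsNuc.neg {T : E →L[ℂ] E} (h : IsNuc T) : IsNuc (-T) := by
  simpa using h.smul (-1)

theorem tr_neg {T : E →L[ℂ] E} (h : IsNuc T) : tr (-T) = -tr T := by
  simpa using tr_smul h (-1)

theorem IsNuc.sub {T T' : E →L[ℂ] E} (h : IsNuc T) (h' : IsNuc T') : IsNuc (T - T') := by
  simpa [sub_eq_add_neg] using h.add h'.neg

theorem tr_sub {T T' : E →L[ℂ] E} (h : IsNuc T) (h' : IsNuc T') : tr (T - T') = tr T - tr T' := by
  rw [sub_eq_add_neg, tr_add h h'.neg, tr_neg h', sub_eq_add_neg]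

theorem IsNuc.mul_left {T : E →L[ℂ] E} (h : IsNuc T) (X : E →L[ℂ] E) : IsNuc (X * T) := by
  obtain ⟨C, hC⟩ := h.nucTr.mul_left
  obtain ⟨w, hw, -⟩ := hC X
  exact hw.isNuc

theorem IsNuc.mul_right {T : E →L[ℂ] E} (h : IsNuc T) (X : E →L[ℂ] E) : IsNuc (T * X) := by
  obtain ⟨C, hC⟩ := h.nucTr.mul_left
  obtain ⟨w, -, hw, -⟩ := hC X
  exact hw.isNuc

theorem tr_mul_comm {T : E →L[ℂ] E} (h : IsNuc T) (X : E →L[ℂ] E) : tr (X * T) = tr (T * X) := by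
  obtain ⟨C, hC⟩ := h.nucTr.mul_left
  obtain ⟨w, hw, hw', -⟩ := hC X
  rw [hw.tr_eq, hw'.tr_eq]

theorem IsNuc.exists_norm_tr_mul_le {T : E →L[ℂ] E} (h : IsNuc T) :
    ∃ C : ℝ, ∀ X : E →L[ℂ] E, ‖tr (X * T)‖ ≤ C * ‖X‖ := by
  obtain ⟨C, hC⟩ := h.nucTr.mul_left
  refine ⟨C, fun X => ?_⟩
  obtain ⟨w, hw, -, hn⟩ := hC X
  rwa [hw.tr_eq]

/-! ### Atkinson's theorem and the index as a difference of traces -/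

theorem nucTr_of_isIdempotent {p : E →L[ℂ] E} (hp : p * p = p) [FiniteDimensional ℂ p.range] :
    NucTr p (Module.finrank ℂ p.range) := by
  let b := stdOrthonormalBasis ℂ p.range
  -- The idempotent need not be an orthogonal projection, so the adjoint has to act on the basis of
  -- the range.
  refine ⟨Fin (Module.finrank ℂ p.range), fun i => p.adjoint (b i), fun i => b i,
    Summable.of_finite, fun ψ => ?_, ?_⟩
  · have h : p ψ = ∑ i, ⟪p.adjoint (b i : E), ψ⟫_ℂ • (b i : E) := by
      have := congrArg Subtype.val (b.sum_repr' ⟨p ψ, ⟨ψ, rfl⟩⟩)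
      simp only [Submodule.coe_inner, AddSubmonoidClass.coe_finsetSum, SetLike.val_smul] at this
      simp_rw [ContinuousLinearMap.adjoint_inner_left]
      exact this.symm
    rw [h]
    exact hasSum_fintype _
  · have hfix : ∀ i, p (b i : E) = b i := fun i => by
      obtain ⟨φ, hφ⟩ := (b i).2
      rw [← hφ]
      exact congrArg (fun T : E →L[ℂ] E => T φ) hp
    have : ∑ i, ⟪p.adjoint (b i : E), (b i : E)⟫_ℂ = (Module.finrank ℂ p.range : ℂ) := by
      simp_rw [ContinuousLinearMap.adjoint_inner_left, hfix, ← Submodule.coe_inner]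
      simp
    rw [← this]
    exact hasSum_fintype _

/-- Finitely many terms of the series are split off so that the remaining norms sum to less than 1.
The Neumann series then inverts 1 - A. -/
theorem IsNuc.exists_small_add_finiteRange {T : E →L[ℂ] E} (h : IsNuc T) :
    ∃ A R : E →L[ℂ] E, T = A + R ∧ ‖A‖ < 1 ∧ R.toLinearMap.HasFiniteRange := by
  obtain ⟨z, κ, x, y, hs, hT, -⟩ := h
  obtain ⟨s, hs1⟩ : ∃ s : Finset κ, ∑' k : {k // k ∉ s}, ‖x k‖ * ‖y k‖ < 1 := by
    have := (tendsto_tsum_compl_atTop_zero fun k => ‖x k‖ * ‖y k‖).eventually_lt_const one_pos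
    exact this.exists
  let R : E →L[ℂ] E := ∑ k ∈ s, (innerSL ℂ (x k)).smulRight (y k)
  have hR : ∀ ψ, R ψ = ∑ k ∈ s, ⟪x k, ψ⟫_ℂ • y k := fun ψ => by simp [R]
  refine ⟨T - R, R, by simp, ?_, ?_⟩
  · refine lt_of_le_of_lt (ContinuousLinearMap.opNorm_le_bound _
      (tsum_nonneg fun _ => by positivity) fun ψ => ?_) hs1
    have h1 : HasSum (fun k : {k // k ∉ s} => ⟪x k, ψ⟫_ℂ • y k) ((T - R) ψ) := by
      have := (Finset.hasSum_compl_iff (f := fun k => ⟪x k, ψ⟫_ℂ • y k) (a := (T - R) ψ) s).2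
      apply this
      simpa [hR] using hT ψ
    rw [← h1.tsum_eq, ← tsum_mul_right]
    refine tsum_of_norm_bounded
      ((hs.subtype {k | k ∉ s}).mul_right ‖ψ‖).hasSum fun k => ?_
    rw [norm_smul]
    calc ‖⟪x k, ψ⟫_ℂ‖ * ‖y k‖ ≤ (‖x k‖ * ‖ψ‖) * ‖y k‖ := by
          gcongr; exact norm_inner_le_norm _ _
      _ = _ := by simp; ring
  · have hle : R.toLinearMap.range ≤ Submodule.span ℂ (y '' s) := by
      rintro _ ⟨ψ, rfl⟩
      change R ψ ∈ _
      rw [hR]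
      exact Submodule.sum_mem _ fun k hk => Submodule.smul_mem _ _ (Submodule.subset_span
        (Set.mem_image_of_mem y hk))
    have : IsNoetherian ℂ (Submodule.span ℂ (y '' s)) :=
      isNoetherian_span_of_finite ℂ (s.finite_toSet.image y)
    exact LinearMap.HasNoetherianRange.hasFiniteRange (isNoetherian_of_le hle)

theorem isUnit_one_sub_of_norm_lt_one {A : E →L[ℂ] E} (h : ‖A‖ < 1) :
    ∃ u : E →L[ℂ] E, u * (1 - A) = 1 ∧ (1 - A) * u = 1 :=
  ⟨(↑(Units.oneSub A h)⁻¹ : E →L[ℂ] E), (Units.oneSub A h).inv_mul, (Units.oneSub A h).mul_inv⟩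

theorem hasFiniteRange_mul_left {R : E →L[ℂ] E} (h : R.toLinearMap.HasFiniteRange)
    (X : E →L[ℂ] E) : (X * R).toLinearMap.HasFiniteRange :=
  LinearMap.HasFiniteRange.comp_left h X.toLinearMap

theorem hasFiniteRange_mul_right {R : E →L[ℂ] E} (h : R.toLinearMap.HasFiniteRange)
    (X : E →L[ℂ] E) : (R * X).toLinearMap.HasFiniteRange :=
  LinearMap.HasFiniteRange.comp_right h X.toLinearMap

theorem hasFiniteRange_add {R R' : E →L[ℂ] E} (h : R.toLinearMap.HasFiniteRange)
    (h' : R'.toLinearMap.HasFiniteRange) : (R + R').toLinearMap.HasFiniteRange :=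
  LinearMap.HasFiniteRange.add h h'

open scoped LinearMap.FiniteRangeSetoid in
-- Inverting the small parts of the two defects corrects S to a left and a right inverse of T modulo
-- finite rank.
theorem isFredholm_of_isNuc {S T : E →L[ℂ] E} (h₁ : IsNuc (1 - S * T)) (h₂ : IsNuc (1 - T * S)) :
    T.IsFredholm := by
  obtain ⟨A, R, hAR, hA, hR⟩ := h₁.exists_small_add_finiteRange
  obtain ⟨A', R', hAR', hA', hR'⟩ := h₂.exists_small_add_finiteRange
  obtain ⟨u, hu, -⟩ := isUnit_one_sub_of_norm_lt_one hA
  obtain ⟨u', -, hu'⟩ := isUnit_one_sub_of_norm_lt_one hA'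
  have hl : u * S * T - 1 = -u * R := by
    have : S * T = 1 - A - R := by rw [sub_sub, ← hAR]; abel
    rw [mul_assoc, this, mul_sub, hu]; noncomm_ring
  have hr : T * (S * u') - 1 = R' * -u' := by
    have : T * S = 1 - A' - R' := by rw [sub_sub, ← hAR']; abel
    rw [← mul_assoc, this, sub_mul, hu']; noncomm_ring
  have hfl : (u * S * T - 1).toLinearMap.HasFiniteRange := hl ▸ hasFiniteRange_mul_left hR _
  have hfr : (T * (S * u') - 1).toLinearMap.HasFiniteRange := hr ▸ hasFiniteRange_mul_right hR' _
  -- Left and right inverses modulo an ideal agree modulo that ideal, so the left parametrix also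
  -- works on the right.
  have hfr2 : (T * (u * S) - 1).toLinearMap.HasFiniteRange := by
    have : T * (u * S) - 1 = -(T * (u * S)) * (T * (S * u') - 1)
        + (T * ((u * S * T - 1) * (S * u')) + (T * (S * u') - 1)) := by noncomm_ring
    rw [this]
    exact hasFiniteRange_add (hasFiniteRange_mul_left hfr _) (hasFiniteRange_add
      (hasFiniteRange_mul_left (hasFiniteRange_mul_right hfl _) _) hfr)
  exact ContinuousLinearMap.IsFredholm.of_isQuasiInverse (v := u * S)
    ⟨LinearMap.FiniteRangeSetoid.equiv_iff_hasFiniteRange.2 hfl, LinearMap.FiniteRangeSetoid.equiv_iff_hasFiniteRange.2 hfr2⟩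

theorem nucTr_one_sub_proj (dec : FredholmDecomposition ℂ E) :
    NucTr (1 - dec.X₁.subtypeL ∘L dec.proj) (Module.finrank ℂ dec.X₀) := by
  have hidem : ∀ ψ, dec.proj (dec.proj ψ : E) = dec.proj ψ := fun ψ =>
    Submodule.projectionOntoL_apply_left _ _
  have hker : ∀ ψ : E, dec.proj ψ = 0 ↔ ψ ∈ dec.X₀ := fun ψ =>
    Submodule.projectionOntoL_apply_eq_zero_iff _
  set q : E →L[ℂ] E := 1 - dec.X₁.subtypeL ∘L dec.proj with hq
  have hqa : ∀ ψ, q ψ = ψ - dec.proj ψ := fun ψ => rfl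
  have hr : q.range = dec.X₀ := by
    ext ψ
    constructor
    · rintro ⟨φ, rfl⟩
      change q φ ∈ _
      rw [← hker, hqa, map_sub, hidem, sub_self]
    · intro h
      refine ⟨ψ, ?_⟩
      change q ψ = ψ
      rw [hqa, (hker ψ).2 h]
      simp
  have hqq : q * q = q := by
    ext ψ
    change q (q ψ) = q ψ
    rw [hqa (q ψ), hqa ψ, map_sub, hidem, sub_self]
    simp
  have := dec.finite_X₀
  have : FiniteDimensional ℂ q.range := by rw [hr]; infer_instance
  have h := nucTr_of_isIdempotent hqq
  rwa [hr] at h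

/-- For the quasi-inverse v of a Fredholm decomposition both defects are idempotents of finite rank,
whose traces are the dimensions of kernel and cokernel. S - v is nuclear, and replacing v by S
changes the two traces by tr((S - v) T) and tr(T (S - v)), which are equal. -/
theorem index_eq_tr_sub_tr {S T : E →L[ℂ] E} (h₁ : IsNuc (1 - S * T)) (h₂ : IsNuc (1 - T * S)) :
    (T.toLinearMap.index : ℂ) = tr (1 - S * T) - tr (1 - T * S) := by
  obtain ⟨pkg⟩ := (isFredholm_of_isNuc h₁ h₂).nonempty_fredholmPackage
  have hX₀ := pkg.decDom.finite_X₀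
  have hY₀ := pkg.decCodom.finite_X₀
  set v := pkg.quasiInverse with hv
  have hvT : v * T = pkg.decDom.X₁.subtypeL ∘L pkg.decDom.proj := by
    ext ψ
    change v (T ψ) = _
    conv_lhs => rw [pkg.eq_equiv]
    simp [hv, ContinuousLinearMap.FredholmPackage.quasiInverse]
  have hTv : T * v = pkg.decCodom.X₁.subtypeL ∘L pkg.decCodom.proj := by
    ext ψ
    change T (v ψ) = _
    conv_lhs => rw [pkg.eq_equiv]
    simp [hv, ContinuousLinearMap.FredholmPackage.quasiInverse]
  have n₁ := nucTr_one_sub_proj pkg.decDom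
  have n₂ := nucTr_one_sub_proj pkg.decCodom
  rw [← hvT] at n₁
  rw [← hTv] at n₂
  have hD : S - v = (1 - v * T) * S - v * (1 - T * S) := by noncomm_ring
  have nD : IsNuc (S - v) := hD ▸ (n₁.isNuc.mul_right S).sub (h₂.mul_left v)
  have e₁ : 1 - S * T = (1 - v * T) - (S - v) * T := by noncomm_ring
  have e₂ : 1 - T * S = (1 - T * v) - T * (S - v) := by noncomm_ring
  have hi : (T.toLinearMap.index : ℂ)
      = Module.finrank ℂ pkg.decDom.X₀ - Module.finrank ℂ pkg.decCodom.X₀ := by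
    rw [LinearMap.index_eq_finrank_sub, pkg.ker_eq, pkg.range_eq,
      (Submodule.quotientEquivOfIsCompl _ _ pkg.decCodom.isTopCompl.isCompl).finrank_eq]
    simp
  rw [e₁, e₂, tr_sub n₁.isNuc (nD.mul_right T), tr_sub n₂.isNuc (nD.mul_left T), n₁.tr_eq,
    n₂.tr_eq, tr_mul_comm nD, hi]
  ring

end Nuclear

/-! ### Matrix entries -/

section Entries

variable {I : Type} [DecidableEq I]

/-- The matrix entry `⟨j|A|k⟩`. -/
def ent (A : Hil I →L[ℂ] Hil I) (j k : I) : ℂ := A (ket k) j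

theorem inner_ket (j : I) (ψ : Hil I) : ⟪(ket j : Hil I), ψ⟫_ℂ = ψ j := by
  simpa using lp.inner_single_left (𝕜 := ℂ) j (1 : ℂ) ψ

theorem norm_ket (j : I) : ‖(ket j : Hil I)‖ = 1 := by
  simp

theorem norm_coord_le (ψ : Hil I) (j : I) : ‖ψ j‖ ≤ ‖ψ‖ := lp.norm_apply_le_norm (by norm_num) ψ j

theorem norm_ent_le (A : Hil I →L[ℂ] Hil I) (j k : I) : ‖ent A j k‖ ≤ ‖A‖ :=
  (norm_coord_le _ _).trans ((A.le_opNorm _).trans_eq (by rw [norm_ket, mul_one]))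

theorem hasSum_ket (ψ : Hil I) : HasSum (fun n => ψ n • (ket n : Hil I)) ψ := by
  have h := lp.hasSum_single (E := fun _ : I => ℂ) (p := 2) (by norm_num) ψ
  refine h.congr_fun fun n => ?_
  rw [← lp.single_smul, smul_eq_mul, mul_one]

theorem hasSum_coord {κ : Type*} {f : κ → Hil I} {ψ : Hil I} (h : HasSum f ψ) (j : I) :
    HasSum (fun k => f k j) (ψ j) := by
  simpa only [innerSL_apply_apply, inner_ket] using (innerSL ℂ (ket j : Hil I)).hasSum h

theorem hasSum_ent_mul_coord (A : Hil I →L[ℂ] Hil I) (ψ : Hil I) (j : I) :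
    HasSum (fun l => ent A j l * ψ l) (A ψ j) := by
  refine (hasSum_coord (A.hasSum (hasSum_ket ψ)) j).congr_fun fun l => ?_
  simp [ent, mul_comm]

theorem hasSum_ent_mul (A B : Hil I →L[ℂ] Hil I) (j k : I) :
    HasSum (fun l => ent A j l * ent B l k) (ent (A * B) j k) :=
  hasSum_ent_mul_coord A (B (ket k)) j

theorem ext_ent {A B : Hil I →L[ℂ] Hil I} (h : ∀ j k, ent A j k = ent B j k) : A = B := by
  ext ψ j
  exact (hasSum_ent_mul_coord A ψ j).unique
    ((hasSum_ent_mul_coord B ψ j).congr_fun fun l => by rw [h])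

@[simp] theorem ent_zero (j k : I) : ent (0 : Hil I →L[ℂ] Hil I) j k = 0 := rfl
@[simp] theorem ent_add (A B : Hil I →L[ℂ] Hil I) (j k : I) :
    ent (A + B) j k = ent A j k + ent B j k := rfl
@[simp] theorem ent_sub (A B : Hil I →L[ℂ] Hil I) (j k : I) :
    ent (A - B) j k = ent A j k - ent B j k := rfl
@[simp] theorem ent_neg (A : Hil I →L[ℂ] Hil I) (j k : I) : ent (-A) j k = -ent A j k := rfl
@[simp] theorem ent_smul (c : ℂ) (A : Hil I →L[ℂ] Hil I) (j k : I) :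
    ent (c • A) j k = c * ent A j k := rfl

theorem ket_apply (j k : I) : (ket k : Hil I) j = if j = k then 1 else 0 := by
  rw [lp.single_apply, Pi.single_apply]

theorem ent_one (j k : I) : ent (1 : Hil I →L[ℂ] Hil I) j k = if j = k then 1 else 0 :=
  ket_apply j k

@[simp] theorem ent_mulOp_mul (f : I → ℂ) (hf : ∃ C : ℝ, ∀ n, ‖f n‖ ≤ C)
    (A : Hil I →L[ℂ] Hil I) (j k : I) : ent (mulOp f hf * A) j k = f j * ent A j k := rfl

theorem mulOp_ket (f : I → ℂ) (hf : ∃ C : ℝ, ∀ n, ‖f n‖ ≤ C) (k : I) :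
    mulOp f hf (ket k) = f k • (ket k : Hil I) := by
  ext j
  rw [mulOp_apply]
  change f j * _ = f k * _
  rw [ket_apply]
  split_ifs with h <;> simp [h]

@[simp] theorem ent_mul_mulOp (f : I → ℂ) (hf : ∃ C : ℝ, ∀ n, ‖f n‖ ≤ C)
    (A : Hil I →L[ℂ] Hil I) (j k : I) : ent (A * mulOp f hf) j k = ent A j k * f k := by
  change A (mulOp f hf (ket k)) j = _
  rw [mulOp_ket, map_smul, mul_comm]
  rfl

theorem ent_mulOp (f : I → ℂ) (hf : ∃ C : ℝ, ∀ n, ‖f n‖ ≤ C) (j k : I) :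
    ent (mulOp f hf) j k = if j = k then f j else 0 := by
  rw [← mul_one (mulOp f hf), ent_mulOp_mul, ent_one]
  simp

theorem ent_adjoint (A : Hil I →L[ℂ] Hil I) (j k : I) :
    ent (ContinuousLinearMap.adjoint A) j k = (starRingEnd ℂ) (ent A k j) := by
  rw [ent, ← inner_ket, ContinuousLinearMap.adjoint_inner_right, ← inner_conj_symm, inner_ket, ent]

theorem star_mulOp (f : I → ℂ) (hf : ∃ C : ℝ, ∀ n, ‖f n‖ ≤ C)
    (hf' : ∃ C : ℝ, ∀ n, ‖(starRingEnd ℂ) (f n)‖ ≤ C) :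
    star (mulOp f hf) = mulOp (fun n => (starRingEnd ℂ) (f n)) hf' := by
  refine ext_ent fun j k => ?_
  rw [ContinuousLinearMap.star_eq_adjoint, ent_adjoint, ent_mulOp, ent_mulOp]
  by_cases h : j = k
  · simp [h]
  · simp [h, Ne.symm h]

variable (I) in
/-- The standard orthonormal basis. -/
def ketBasis : HilbertBasis I ℂ (Hil I) := .ofRepr (.refl ℂ _)

theorem ketBasis_apply (i : I) : ketBasis I i = ket i :=
  ((ketBasis I).repr_symm_single i).symm

theorem NucTr.hasSum_ent {T : Hil I →L[ℂ] Hil I} {z : ℂ} (h : NucTr T z) :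
    HasSum (fun j => ent T j j) z := by
  refine (h.hasSum_basis (ketBasis I)).congr_fun fun j => ?_
  rw [ketBasis_apply, inner_ket, ent]

theorem IsNuc.hasSum_ent {T : Hil I →L[ℂ] Hil I} (h : IsNuc T) :
    HasSum (fun j => ent T j j) (tr T) := h.nucTr.hasSum_ent

theorem tr_congr_diag {T T' : Hil I →L[ℂ] Hil I} (h : IsNuc T) (h' : IsNuc T')
    (hd : ∀ j, ent T j j = ent T' j j) : tr T = tr T' :=
  h.hasSum_ent.unique (h'.hasSum_ent.congr_fun hd)

theorem tr_eq_zero_of_diag {T : Hil I →L[ℂ] Hil I} (h : IsNuc T) (hd : ∀ j, ent T j j = 0) :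
    tr T = 0 :=
  h.hasSum_ent.unique (by simp [hd])

/-- The matrix entries of `A` are absolutely summable. -/
def AbsSum (A : Hil I →L[ℂ] Hil I) : Prop := Summable fun p : I × I => ‖ent A p.1 p.2‖

theorem AbsSum.hasSum {A : Hil I →L[ℂ] Hil I} (h : AbsSum A) (ψ : Hil I) :
    HasSum (fun p : I × I => ⟪(ket p.2 : Hil I), ψ⟫_ℂ • (ent A p.1 p.2 • (ket p.1 : Hil I)))
      (A ψ) := by
  have hs : Summable fun p : I × I =>
      ⟪(ket p.2 : Hil I), ψ⟫_ℂ • (ent A p.1 p.2 • (ket p.1 : Hil I)) := by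
    refine Summable.of_norm_bounded (Summable.mul_left ‖ψ‖ h) fun p => ?_
    rw [norm_smul, norm_smul, norm_ket, inner_ket, mul_one]
    exact mul_le_mul_of_nonneg_right (norm_coord_le ψ p.2) (norm_nonneg _)
  have h1 : HasSum (fun j => (A ψ) j • (ket j : Hil I)) (∑' p : I × I,
      ⟪(ket p.2 : Hil I), ψ⟫_ℂ • (ent A p.1 p.2 • (ket p.1 : Hil I))) := by
    refine hs.hasSum.prod_fiberwise fun j => ?_
    refine ((hasSum_ent_mul_coord A ψ j).smul_const (ket j : Hil I)).congr_fun fun l => ?_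
    rw [inner_ket, smul_smul, mul_comm]
  rw [(hasSum_ket (A ψ)).unique h1]
  exact hs.hasSum

theorem AbsSum.isNuc {A : Hil I →L[ℂ] Hil I} (h : AbsSum A) : IsNuc A := by
  refine (nucTr_of_hasSum (κ := I × I) (x := fun p => ket p.2)
    (y := fun p => ent A p.1 p.2 • ket p.1) ?_ h.hasSum).isNuc
  simp only [norm_smul, norm_ket, mul_one, one_mul]
  exact h

/-- Denumerability only serves to index the pairs of sites by ℕ, as `IsTraceClass` requires. -/
theorem AbsSum.hasTrace [Denumerable I] {A : Hil I →L[ℂ] Hil I} (h : AbsSum A) :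
    HasTrace A (tr A) := by
  refine ⟨?_, fun ι b => h.isNuc.nucTr.hasSum_basis b⟩
  obtain ⟨e⟩ : Nonempty (ℕ ≃ I × I) := ⟨(Denumerable.eqv (I × I)).symm⟩
  refine ⟨fun n => ket (e n).2, fun n => ent A (e n).1 (e n).2 • ket (e n).1, ?_, fun ψ => ?_⟩
  · simp only [norm_smul, norm_ket, mul_one, one_mul]
    exact e.summable_iff (f := fun p : I × I => ‖ent A p.1 p.2‖).2 h
  · exact e.hasSum_iff (f := fun p : I × I =>
      ⟪(ket p.2 : Hil I), ψ⟫_ℂ • (ent A p.1 p.2 • (ket p.1 : Hil I))).2 (h.hasSum ψ)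

/-- A nuclear operator which leaves the range of the orthogonal projection `P` invariant has the
same trace as its restriction to that range. -/
theorem nucTr_restrict {P K : Hil I →L[ℂ] Hil I} (hP : P * P = P) (hPs : star P = P)
    [CompleteSpace P.range] (hPK : P * K = K) (h : IsNuc K)
    (K' : P.range →L[ℂ] P.range) (hK' : ∀ ψ, (K' ψ : Hil I) = K ψ) : NucTr K' (tr K) := by
  obtain ⟨κ, x, y, hs, hT, hz⟩ := h.nucTr
  have hPadj : ContinuousLinearMap.adjoint P = P := hPs
  have hfix : ∀ ψ : P.range, P (ψ : Hil I) = ψ := by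
    rintro ⟨_, φ, rfl⟩
    exact congrArg (fun T : Hil I →L[ℂ] Hil I => T φ) hP
  have hnP : ‖P‖ ≤ 1 := by
    have := CStarRing.norm_self_mul_star (x := P)
    rw [hPs, hP] at this
    nlinarith [norm_nonneg P]
  have hle : ∀ ψ, ‖P ψ‖ ≤ ‖ψ‖ := fun ψ => (P.le_opNorm ψ).trans (by
    nlinarith [norm_nonneg ψ])
  let r : Hil I →L[ℂ] P.range := P.codRestrict P.range fun ψ => ⟨ψ, rfl⟩
  have hr : ∀ ψ, ((r ψ : P.range) : Hil I) = P ψ := fun ψ => rfl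
  have hin : ∀ (φ : Hil I) (ψ : P.range), ⟪r φ, ψ⟫_ℂ = ⟪φ, (ψ : Hil I)⟫_ℂ := fun φ ψ => by
    rw [Submodule.coe_inner, hr, ← ContinuousLinearMap.adjoint_inner_right, hPadj, hfix]
  have hmain := nucTr_of_hasSum (E := P.range) (T := K') (x := fun k => r (x k))
    (y := fun k => r (y k))
    (Summable.of_nonneg_of_le (fun _ => by positivity) (fun k =>
      mul_le_mul (hle (x k)) (hle (y k)) (norm_nonneg _) (norm_nonneg _)) hs) (fun ψ => by
      have e : r (K ψ) = K' ψ := by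
        ext1
        rw [hr, hK']
        exact congrArg (fun T : Hil I →L[ℂ] Hil I => T ψ) hPK
      rw [← e]
      simpa only [map_smul, hin] using r.hasSum (hT ψ))
  -- The expansion of P K = K has the same pairings ⟨x_k, P y_k⟩ as that of the restriction, so the
  -- traces coincide.
  have h2 := nucTr_of_hasSum (T := P * K) (x := x) (y := fun k => P (y k))
    (Summable.of_nonneg_of_le (fun _ => by positivity) (fun k =>
      mul_le_mul_of_nonneg_left (hle (y k)) (norm_nonneg _)) hs) (fun ψ => by
      simpa using P.hasSum (hT ψ))
  simp_rw [hin, hr] at hmain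
  rw [hPK] at h2
  rwa [← h2.tr_eq] at hmain

end Entries

/-! ### Operators with rapidly decaying matrix entries -/

/-- The bounded operators on `ℓ²(ℤ²)`. -/
abbrev Op : Type := Hil Site →L[ℂ] Hil Site

/-- One plus the distance of two sites. -/
def dd (j k : Site) : ℝ := 1 + ‖j - k‖

theorem one_le_dd (j k : Site) : 1 ≤ dd j k := by simp [dd]

theorem dd_pos (j k : Site) : 0 < dd j k := zero_lt_one.trans_le (one_le_dd j k)

theorem dd_comm (j k : Site) : dd j k = dd k j := by simp [dd, norm_sub_rev]

theorem dd_le_mul (j l k : Site) : dd j k ≤ dd j l * dd l k := by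
  have := norm_sub_le_norm_sub_add_norm_sub j l k
  simp only [dd]
  nlinarith [norm_nonneg (j - l), norm_nonneg (l - k)]

theorem abs_fst_sub_le (j k : Site) : |((j.1 - k.1 : ℤ) : ℝ)| ≤ ‖j - k‖ := by
  rw [← Int.norm_eq_abs]
  exact norm_fst_le (j - k)

theorem abs_snd_sub_le (j k : Site) : |((j.2 - k.2 : ℤ) : ℝ)| ≤ ‖j - k‖ := by
  rw [← Int.norm_eq_abs]
  exact norm_snd_le (j - k)

/-- The exponent 3 exceeds the dimension 2. The norm of `Site` is the sup norm, so this is the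
convergence of the Eisenstein series of weight 3. -/
theorem summable_inv_one_add_norm_cube : Summable fun n : Site => ((1 + ‖n‖) ^ 3)⁻¹ := by
  have h := EisensteinSeries.summable_one_div_norm_rpow (k := 3) (by norm_num)
  have h2 := (finTwoArrowEquiv ℤ).symm.summable_iff.2 h
  refine Summable.of_norm_bounded_eventually (g := fun n : Site => ‖n‖ ^ (-3 : ℝ)) ?_ ?_
  · refine h2.congr fun n => ?_
    simp only [Function.comp_apply]
    congr 1
    refine le_antisymm ?_ ?_
    · exact (pi_norm_le_iff_of_nonneg (norm_nonneg _)).2 fun i => by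
        fin_cases i
        · exact norm_fst_le n
        · exact norm_snd_le n
    · refine norm_prod_le_iff.2 ⟨?_, ?_⟩
      · exact norm_le_pi_norm ((finTwoArrowEquiv ℤ).symm n) 0
      · exact norm_le_pi_norm ((finTwoArrowEquiv ℤ).symm n) 1
  · filter_upwards [(Set.finite_singleton (0 : Site)).compl_mem_cofinite] with n hn
    have hn0 : 0 < ‖n‖ := norm_pos_iff.2 hn
    rw [Real.norm_of_nonneg (by positivity), Real.rpow_neg hn0.le]
    norm_cast
    gcongr
    linarith

/-- `∑ₙ (1 + |n|)⁻³`. -/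
def S3 : ℝ := ∑' n : Site, ((1 + ‖n‖) ^ 3)⁻¹

theorem hasSum_dd (k : Site) : HasSum (fun l => (dd l k ^ 3)⁻¹) S3 :=
  (Equiv.subRight k).hasSum_iff.2 summable_inv_one_add_norm_cube.hasSum

/-- A moderate weight. -/
def Mod (t : ℕ) (ρ : Site → ℝ) : Prop :=
  (∀ j, 0 < ρ j) ∧ ∀ j k, ρ j ≤ ρ k * dd j k ^ t

theorem Mod.mul {t t' : ℕ} {ρ σ : Site → ℝ} (h : Mod t ρ) (h' : Mod t' σ) :
    Mod (t + t') fun k => ρ k * σ k := by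
  refine ⟨fun j => mul_pos (h.1 j) (h'.1 j), fun j k => ?_⟩
  calc ρ j * σ j ≤ (ρ k * dd j k ^ t) * (σ k * dd j k ^ t') :=
        mul_le_mul (h.2 j k) (h'.2 j k) (h'.1 j).le
          (mul_nonneg (h.1 k).le (pow_nonneg (dd_pos _ _).le _))
    _ = _ := by ring

theorem mod_one : Mod 0 fun _ => 1 := ⟨fun _ => one_pos, fun j k => by simp⟩

theorem mod_pow {u : Site → ℝ} (hu : ∀ j, 1 ≤ u j) (h : ∀ j k, u j ≤ u k + ‖j - k‖) (s : ℕ) :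
    Mod s fun k => u k ^ s := by
  refine ⟨fun j => pow_pos (zero_lt_one.trans_le (hu j)) _, fun j k => ?_⟩
  rw [← mul_pow]
  refine pow_le_pow_left₀ (zero_le_one.trans (hu j)) ((h j k).trans ?_) _
  simp only [dd]
  nlinarith [hu k, norm_nonneg (j - k)]

/-- `A` decays rapidly off the diagonal, and its entries are bounded by `1/ρ`; the constants
are `C`. -/
def LocC (ρ : Site → ℝ) (A : Op) (C : ℕ → ℝ) : Prop :=
  ∀ N j k, ‖ent A j k‖ * dd j k ^ N * ρ k ≤ C N

/-- `A` decays rapidly off the diagonal, and its entries are bounded by `1/ρ`. -/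
def Loc (ρ : Site → ℝ) (A : Op) : Prop := ∃ C, LocC ρ A C

theorem LocC.nonneg {ρ : Site → ℝ} {A : Op} {C : ℕ → ℝ} (h : LocC ρ A C) (hρ : ∀ j, 0 < ρ j)
    (N : ℕ) : 0 ≤ C N :=
  le_trans (by have := hρ 0; have := dd_pos 0 0; positivity) (h N 0 0)

theorem LocC.norm_le {ρ : Site → ℝ} {A : Op} {C : ℕ → ℝ} (h : LocC ρ A C) (hρ : ∀ j, 0 < ρ j)
    (N : ℕ) (j k : Site) : ‖ent A j k‖ ≤ C N * (dd j k ^ N)⁻¹ * (ρ k)⁻¹ := by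
  have := hρ k
  have := dd_pos j k
  rw [← div_eq_mul_inv, ← div_eq_mul_inv, le_div_iff₀ (hρ k), le_div_iff₀ (by positivity)]
  calc ‖ent A j k‖ * ρ k * dd j k ^ N = ‖ent A j k‖ * dd j k ^ N * ρ k := by ring
    _ ≤ _ := h N j k

theorem LocC.add {ρ : Site → ℝ} {A B : Op} {C D : ℕ → ℝ} (hρ : ∀ j, 0 < ρ j)
    (h : LocC ρ A C) (h' : LocC ρ B D) : LocC ρ (A + B) fun N => C N + D N := fun N j k => by
  refine le_trans ?_ (add_le_add (h N j k) (h' N j k))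
  rw [← add_mul, ← add_mul, ent_add]
  have := hρ k
  have := dd_pos j k
  gcongr
  exact norm_add_le _ _

theorem LocC.neg {ρ : Site → ℝ} {A : Op} {C : ℕ → ℝ} (h : LocC ρ A C) : LocC ρ (-A) C :=
  fun N j k => by simpa using h N j k

theorem LocC.sub {ρ : Site → ℝ} {A B : Op} {C D : ℕ → ℝ} (hρ : ∀ j, 0 < ρ j)
    (h : LocC ρ A C) (h' : LocC ρ B D) : LocC ρ (A - B) fun N => C N + D N :=
  sub_eq_add_neg A B ▸ h.add hρ h'.neg

/-- The inequality `dd j k ≤ dd j l * dd l k` shares the decay between the factors; moving the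
weight ρ between l and k costs t powers, and 3 more make the sum over l converge. The new constants
depend on ρ and σ only through t, C and D, hence they are uniform in the position of a cut. -/
theorem LocC.mul {t : ℕ} {ρ σ : Site → ℝ} {A B : Op} {C D : ℕ → ℝ} (hρ : Mod t ρ)
    (hσ : ∀ j, 0 < σ j) (h : LocC ρ A C) (h' : LocC σ B D) :
    LocC (fun k => ρ k * σ k) (A * B) fun N => C N * D (N + t + 3) * S3 := fun N j k => by
  have hp := dd_pos j k
  have hrk := hρ.1 k
  have hsk := hσ k
  have hterm : ∀ l, ‖ent A j l * ent B l k‖ * (dd j k ^ N * (ρ k * σ k))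
      ≤ C N * D (N + t + 3) * (dd l k ^ 3)⁻¹ := fun l => by
    have h1 := h N j l
    have h2 := h' (N + t + 3) l k
    have hl := dd_pos l k
    have hjl := dd_pos j l
    have hrl := hρ.1 l
    have e1 : dd j k ^ N ≤ dd j l ^ N * dd l k ^ N := by
      rw [← mul_pow]; exact pow_le_pow_left₀ hp.le (dd_le_mul j l k) N
    have e2 : ρ k ≤ ρ l * dd l k ^ t := by rw [dd_comm l k]; exact hρ.2 k l
    calc ‖ent A j l * ent B l k‖ * (dd j k ^ N * (ρ k * σ k))
        ≤ ‖ent A j l * ent B l k‖ * ((dd j l ^ N * dd l k ^ N) * ((ρ l * dd l k ^ t) * σ k)) := by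
          gcongr
      _ = (‖ent A j l‖ * dd j l ^ N * ρ l) * (‖ent B l k‖ * dd l k ^ (N + t + 3) * σ k)
          * (dd l k ^ 3)⁻¹ := by
          rw [norm_mul, pow_add, pow_add]; field_simp
      _ ≤ _ := by
          gcongr
          exact h.nonneg hρ.1 N
  rw [mul_assoc]
  have hsum := (hasSum_dd k).mul_left (C N * D (N + t + 3))
  have hpos : 0 < dd j k ^ N * (ρ k * σ k) := by positivity
  rw [← le_div_iff₀ hpos]
  rw [← (hasSum_ent_mul A B j k).tsum_eq]
  refine tsum_of_norm_bounded (hsum.div_const _) fun l => ?_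
  rw [le_div_iff₀ hpos]
  exact hterm l

theorem Loc.add {ρ : Site → ℝ} {A B : Op} (hρ : ∀ j, 0 < ρ j) (h : Loc ρ A) (h' : Loc ρ B) :
    Loc ρ (A + B) := h.elim fun _ h => h'.elim fun _ h' => ⟨_, h.add hρ h'⟩

theorem Loc.sub {ρ : Site → ℝ} {A B : Op} (hρ : ∀ j, 0 < ρ j) (h : Loc ρ A) (h' : Loc ρ B) :
    Loc ρ (A - B) := h.elim fun _ h => h'.elim fun _ h' => ⟨_, h.sub hρ h'⟩

theorem Loc.mul {t : ℕ} {ρ σ : Site → ℝ} {A B : Op} (hρ : Mod t ρ) (hσ : ∀ j, 0 < σ j)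
    (h : Loc ρ A) (h' : Loc σ B) : Loc (fun k => ρ k * σ k) (A * B) :=
  h.elim fun _ h => h'.elim fun _ h' => ⟨_, h.mul hρ hσ h'⟩

theorem Loc.mul_one_left {ρ : Site → ℝ} {A B : Op} (hρ : ∀ j, 0 < ρ j)
    (h : Loc (fun _ => 1) A) (h' : Loc ρ B) : Loc ρ (A * B) := by
  simpa only [one_mul] using h.mul mod_one hρ h'

theorem Loc.mul_one_right {t : ℕ} {ρ : Site → ℝ} {A B : Op} (hρ : Mod t ρ)
    (h : Loc ρ A) (h' : Loc (fun _ => 1) B) : Loc ρ (A * B) := by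
  simpa only [mul_one] using h.mul hρ (fun _ => one_pos) h'

theorem LocC.absSum {ρ : Site → ℝ} {A : Op} {C : ℕ → ℝ} (h : LocC ρ A C) (hρ : ∀ j, 0 < ρ j)
    (hs : Summable fun k => (ρ k)⁻¹) : AbsSum A := by
  have h1 : Summable fun p : Site × Site => ((1 + ‖p.1‖) ^ 3)⁻¹ * (ρ p.2)⁻¹ :=
    summable_inv_one_add_norm_cube.mul_of_nonneg hs (fun _ => by positivity)
      (fun k => inv_nonneg.2 (hρ k).le)
  let e : Site × Site ≃ Site × Site :=
    { toFun := fun p => (p.1 - p.2, p.2)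
      invFun := fun p => (p.1 + p.2, p.2)
      left_inv := fun p => by simp
      right_inv := fun p => by simp }
  have h2 := (e.summable_iff.2 h1).mul_left (C 3)
  refine Summable.of_nonneg_of_le (fun _ => norm_nonneg _) (fun p => ?_) h2
  exact (h.norm_le hρ 3 p.1 p.2).trans_eq (mul_assoc _ _ _)

theorem Loc.absSum {ρ : Site → ℝ} {A : Op} (h : Loc ρ A) (hρ : ∀ j, 0 < ρ j)
    (hs : Summable fun k => (ρ k)⁻¹) : AbsSum A := h.elim fun _ h => h.absSum hρ hs

theorem LocC.norm_tr_le {ρ : Site → ℝ} {A : Op} {C : ℕ → ℝ} (h : LocC ρ A C) (hρ : ∀ j, 0 < ρ j)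
    (hs : Summable fun k => (ρ k)⁻¹) : ‖tr A‖ ≤ C 0 * ∑' k, (ρ k)⁻¹ := by
  rw [← (h.absSum hρ hs).isNuc.hasSum_ent.tsum_eq]
  refine tsum_of_norm_bounded (hs.hasSum.mul_left (C 0)) fun j => ?_
  simpa using h.norm_le hρ 0 j j

/-- Off-diagonal decay allows the three weights to be collected at one vertex, where their product
is summable; the differences to the other two vertices are summed by the cubic decay. The sum over
triangles is thus absolute and may be rearranged later. -/
theorem hasSum_triple {t t' t'' : ℕ} {ρ σ κ : Site → ℝ} {A B D : Op} (hρ : Mod t ρ)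
    (hσ : Mod t' σ) (hκ : Mod t'' κ) (hs : Summable fun k => (ρ k * σ k * κ k)⁻¹) (hA : Loc ρ A)
    (hB : Loc σ B) (hD : Loc κ D) :
    HasSum (fun p : Site × Site × Site => ent A p.1 p.2.1 * ent B p.2.1 p.2.2 * ent D p.2.2 p.1)
      (tr (A * B * D)) := by
  have hnuc : IsNuc (A * B * D) :=
    ((hA.mul hρ hσ.1 hB).mul (hρ.mul hσ) hκ.1 hD).absSum ((hρ.mul hσ).mul hκ).1 hs |>.isNuc
  obtain ⟨a, hA⟩ := hA
  obtain ⟨b, hB⟩ := hB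
  obtain ⟨d, hD⟩ := hD
  have hsum : Summable fun p : Site × Site × Site =>
      ent A p.1 p.2.1 * ent B p.2.1 p.2.2 * ent D p.2.2 p.1 := by
    have h1 : Summable fun p : Site × Site × Site => ((1 + ‖p.1‖) ^ 3)⁻¹ *
        ((ρ p.2.1 * σ p.2.1 * κ p.2.1)⁻¹ * ((1 + ‖p.2.2‖) ^ 3)⁻¹) :=
      summable_inv_one_add_norm_cube.mul_of_nonneg
        (hs.mul_of_nonneg summable_inv_one_add_norm_cube
          (fun k => inv_nonneg.2 (((hρ.mul hσ).mul hκ).1 k).le) (fun _ => by positivity))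
        (fun _ => by positivity)
        (fun p => mul_nonneg (inv_nonneg.2 (((hρ.mul hσ).mul hκ).1 p.1).le) (by positivity))
    let e : Site × Site × Site ≃ Site × Site × Site :=
      { toFun := fun p => (p.1 - p.2.1, p.2.1, p.2.1 - p.2.2)
        invFun := fun p => (p.1 + p.2.1, p.2.1, p.2.1 - p.2.2)
        left_inv := fun p => by simp
        right_inv := fun p => by simp }
    have h2 := (e.summable_iff.2 h1).mul_left (a (3 + t'') * b (3 + t') * d 0)
    refine Summable.of_norm_bounded h2 fun p => ?_
    obtain ⟨j, k, l⟩ := p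
    have hrk := hρ.1 k
    have hsk := hσ.1 k
    have hsl := hσ.1 l
    have hkl := dd_pos k l
    have hjk := dd_pos j k
    have hκk := hκ.1 k
    have hκj := hκ.1 j
    have i1 := hA.norm_le hρ.1 (3 + t'') j k
    have i2 := hB.norm_le hσ.1 (3 + t') k l
    have i3 := hD.norm_le hκ.1 0 l j
    have i4 : (dd k l ^ (3 + t'))⁻¹ * (σ l)⁻¹ ≤ (dd k l ^ 3)⁻¹ * (σ k)⁻¹ := by
      rw [← mul_inv, ← mul_inv]
      refine inv_anti₀ (by positivity) ?_
      rw [pow_add, mul_assoc, mul_comm (dd k l ^ t')]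
      exact mul_le_mul_of_nonneg_left (hσ.2 k l) (by positivity)
    have i5 : ‖ent B k l‖ ≤ b (3 + t') * ((dd k l ^ 3)⁻¹ * (σ k)⁻¹) :=
      i2.trans (by
        rw [mul_assoc]
        exact mul_le_mul_of_nonneg_left i4 (hB.nonneg hσ.1 _))
    have i6 : (dd j k ^ (3 + t''))⁻¹ * (κ j)⁻¹ ≤ (dd j k ^ 3)⁻¹ * (κ k)⁻¹ := by
      rw [← mul_inv, ← mul_inv]
      refine inv_anti₀ (by positivity) ?_
      rw [pow_add, mul_assoc, mul_comm (dd j k ^ t''), dd_comm j k]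
      exact mul_le_mul_of_nonneg_left (hκ.2 k j) (pow_nonneg (dd_pos _ _).le _)
    have hd := hD.nonneg hκ.1 0
    have ha := hA.nonneg hρ.1 (3 + t'')
    have hb := hB.nonneg hσ.1 (3 + t')
    rw [norm_mul, norm_mul]
    calc ‖ent A j k‖ * ‖ent B k l‖ * ‖ent D l j‖
        ≤ (a (3 + t'') * (dd j k ^ (3 + t''))⁻¹ * (ρ k)⁻¹)
          * (b (3 + t') * ((dd k l ^ 3)⁻¹ * (σ k)⁻¹)) * (d 0 * (κ j)⁻¹) := by
          gcongr
          simpa using i3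
      _ = a (3 + t'') * (ρ k)⁻¹ * (b (3 + t') * ((dd k l ^ 3)⁻¹ * (σ k)⁻¹)) * d 0
          * ((dd j k ^ (3 + t''))⁻¹ * (κ j)⁻¹) := by ring
      _ ≤ a (3 + t'') * (ρ k)⁻¹ * (b (3 + t') * ((dd k l ^ 3)⁻¹ * (σ k)⁻¹)) * d 0
          * ((dd j k ^ 3)⁻¹ * (κ k)⁻¹) := by gcongr
      _ = _ := by
          simp only [Function.comp_apply, e, Equiv.coe_fn_mk, dd]
          rw [mul_inv, mul_inv (ρ k)]
          ring
  have hfib : ∀ j, HasSum (fun p : Site × Site => ent A j p.1 * ent B p.1 p.2 * ent D p.2 j)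
      (ent (A * B * D) j j) := fun j => by
    have hj : Summable fun p : Site × Site => ent A j p.1 * ent B p.1 p.2 * ent D p.2 j :=
      hsum.prod_factor j
    have h1 : HasSum (fun k => ent A j k * ent (B * D) k j)
        (∑' p : Site × Site, ent A j p.1 * ent B p.1 p.2 * ent D p.2 j) := by
      refine hj.hasSum.prod_fiberwise fun k => ?_
      simpa only [mul_assoc] using (hasSum_ent_mul B D k j).mul_left (ent A j k)
    rw [mul_assoc, (hasSum_ent_mul A (B * D) j j).unique h1]
    exact hj.hasSum
  have h := hsum.hasSum.prod_fiberwise hfib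
  rw [hnuc.hasSum_ent.unique h]
  exact hsum.hasSum

/-! ### Cut functions -/

/-- The multiplication by the indicator function of `{n : f n ≤ c}`. -/
def cutOp (f : Site → ℤ) (c : ℤ) : Op :=
  mulOp (fun n => if f n ≤ c then 1 else 0) ⟨1, fun n => by split_ifs <;> simp⟩

/-- The function `1 + |f n - c|`. -/
def cutWt (f : Site → ℤ) (c : ℤ) (n : Site) : ℝ := 1 + |((f n - c : ℤ) : ℝ)|

theorem one_le_cutWt (f : Site → ℤ) (c : ℤ) (n : Site) : 1 ≤ cutWt f c n := by simp [cutWt]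

theorem mod_cutWt {f : Site → ℤ} (hf : ∀ j k, |((f j - f k : ℤ) : ℝ)| ≤ ‖j - k‖) (c : ℤ) (s : ℕ) :
    Mod s fun k => cutWt f c k ^ s := by
  refine mod_pow (one_le_cutWt f c) (fun j k => ?_) s
  have h1 := hf j k
  have h2 := abs_add_le ((f j - f k : ℤ) : ℝ) ((f k - c : ℤ) : ℝ)
  have h3 : ((f j - f k : ℤ) : ℝ) + ((f k - c : ℤ) : ℝ) = ((f j - c : ℤ) : ℝ) := by
    push_cast; ring
  rw [h3] at h2
  simp only [cutWt]
  linarith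

theorem cutWt_le_dd {f : Site → ℤ} (hf : ∀ j k, |((f j - f k : ℤ) : ℝ)| ≤ ‖j - k‖) (c : ℤ)
    (j k : Site) (h : ¬(f j ≤ c ↔ f k ≤ c)) : cutWt f c k ≤ dd j k := by
  have h1 := hf j k
  have : |f k - c| ≤ |f j - f k| := by
    rcases le_or_gt (f j) c with hj | hj <;> rcases le_or_gt (f k) c with hk | hk
    · exact absurd (iff_of_true hj hk) h
    · rw [abs_of_pos (by omega), abs_of_neg (by omega)]; omega
    · rw [abs_of_nonpos (by omega), abs_of_pos (by omega)]; omega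
    · exact absurd (iff_of_false (by omega) (by omega)) h
  have h2 : |((f k - c : ℤ) : ℝ)| ≤ |((f j - f k : ℤ) : ℝ)| := by exact_mod_cast this
  simp only [cutWt, dd]
  linarith

theorem ent_cutOp_comm (f : Site → ℤ) (c : ℤ) (A : Op) (j k : Site) :
    ent (cutOp f c * A - A * cutOp f c) j k
      = ((if f j ≤ c then 1 else 0) - (if f k ≤ c then 1 else 0)) * ent A j k := by
  rw [ent_sub, cutOp, ent_mulOp_mul, ent_mul_mulOp]
  ring

/-- The commutator only has entries between sites separated by the cut. For these the distance to
the cut is at most the distance of the two sites, so s powers of off-diagonal decay turn into s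
powers of decay away from the cut. -/
theorem LocC.cutOp_comm {f : Site → ℤ} (hf : ∀ j k, |((f j - f k : ℤ) : ℝ)| ≤ ‖j - k‖) (c : ℤ)
    (s : ℕ) {ρ : Site → ℝ} {A : Op} {C : ℕ → ℝ} (hρ : ∀ j, 0 < ρ j) (h : LocC ρ A C) :
    LocC (fun k => cutWt f c k ^ s * ρ k) (cutOp f c * A - A * cutOp f c)
      fun N => C (N + s) := fun N j k => by
  have hd := dd_pos j k
  have hr := hρ k
  by_cases hjk : f j ≤ c ↔ f k ≤ c
  · rw [ent_cutOp_comm]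
    simp only [hjk, sub_self, zero_mul, norm_zero]
    exact h.nonneg hρ _
  · have h1 := cutWt_le_dd hf c j k hjk
    have h0 := one_le_cutWt f c k
    have hn : ‖ent (cutOp f c * A - A * cutOp f c) j k‖ ≤ ‖ent A j k‖ := by
      rw [ent_cutOp_comm, norm_mul]
      refine mul_le_of_le_one_left (norm_nonneg _) ?_
      split_ifs <;> simp
    calc _ ≤ ‖ent A j k‖ * dd j k ^ N * (dd j k ^ s * ρ k) := by
          have : cutWt f c k ^ s * ρ k ≤ dd j k ^ s * ρ k := by gcongr
          gcongr
      _ = ‖ent A j k‖ * dd j k ^ (N + s) * ρ k := by rw [pow_add]; ring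
      _ ≤ _ := h _ j k

theorem Loc.cutOp_comm {f : Site → ℤ} (hf : ∀ j k, |((f j - f k : ℤ) : ℝ)| ≤ ‖j - k‖) (c : ℤ)
    (s : ℕ) {ρ : Site → ℝ} {A : Op} (hρ : ∀ j, 0 < ρ j) (h : Loc ρ A) :
    Loc (fun k => cutWt f c k ^ s * ρ k) (cutOp f c * A - A * cutOp f c) :=
  h.elim fun _ h => ⟨_, h.cutOp_comm hf c s hρ⟩

theorem summable_int_inv_sq (c : ℤ) : Summable fun x : ℤ => ((1 + |((x - c : ℤ) : ℝ)|) ^ 2)⁻¹ := by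
  have h0 : Summable fun x : ℤ => ((1 + |(x : ℝ)|) ^ 2)⁻¹ := by
    have h := Real.summable_one_div_int_pow.2 (by norm_num : 1 < 2)
    refine Summable.of_norm_bounded_eventually h ?_
    filter_upwards [(Set.finite_singleton (0 : ℤ)).compl_mem_cofinite] with n hn
    have hn0 : 0 < |(n : ℝ)| := abs_pos.2 (Int.cast_ne_zero.2 hn)
    rw [Real.norm_of_nonneg (by positivity), one_div, ← sq_abs (n : ℝ)]
    gcongr
    linarith
  exact (Equiv.subRight c).summable_iff.2 h0

theorem summable_cutWt (c c' : ℤ) :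
    Summable fun k => (cutWt Prod.fst c k ^ 2 * cutWt Prod.snd c' k ^ 2)⁻¹ := by
  simp_rw [mul_inv]
  exact (summable_int_inv_sq c).mul_of_nonneg (summable_int_inv_sq c') (fun _ => by positivity)
    (fun _ => by positivity)

/-- `∑ₓ (1 + |x|)⁻²` over `x ∈ ℤ`. -/
def S2 : ℝ := ∑' x : ℤ, ((1 + |(x : ℝ)|) ^ 2)⁻¹

/-- Translation invariance: the bound does not see the position of the cuts, which later go to
infinity. -/
theorem tsum_cutWt (c c' : ℤ) :
    ∑' k, (cutWt Prod.fst c k ^ 2 * cutWt Prod.snd c' k ^ 2)⁻¹ = S2 * S2 := by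
  have h : ∀ c : ℤ, HasSum (fun x : ℤ => ((1 + |((x - c : ℤ) : ℝ)|) ^ 2)⁻¹) S2 := fun c => by
    have h1 : (∑' x : ℤ, ((1 + |((x - c : ℤ) : ℝ)|) ^ 2)⁻¹) = S2 :=
      (Equiv.subRight c).tsum_eq fun x : ℤ => ((1 + |(x : ℝ)|) ^ 2)⁻¹
    exact h1 ▸ (summable_int_inv_sq c).hasSum
  have hs := summable_cutWt c c'
  simp_rw [mul_inv] at hs ⊢
  exact ((h c).mul (h c') hs).tsum_eq

/-! ### Polynomial approximation of smooth functions -/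

open Polynomial in
theorem exists_derivative_eq (q : ℝ[X]) : ∃ p : ℝ[X], derivative p = q := by
  induction q using Polynomial.induction_on' with
  | add p q hp hq =>
    obtain ⟨p', rfl⟩ := hp
    obtain ⟨q', rfl⟩ := hq
    exact ⟨p' + q', derivative_add⟩
  | monomial n a =>
    refine ⟨monomial (n + 1) (a / (n + 1)), ?_⟩
    rw [derivative_monomial]
    have : (n : ℝ) + 1 ≠ 0 := by positivity
    congr 1
    push_cast
    field_simp

open Polynomial in
-- Weierstrass approximation is applied to the derivative and then integrated from 0. Integration
-- loses at most a factor c, so the accuracy ε / (1 + c) serves both estimates.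
theorem exists_polynomial_near_deriv {h : ℝ → ℝ} (hh : ContDiff ℝ ∞ h) {c : ℝ} (hc : 0 ≤ c) {ε : ℝ}
    (hε : 0 < ε) : ∃ p : ℝ[X], ∀ x ∈ Set.Icc (-c) c,
      |p.eval x - h x| ≤ ε ∧ |(derivative p).eval x - deriv h x| ≤ ε := by
  have hd : Continuous (deriv h) := hh.continuous_deriv (by norm_num)
  have hdiff : Differentiable ℝ h := hh.differentiable (by norm_num)
  have hδ : 0 < ε / (1 + c) := by positivity
  obtain ⟨q, hq⟩ := exists_polynomial_near_of_continuousOn (-c) c (deriv h) hd.continuousOn _ hδ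
  obtain ⟨p, hp⟩ := exists_derivative_eq q
  refine ⟨p + C (h 0 - p.eval 0), fun x hx => ⟨?_, ?_⟩⟩
  · have h1 := (convex_Icc (-c) c).norm_image_sub_le_of_norm_deriv_le
      (f := fun x => p.eval x - h x) (C := ε / (1 + c)) (x := 0) (y := x)
      (fun y _ => p.differentiable.differentiableAt.sub hdiff.differentiableAt)
      (fun y hy => by
        rw [deriv_fun_sub p.differentiableAt hdiff.differentiableAt, Polynomial.deriv, hp]
        exact (hq y hy).le) ⟨by linarith, hc⟩ hx
    have h2 : |x| ≤ c := abs_le.2 hx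
    rw [Real.norm_eq_abs, sub_zero, Real.norm_eq_abs] at h1
    have e : (p + C (h 0 - p.eval 0)).eval x - h x = p.eval x - h x - (p.eval 0 - h 0) := by
      simp; ring
    rw [e]
    refine h1.trans ?_
    rw [div_mul_eq_mul_div, div_le_iff₀ (by positivity)]
    nlinarith
  · simp only [derivative_add, derivative_C, add_zero, hp]
    refine (hq x hx).le.trans ?_
    rw [div_le_iff₀ (by positivity)]
    nlinarith

/-! ### Fourier coefficients and Jackson's theorem -/

open Real in
theorem two_pi_sub_zero_pos : Fact (0 < 2 * π - 0) := ⟨by simpa using two_pi_pos⟩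

open Real in
/-- The Fourier coefficients of a smooth periodic function decay rapidly. -/
theorem exists_norm_fourierCoeffOn_le (N : ℕ) (F : ℝ → ℂ) (hF : ContDiff ℝ ∞ F)
    (hper : Function.Periodic F (2 * π)) :
    ∃ C : ℝ, 0 ≤ C ∧ ∀ n : ℤ, n ≠ 0 →
      ‖fourierCoeffOn two_pi_pos F n‖ * |(n : ℝ)| ^ N ≤ C := by
  induction N generalizing F with
  | zero =>
    obtain ⟨B, hB⟩ := isCompact_Icc.exists_bound_of_continuousOn (s := Set.Icc 0 (2 * π))
      hF.continuous.continuousOn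
    have hB0 : 0 ≤ B := (norm_nonneg _).trans (hB 0 ⟨le_rfl, two_pi_pos.le⟩)
    refine ⟨B, hB0, fun n _ => ?_⟩
    rw [pow_zero, mul_one, fourierCoeffOn_eq_integral, norm_smul]
    have h1 : ‖∫ x in (0 : ℝ)..2 * π, fourier (-n) (x : AddCircle (2 * π - 0)) • F x‖
        ≤ B * |2 * π - 0| := by
      refine intervalIntegral.norm_integral_le_of_norm_le_const fun x hx => ?_
      rw [Set.uIoc_of_le two_pi_pos.le] at hx
      rw [norm_smul, fourier_apply, Circle.norm_coe, one_mul]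
      exact hB x ⟨hx.1.le, hx.2⟩
    have h2 : (0 : ℝ) < 2 * π - 0 := by simpa using two_pi_pos
    rw [abs_of_pos h2] at h1
    rw [norm_of_nonneg (by positivity), one_div]
    calc _ ≤ (2 * π - 0)⁻¹ * (B * (2 * π - 0)) := by gcongr
      _ = B := by field_simp
  | succ N ih =>
    have hd : ContDiff ℝ ∞ (deriv F) := (contDiff_infty_iff_deriv.1 hF).2
    have hdp : Function.Periodic (deriv F) (2 * π) := fun x => by
      have : (fun y => F (y + 2 * π)) = F := funext hper
      rw [← deriv_comp_add_const F (2 * π) x, this]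
    obtain ⟨C, hC, h⟩ := ih (deriv F) hd hdp
    refine ⟨C, hC, fun n hn => ?_⟩
    -- Integration by parts gains one power of n per derivative; the boundary term vanishes by
    -- periodicity.
    have hpart := fourierCoeffOn_of_hasDerivAt two_pi_pos hn (f := F) (f' := deriv F)
      (fun x _ => (hF.differentiable (by norm_num)).differentiableAt.hasDerivAt)
      (hd.continuous.intervalIntegrable _ _)
    have hF0 : F (2 * π) - F 0 = 0 := by
      have := hper 0
      rw [zero_add] at this
      rw [this, sub_self]
    have hn' : (n : ℂ) ≠ 0 := Int.cast_ne_zero.2 hn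
    have hpi : (π : ℂ) ≠ 0 := Complex.ofReal_ne_zero.2 pi_ne_zero
    have e : fourierCoeffOn two_pi_pos F n * n =
        -Complex.I * fourierCoeffOn two_pi_pos (deriv F) n := by
      rw [hpart, hF0]
      push_cast
      field_simp
      ring_nf
      simp
    have e2 : ‖fourierCoeffOn two_pi_pos F n‖ * |(n : ℝ)|
        = ‖fourierCoeffOn two_pi_pos (deriv F) n‖ := by
      have := congrArg norm e
      simpa using this
    rw [pow_succ', ← mul_assoc, e2]
    exact h n hn

open Real in
theorem hasSum_fourierCoeffOn {F : ℝ → ℂ} (hF : ContDiff ℝ ∞ F)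
    (hper : Function.Periodic F (2 * π)) (x : ℝ) :
    HasSum (fun n : ℤ => fourierCoeffOn two_pi_pos F n * Complex.exp (n * x * Complex.I)) (F x) := by
  have hT := two_pi_sub_zero_pos
  have hper' : Function.Periodic F (2 * π - 0) := by simpa using hper
  have hcont : Continuous hper'.lift := continuous_coinduced_dom.2 hF.continuous
  let G : C(AddCircle (2 * π - 0), ℂ) := ⟨hper'.lift, hcont⟩
  have hG : ∀ n, fourierCoeff G n = fourierCoeffOn two_pi_pos F n := fun n => by
    rw [fourierCoeff_eq_intervalIntegral _ _ 0, fourierCoeffOn_eq_integral, zero_add]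
    congr 1
    change ∫ x in (0 : ℝ)..(2 * π - 0), fourier (-n) (x : AddCircle (2 * π - 0)) • F x = _
    congr 1
    exact sub_zero _
  obtain ⟨C, hC, h⟩ := exists_norm_fourierCoeffOn_le 2 F hF hper
  have hs : Summable (fourierCoeff G) := by
    have h1 := (Real.summable_one_div_int_pow.2 (by norm_num : 1 < 2)).mul_left C
    refine Summable.of_norm_bounded_eventually h1 ?_
    filter_upwards [(Set.finite_singleton (0 : ℤ)).compl_mem_cofinite] with n hn
    have hn0 : 0 < |(n : ℝ)| := abs_pos.2 (Int.cast_ne_zero.2 hn)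
    rw [hG, ← sq_abs, mul_one_div, le_div_iff₀ (by positivity)]
    exact h n hn
  refine (has_pointwise_sum_fourier_series_of_summable hs (x : AddCircle (2 * π - 0))).congr_fun
    fun n => ?_
  rw [hG, smul_eq_mul, fourier_coe_apply]
  congr 2
  have hpi : (π : ℂ) ≠ 0 := Complex.ofReal_ne_zero.2 pi_ne_zero
  push_cast
  field_simp
  rw [sub_zero]
  ring

open Real Polynomial in
/-- Jackson's theorem for smooth functions. -/
theorem exists_polynomial_approx {f : ℝ → ℝ} (hf : ContDiff ℝ ∞ f) {c : ℝ} (hc : 0 < c) (N : ℕ) :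
    ∃ C : ℝ, 0 ≤ C ∧ ∀ M : ℕ, ∃ p : ℝ[X], p.natDegree ≤ M ∧
      ∀ x ∈ Set.Icc (-c) c, |f x - p.eval x| * (M + 1 : ℝ) ^ N ≤ C := by
  -- With x = c cos θ the function becomes smooth and periodic, and cos(nθ) is the Chebyshev
  -- polynomial of degree |n| in x / c. Truncated cosine series are therefore polynomials.
  let F : ℝ → ℂ := fun θ => (f (c * cos θ) : ℂ)
  have hF : ContDiff ℝ ∞ F :=
    Complex.ofRealCLM.contDiff.comp (hf.comp (contDiff_const.mul contDiff_cos))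
  have hper : Function.Periodic F (2 * π) := fun θ => by simp [F]
  set a : ℤ → ℝ := fun n => (fourierCoeffOn two_pi_pos F n).re with ha
  have hsum : ∀ θ, HasSum (fun n : ℤ => a n * cos (n * θ)) (f (c * cos θ)) := fun θ => by
    -- F is even and real, so averaging the series at θ and -θ and taking real parts leaves cosines
    -- only.
    have h1 := hasSum_fourierCoeffOn hF hper θ
    have h2 := hasSum_fourierCoeffOn hF hper (-θ)
    have h3 := Complex.hasSum_re ((h1.add h2).div_const 2)
    have e : ((F θ + F (-θ)) / 2).re = f (c * cos θ) := by
      simp only [F, cos_neg]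
      rw [← two_mul, mul_div_cancel_left₀ _ two_ne_zero, Complex.ofReal_re]
    rw [e] at h3
    refine h3.congr_fun fun n => ?_
    have e2 : Complex.exp (n * (θ : ℝ) * Complex.I) + Complex.exp (n * ((-θ : ℝ) : ℂ) * Complex.I)
        = ((2 * cos (n * θ) : ℝ) : ℂ) := by
      push_cast
      rw [Complex.two_cos]
      congr 2
      ring
    rw [← mul_add, e2, Complex.ofReal_mul, Complex.ofReal_ofNat, mul_div_assoc,
      mul_div_cancel_left₀ _ two_ne_zero, Complex.re_mul_ofReal]
  -- N powers give the rate of approximation, the other two make the tail summable.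
  obtain ⟨C, hC, hdec⟩ := exists_norm_fourierCoeffOn_le (N + 2) F hF hper
  have hs2 := Real.summable_one_div_int_pow.2 (by norm_num : 1 < 2)
  set s : ℝ := ∑' n : ℤ, 1 / (n : ℝ) ^ 2 with hsdef
  have hs0 : 0 ≤ s := tsum_nonneg fun n => by positivity
  refine ⟨C * s, by positivity, fun M => ?_⟩
  refine ⟨∑ n ∈ Finset.Icc (-(M : ℤ)) M,
    Polynomial.C (a n) * (Chebyshev.T ℝ n).comp (Polynomial.C c⁻¹ * X), ?_, fun x hx => ?_⟩
  · refine natDegree_sum_le_of_forall_le _ _ fun n hn => ?_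
    refine (natDegree_C_mul_le _ _).trans (natDegree_comp_le.trans ?_)
    rw [Chebyshev.natDegree_T]
    have h1 : (Polynomial.C c⁻¹ * X : ℝ[X]).natDegree ≤ 1 := (natDegree_C_mul_le _ _).trans natDegree_X_le
    rw [Finset.mem_Icc] at hn
    calc _ ≤ n.natAbs * 1 := Nat.mul_le_mul_left _ h1
      _ ≤ M := by omega
  · obtain ⟨θ, rfl⟩ : ∃ θ, c * cos θ = x := by
      refine ⟨arccos (x / c), ?_⟩
      rw [cos_arccos, mul_div_cancel₀ _ hc.ne']
      · rw [le_div_iff₀ hc]; linarith [hx.1]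
      · rw [div_le_iff₀ hc]; linarith [hx.2]
    have hev : (∑ n ∈ Finset.Icc (-(M : ℤ)) M,
        Polynomial.C (a n) * (Chebyshev.T ℝ n).comp (Polynomial.C c⁻¹ * X)).eval (c * cos θ)
        = ∑ n ∈ Finset.Icc (-(M : ℤ)) M, a n * cos (n * θ) := by
      rw [eval_finsetSum]
      refine Finset.sum_congr rfl fun n _ => ?_
      rw [eval_mul, eval_C, eval_comp, eval_mul, eval_C, eval_X, inv_mul_cancel_left₀ hc.ne',
        Chebyshev.T_real_cos]
    rw [hev]
    have htail : HasSum (fun n : {n // n ∉ Finset.Icc (-(M : ℤ)) M} => a n * cos (n * θ))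
        (f (c * cos θ) - ∑ n ∈ Finset.Icc (-(M : ℤ)) M, a n * cos (n * θ)) := by
      refine (Finset.hasSum_compl_iff (f := fun n : ℤ => a n * cos (n * θ)) _).2 ?_
      simpa using hsum θ
    have hM : (0 : ℝ) < (M + 1 : ℝ) ^ N := by positivity
    rw [← le_div_iff₀ hM, ← htail.tsum_eq, ← Real.norm_eq_abs]
    have hle : ∑' n : {n // n ∉ Finset.Icc (-(M : ℤ)) M},
        C / (M + 1 : ℝ) ^ N * (1 / ((n : ℤ) : ℝ) ^ 2) ≤ C * s / (M + 1 : ℝ) ^ N := by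
      rw [tsum_mul_left, mul_div_right_comm]
      refine mul_le_mul_of_nonneg_left ?_ (by positivity)
      exact hs2.tsum_subtype_le _ {n | n ∉ Finset.Icc (-(M : ℤ)) M} fun n => by positivity
    refine le_trans (tsum_of_norm_bounded
      ((hs2.subtype {n | n ∉ Finset.Icc (-(M : ℤ)) M}).mul_left _).hasSum fun n => ?_) hle
    obtain ⟨n, hn⟩ := n
    have hn0 : n ≠ 0 := by
      rintro rfl
      exact hn (Finset.mem_Icc.2 ⟨by omega, by omega⟩)
    have hnM : (M + 1 : ℝ) ≤ |(n : ℝ)| := by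
      have h1 : ¬|n| ≤ (M : ℤ) := fun h => hn (Finset.mem_Icc.2 (abs_le.1 h))
      exact_mod_cast Int.add_one_le_of_lt (not_le.1 h1)
    have hnpos : 0 < |(n : ℝ)| := by linarith [show (0 : ℝ) ≤ M from Nat.cast_nonneg M]
    have h1 := hdec n hn0
    have h2 : ‖a n * cos (n * θ)‖ ≤ ‖fourierCoeffOn two_pi_pos F n‖ := by
      rw [norm_mul]
      refine (mul_le_of_le_one_right (norm_nonneg _) (abs_cos_le_one _)).trans ?_
      exact Complex.abs_re_le_norm _
    simp only [Function.comp_apply]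
    rw [← sq_abs (n : ℝ), div_mul_div_comm, mul_one, le_div_iff₀ (by positivity)]
    calc _ ≤ ‖fourierCoeffOn two_pi_pos F n‖ * (|(n : ℝ)| ^ N * |(n : ℝ)| ^ 2) := by gcongr
      _ ≤ C := by rw [← pow_add]; exact h1

/-! ### Functions of finite-range operators -/

section FiniteRange

variable {I : Type} [DecidableEq I]

/-- The matrix entries between points at distance more than `r` vanish. -/
def FinRange (pos : I → Site) (r : ℝ) (A : Hil I →L[ℂ] Hil I) : Prop :=
  ∀ j k, r < ‖pos j - pos k‖ → ent A j k = 0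

theorem FinRange.pow {pos : I → Site} {r : ℝ} {A : Hil I →L[ℂ] Hil I} (h : FinRange pos r A)
    (n : ℕ) : FinRange pos (n * r) (A ^ n) := by
  induction n with
  | zero =>
    intro j k hjk
    rw [pow_zero, ent_one, if_neg]
    rintro rfl
    simp at hjk
  | succ n ih =>
    intro j k hjk
    rw [pow_succ', ← (hasSum_ent_mul A (A ^ n) j k).tsum_eq]
    refine (tsum_congr fun l => ?_).trans tsum_zero
    rcases lt_or_ge r ‖pos j - pos l‖ with hl | hl
    · rw [h j l hl, zero_mul]
    · rw [ih l k, mul_zero]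
      have := norm_sub_le_norm_sub_add_norm_sub (pos j) (pos l) (pos k)
      push_cast at hjk
      linarith

theorem ent_real_smul (c : ℝ) (A : Hil I →L[ℂ] Hil I) (j k : I) :
    ent (c • A) j k = c * ent A j k := by
  change c • ent A j k = _
  exact Complex.real_smul

open Polynomial in
theorem ent_aeval (A : Hil I →L[ℂ] Hil I) (p : ℝ[X]) (j k : I) :
    ent (aeval A p) j k = ∑ i ∈ Finset.range (p.natDegree + 1), (p.coeff i : ℂ) * ent (A ^ i) j k := by
  rw [aeval_eq_sum_range]
  have : ∀ s : Finset ℕ, ent (∑ i ∈ s, p.coeff i • A ^ i) j k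
      = ∑ i ∈ s, (p.coeff i : ℂ) * ent (A ^ i) j k := fun s => by
    induction s using Finset.cons_induction with
    | empty => simp
    | cons a s ha ih => rw [Finset.sum_cons, Finset.sum_cons, ent_add, ih, ent_real_smul]
  exact this _

end FiniteRange

section FuncCalc

variable {E : Type} [NormedAddCommGroup E] [InnerProductSpace ℂ E] [CompleteSpace E]

open Polynomial in
theorem norm_aeval_sub_funcCalc_le {K : E →L[ℂ] E} (hK : IsSelfAdjoint K) {f : ℝ → ℝ}
    (hf : Continuous f) (p : ℝ[X]) {ε : ℝ} (hε : 0 ≤ ε)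
    (h : ∀ x ∈ Set.Icc (-(‖K‖ + 1)) (‖K‖ + 1), |p.eval x - f x| ≤ ε) :
    ‖aeval K p - funcCalc f K‖ ≤ ε := by
  rw [funcCalc, ← cfc_polynomial p K hK, ← cfc_sub _ _ K
    (p.continuous.continuousOn) hf.continuousOn]
  refine norm_cfc_le hε fun x hx => h x ?_
  rcases subsingleton_or_nontrivial E with hE | hE
  · have : Subsingleton (E →L[ℂ] E) := ⟨fun a b => by ext x; exact Subsingleton.elim _ _⟩
    simp [spectrum.of_subsingleton] at hx
  · have h1 := spectrum.norm_le_norm_of_mem hx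
    rw [Real.norm_eq_abs] at h1
    have := abs_le.1 h1
    constructor <;> linarith

theorem funcCalc_mul {K : E →L[ℂ] E} {f h : ℝ → ℝ} (hf : Continuous f) (hh : Continuous h) :
    funcCalc (fun x => f x * h x) K = funcCalc f K * funcCalc h K :=
  cfc_mul f h K hf.continuousOn hh.continuousOn

theorem funcCalc_sub {K : E →L[ℂ] E} {f h : ℝ → ℝ} (hf : Continuous f) (hh : Continuous h) :
    funcCalc (fun x => f x - h x) K = funcCalc f K - funcCalc h K :=
  cfc_sub f h K hf.continuousOn hh.continuousOn

theorem funcCalc_smul {K : E →L[ℂ] E} {f : ℝ → ℝ} (c : ℝ) (hf : Continuous f) :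
    funcCalc (fun x => c * f x) K = (c : ℂ) • funcCalc f K := by
  have := cfc_smul c f K hf.continuousOn
  rw [Complex.coe_smul]
  exact this

theorem isSelfAdjoint_funcCalc (f : ℝ → ℝ) (K : E →L[ℂ] E) : IsSelfAdjoint (funcCalc f K) :=
  cfc_predicate f K

theorem funcCalc_eq_zero {K : E →L[ℂ] E} {f : ℝ → ℝ} (h : ∀ x ∈ spectrum ℝ K, f x = 0) :
    funcCalc f K = 0 := by
  rw [funcCalc, cfc_congr (g := fun _ => 0) h]
  exact cfc_const_zero ℝ K

end FuncCalc

open Polynomial in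
/-- Quantities which are approximated by polynomials in a finite-range operator decay rapidly. -/
theorem exists_decay {ι : Type*} {f : ℝ → ℝ} (hf : ContDiff ℝ ∞ f) {c : ℝ} (hc : 0 < c) {r : ℝ}
    (hr : 1 ≤ r) (x : ι → ℂ) (D : ι → ℝ) (B : ℝ) (hB : ∀ i, ‖x i‖ ≤ B)
    (h : ∀ i (M : ℕ) (p : ℝ[X]) (ε : ℝ), 0 ≤ ε → p.natDegree ≤ M → M * r < D i →
      (∀ y ∈ Set.Icc (-c) c, |p.eval y - f y| ≤ ε) → ‖x i‖ ≤ 2 * ε) (N : ℕ) :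
    ∃ C : ℝ, ∀ i, ‖x i‖ * (1 + max (D i) 0) ^ N ≤ C := by
  obtain ⟨C, hC, hJ⟩ := exists_polynomial_approx hf hc N
  refine ⟨max B (2 * C * (2 * r) ^ N), fun i => ?_⟩
  rcases le_or_gt (D i) 0 with hD | hD
  · rw [max_eq_right hD]
    simpa using Or.inl (hB i)
  · refine le_max_of_le_right ?_
    rw [max_eq_left hD.le]
    -- M is the largest admissible degree. Since r ≥ 1, also 1 + D ≤ 2r (M + 1), so an error of
    -- order (M + 1)⁻ᴺ is one of order (1 + D)⁻ᴺ.
    obtain ⟨M, hM1, hM2⟩ : ∃ M : ℕ, M * r < D i ∧ D i ≤ (M + 1) * r := by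
      have hpos : 0 < D i / r := by positivity
      have h1 : 0 < ⌈D i / r⌉₊ := Nat.ceil_pos.2 hpos
      obtain ⟨M, hM⟩ := Nat.exists_eq_succ_of_ne_zero h1.ne'
      refine ⟨M, ?_, ?_⟩
      · rw [← lt_div_iff₀ (by positivity)]
        exact Nat.lt_ceil.1 (by omega)
      · rw [← div_le_iff₀ (by positivity)]
        have := Nat.le_ceil (D i / r)
        rw [hM] at this
        simpa using this
    obtain ⟨p, hp, hpf⟩ := hJ M
    have hMp : (0 : ℝ) < (M + 1 : ℝ) ^ N := by positivity
    have h1 := h i M p (C / (M + 1 : ℝ) ^ N) (by positivity) hp hM1 fun y hy => by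
      rw [abs_sub_comm, le_div_iff₀ hMp]
      exact hpf y hy
    calc ‖x i‖ * (1 + D i) ^ N ≤ 2 * (C / (M + 1 : ℝ) ^ N) * ((2 * r) * (M + 1)) ^ N := by
          gcongr
          nlinarith [show (0 : ℝ) ≤ M from Nat.cast_nonneg M]
      _ = 2 * C * (2 * r) ^ N := by rw [mul_pow]; field_simp

/-! ### The half-plane -/

theorem restrictUpper_ket (n : Site) :
    restrictUpper (ket n) = if h : 0 < n.2 then ket ⟨n, h⟩ else 0 := by
  ext j
  rw [restrictUpper_apply, ket_apply]
  split_ifs with h1 h2 h2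
  · subst h1
    rw [ket_apply, if_pos rfl]
  · exact absurd (h1 ▸ j.2) h2
  · rw [ket_apply, if_neg]
    rintro rfl
    exact h1 rfl
  · rfl

theorem adjoint_restrictUpper_apply (φ : Hil UpperSite) (n : Site) :
    ContinuousLinearMap.adjoint restrictUpper φ n = if h : 0 < n.2 then φ ⟨n, h⟩ else 0 := by
  rw [← inner_ket, ContinuousLinearMap.adjoint_inner_right, restrictUpper_ket]
  split_ifs with h
  · exact inner_ket _ _
  · exact inner_zero_left _

theorem restrictUpper_adjoint (φ : Hil UpperSite) :
    restrictUpper (ContinuousLinearMap.adjoint restrictUpper φ) = φ := by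
  ext j
  rw [restrictUpper_apply, adjoint_restrictUpper_apply, dif_pos j.2]

theorem adjoint_restrictUpper_ket (n : UpperSite) :
    ContinuousLinearMap.adjoint restrictUpper (ket n) = ket n.1 := by
  ext j
  rw [adjoint_restrictUpper_apply, ket_apply]
  split_ifs with h1 h2 h2
  · subst h2; simp
  · rw [ket_apply, if_neg]
    rintro rfl
    exact h2 rfl
  · exact absurd (h2 ▸ n.2) h1
  · rfl

/-- The extension of an operator on the half-plane space by zero. -/
def lift (A : Hil UpperSite →L[ℂ] Hil UpperSite) : Op :=
  ContinuousLinearMap.adjoint restrictUpper ∘L A ∘L restrictUpper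

theorem lift_mul (A B : Hil UpperSite →L[ℂ] Hil UpperSite) : lift (A * B) = lift A * lift B := by
  ext ψ : 1
  change _ = ContinuousLinearMap.adjoint restrictUpper (A (restrictUpper
    (ContinuousLinearMap.adjoint restrictUpper (B (restrictUpper ψ)))))
  rw [restrictUpper_adjoint]
  rfl

theorem lift_sub (A B : Hil UpperSite →L[ℂ] Hil UpperSite) : lift (A - B) = lift A - lift B := by
  ext ψ : 1
  simp [lift]

theorem lift_smul (c : ℂ) (A : Hil UpperSite →L[ℂ] Hil UpperSite) :
    lift (c • A) = c • lift A := by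
  ext ψ : 1
  simp [lift]

theorem ent_lift (A : Hil UpperSite →L[ℂ] Hil UpperSite) (j k : Site) :
    ent (lift A) j k = if h : 0 < j.2 ∧ 0 < k.2 then ent A ⟨j, h.1⟩ ⟨k, h.2⟩ else 0 := by
  rw [ent, lift, ContinuousLinearMap.comp_apply, adjoint_restrictUpper_apply,
    ContinuousLinearMap.comp_apply, restrictUpper_ket]
  by_cases hj : 0 < j.2 <;> by_cases hk : 0 < k.2 <;> simp [hj, hk, ent]

theorem ent_lift_coe (A : Hil UpperSite →L[ℂ] Hil UpperSite) (j k : UpperSite) :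
    ent (lift A) j k = ent A j k := by
  rw [ent_lift, dif_pos ⟨j.2, k.2⟩]

theorem AbsSum.of_lift {A : Hil UpperSite →L[ℂ] Hil UpperSite} (h : AbsSum (lift A)) :
    AbsSum A := by
  have h1 := h.comp_injective (i := fun p : UpperSite × UpperSite => ((p.1 : Site), (p.2 : Site)))
    (Subtype.val_injective.prodMap Subtype.val_injective)
  refine h1.congr fun p => ?_
  simp only [Function.comp_apply, ent_lift_coe]

theorem tr_lift {A : Hil UpperSite →L[ℂ] Hil UpperSite} (h : AbsSum (lift A)) :
    tr (lift A) = tr A := by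
  have h1 := h.isNuc.hasSum_ent
  rw [← hasSum_subtype_iff_of_support_subset (s := {n : Site | 0 < n.2})] at h1
  · refine h1.unique (h.of_lift.isNuc.hasSum_ent.congr_fun fun j => ?_)
    exact ent_lift_coe A j j
  · intro j hj
    by_contra hj'
    refine hj ?_
    change ent (lift A) j j = 0
    rw [ent_lift, dif_neg]
    exact fun h => hj' h.1

/-- The compression of an operator to the half-plane space. -/
def halfPlane (H : Op) : Hil UpperSite →L[ℂ] Hil UpperSite :=
  restrictUpper ∘L H ∘L ContinuousLinearMap.adjoint restrictUpper

theorem ent_halfPlane (H : Op) (j k : UpperSite) : ent (halfPlane H) j k = ent H j k := by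
  rw [ent, halfPlane, ContinuousLinearMap.comp_apply, restrictUpper_apply,
    ContinuousLinearMap.comp_apply, adjoint_restrictUpper_ket, ent]

theorem isSelfAdjoint_halfPlane {H : Op} (hH : IsSelfAdjoint H) : IsSelfAdjoint (halfPlane H) := by
  rw [IsSelfAdjoint, ContinuousLinearMap.star_eq_adjoint]
  refine ext_ent fun j k => ?_
  rw [ent_adjoint, ent_halfPlane, ent_halfPlane, ← ent_adjoint, ← ContinuousLinearMap.star_eq_adjoint,
    hH.star_eq]

theorem finRange_halfPlane {H : Op} {r : ℝ} (h : FinRange id r H) :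
    FinRange Subtype.val r (halfPlane H) := fun j k hjk => by
  rw [ent_halfPlane]
  exact h _ _ hjk

/-- A path of n steps of length at most r which starts at height above n r does not reach the edge,
so the compression is not felt. -/
theorem ent_halfPlane_pow {H : Op} {r : ℝ} (h : FinRange id r H) (hr : 0 ≤ r) (n : ℕ)
    (j k : UpperSite) (hk : n * r < (k.1.2 : ℝ)) :
    ent (halfPlane H ^ n) j k = ent (H ^ n) j k := by
  induction n generalizing j with
  | zero =>
    rw [pow_zero, pow_zero, ent_one, ent_one]
    simp [Subtype.ext_iff]
  | succ n ih =>
    have hn : n * r < (k.1.2 : ℝ) := by push_cast at hk; linarith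
    rw [pow_succ', pow_succ']
    have h1 := hasSum_ent_mul H (H ^ n) j k
    rw [← hasSum_subtype_iff_of_support_subset (s := {n : Site | 0 < n.2})] at h1
    · refine (hasSum_ent_mul (halfPlane H) (halfPlane H ^ n) j k).unique (h1.congr_fun fun l => ?_)
      rw [ih l hn, ent_halfPlane]
      rfl
    · intro l hl
      by_contra hl'
      refine hl ?_
      change ent H j l * ent (H ^ n) l k = 0
      rw [h.pow n l k, mul_zero]
      refine hn.trans_le ?_
      have h2 := abs_snd_sub_le l k.1
      have h3 := neg_abs_le (((l.2 - k.1.2 : ℤ) : ℝ))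
      have h4 : (l.2 : ℝ) ≤ 0 := by exact_mod_cast not_lt.1 hl'
      push_cast at h2 h3
      simp only [id]
      linarith

/-- The distance from the edge plus one. -/
def edgeWt (k : Site) : ℝ := 1 + max (k.2 : ℝ) 0

theorem one_le_edgeWt (k : Site) : 1 ≤ edgeWt k := by simp [edgeWt]

theorem edgeWt_le_add (j k : Site) : edgeWt j ≤ edgeWt k + ‖j - k‖ := by
  have h := (le_abs_self _).trans (abs_snd_sub_le j k)
  push_cast at h
  have h1 := le_max_left (k.2 : ℝ) 0
  have h2 := le_max_right (k.2 : ℝ) 0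
  have : max (j.2 : ℝ) 0 ≤ max (k.2 : ℝ) 0 + ‖j - k‖ :=
    max_le (by linarith) (by linarith [norm_nonneg (j - k)])
  simp only [edgeWt]
  linarith

theorem mod_edgeWt (s : ℕ) : Mod s fun k => edgeWt k ^ s :=
  mod_pow one_le_edgeWt edgeWt_le_add s

theorem edgeWt_pos (s : ℕ) (k : Site) : 0 < edgeWt k ^ s := (mod_edgeWt s).1 k

open Polynomial in
theorem ent_aeval_eq_zero {I : Type} [DecidableEq I] {pos : I → Site} {r : ℝ}
    {A : Hil I →L[ℂ] Hil I} (h : FinRange pos r A) (hr : 0 ≤ r) {p : ℝ[X]} {M : ℕ}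
    (hp : p.natDegree ≤ M) {j k : I} (hjk : M * r < ‖pos j - pos k‖) : ent (aeval A p) j k = 0 := by
  rw [ent_aeval]
  refine Finset.sum_eq_zero fun i hi => ?_
  rw [h.pow i j k, mul_zero]
  refine lt_of_le_of_lt ?_ hjk
  have : i ≤ M := by rw [Finset.mem_range] at hi; omega
  gcongr

open Polynomial in
theorem norm_ent_funcCalc_le {I : Type} [DecidableEq I] {K : Hil I →L[ℂ] Hil I}
    (hK : IsSelfAdjoint K) {f : ℝ → ℝ} (hf : Continuous f) (p : ℝ[X]) {ε : ℝ} (hε : 0 ≤ ε) {c : ℝ}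
    (hc : ‖K‖ + 1 ≤ c) (h : ∀ x ∈ Set.Icc (-c) c, |p.eval x - f x| ≤ ε) (j k : I) :
    ‖ent (aeval K p) j k - ent (funcCalc f K) j k‖ ≤ ε := by
  rw [← ent_sub]
  refine (norm_ent_le _ _ _).trans (norm_aeval_sub_funcCalc_le hK hf p hε fun x hx => h x ?_)
  exact ⟨by linarith [hx.1], by linarith [hx.2]⟩

theorem exists_decay_funcCalc {I : Type} [DecidableEq I] {pos : I → Site} {r : ℝ}
    {K : Hil I →L[ℂ] Hil I} (hK : IsSelfAdjoint K) (h : FinRange pos r K) (hr : 1 ≤ r)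
    {f : ℝ → ℝ} (hf : ContDiff ℝ ∞ f) (N : ℕ) :
    ∃ C : ℝ, ∀ j k, ‖ent (funcCalc f K) j k‖ * (1 + ‖pos j - pos k‖) ^ N ≤ C := by
  obtain ⟨C, hC⟩ := exists_decay hf (c := ‖K‖ + 1) (by positivity) hr
    (fun p : I × I => ent (funcCalc f K) p.1 p.2) (fun p => ‖pos p.1 - pos p.2‖) ‖funcCalc f K‖
    (fun p => norm_ent_le _ _ _) (fun i M p ε hε hp hD hf' => by
      have h1 := norm_ent_funcCalc_le hK hf.continuous p hε le_rfl hf' i.1 i.2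
      rw [ent_aeval_eq_zero h (by linarith) hp hD, zero_sub, norm_neg] at h1
      linarith) N
  refine ⟨C, fun j k => ?_⟩
  simpa only [max_eq_left (norm_nonneg _)] using hC (j, k)

theorem loc_funcCalc {r : ℝ} {H : Op} (hH : IsSelfAdjoint H) (h : FinRange id r H) (hr : 1 ≤ r)
    {f : ℝ → ℝ} (hf : ContDiff ℝ ∞ f) : Loc (fun _ => 1) (funcCalc f H) := by
  choose C hC using exists_decay_funcCalc hH h hr hf
  exact ⟨C, fun N j k => by rw [mul_one]; exact hC N j k⟩

theorem loc_of_finRange {r : ℝ} {A : Op} (hr : 0 ≤ r) (h : FinRange id r A) :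
    Loc (fun _ => 1) A := by
  refine ⟨fun N => ‖A‖ * (1 + r) ^ N, fun N j k => ?_⟩
  rw [mul_one]
  rcases lt_or_ge r ‖j - k‖ with hjk | hjk
  · rw [h j k hjk, norm_zero, zero_mul]
    positivity
  · have : dd j k ≤ 1 + r := by simp only [dd]; linarith
    have := dd_pos j k
    change _ ≤ ‖A‖ * (1 + r) ^ N
    gcongr
    exact norm_ent_le _ _ _

/-- Away from the edge, functions of the half-plane operator agree with those of the operator on
the plane. -/
theorem loc_lift_sub {r : ℝ} {H : Op} (hH : IsSelfAdjoint H) (h : FinRange id r H) (hr : 1 ≤ r)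
    {f : ℝ → ℝ} (hf : ContDiff ℝ ∞ f) (s : ℕ) :
    Loc (fun k => edgeWt k ^ s) (lift (funcCalc f (halfPlane H)) - funcCalc f H) := by
  have hK := isSelfAdjoint_halfPlane hH
  have hKr := finRange_halfPlane h
  set K := halfPlane H with hKdef
  have hr0 : 0 ≤ r := by linarith
  -- If M r is below max(‖j - k‖, k₂), a polynomial of degree at most M has the same entry for K and
  -- H: both entries vanish when j and k are far apart, and all powers agree when k is far from the
  -- edge. The larger interval contains both spectra.
  choose C hC using fun N => exists_decay hf (c := max (‖K‖ + 1) (‖H‖ + 1))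
    (lt_max_of_lt_left (by positivity)) hr
    (fun p : UpperSite × UpperSite => ent (funcCalc f K) p.1 p.2 - ent (funcCalc f H) p.1 p.2)
    (fun p => max ‖p.1.1 - p.2.1‖ p.2.1.2) (‖funcCalc f K‖ + ‖funcCalc f H‖)
    (fun p => (norm_sub_le _ _).trans (add_le_add (norm_ent_le _ _ _) (norm_ent_le _ _ _)))
    (fun i M p ε hε hp hD hf' => by
      have h1 := norm_ent_funcCalc_le hK hf.continuous p hε (le_max_left _ _) hf' i.1 i.2
      have h2 := norm_ent_funcCalc_le hH hf.continuous p hε (le_max_right _ _) hf' i.1.1 i.2.1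
      have h3 : ent (Polynomial.aeval K p) i.1 i.2 = ent (Polynomial.aeval H p) i.1.1 i.2.1 := by
        rcases lt_max_iff.1 hD with hD | hD
        · rw [ent_aeval_eq_zero h hr0 hp hD, ent_aeval_eq_zero hKr hr0 hp hD]
        · rw [ent_aeval, ent_aeval]
          refine Finset.sum_congr rfl fun n hn => ?_
          rw [ent_halfPlane_pow h hr0]
          refine lt_of_le_of_lt ?_ hD
          have : n ≤ M := by rw [Finset.mem_range] at hn; omega
          gcongr
      rw [h3] at h1
      have h4 := norm_sub_le_norm_sub_add_norm_sub (ent (funcCalc f K) i.1 i.2)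
        (ent (Polynomial.aeval H p) i.1.1 i.2.1) (ent (funcCalc f H) i.1 i.2)
      rw [norm_sub_rev] at h1
      linarith) N
  choose D hD using exists_decay_funcCalc hH h hr hf
  refine ⟨fun N => max (C (N + s)) (D (N + s)), fun N j k => ?_⟩
  have hd := dd_pos j k
  have he := one_le_edgeWt k
  rw [ent_sub, ent_lift]
  split_ifs with hjk
  · refine le_max_of_le_left (le_trans ?_ (hC (N + s) (⟨j, hjk.1⟩, ⟨k, hjk.2⟩)))
    simp only
    rw [max_eq_left (le_max_of_le_left (norm_nonneg _)), pow_add, mul_assoc]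
    have hk0 : (0 : ℝ) ≤ k.2 := by exact_mod_cast hjk.2.le
    have e1 : dd j k ≤ 1 + max ‖j - k‖ (k.2 : ℝ) := by
      simp only [dd]; linarith [le_max_left ‖j - k‖ (k.2 : ℝ)]
    have e2 : edgeWt k ≤ 1 + max ‖j - k‖ (k.2 : ℝ) := by
      simp only [edgeWt, max_eq_left hk0]; linarith [le_max_right ‖j - k‖ (k.2 : ℝ)]
    gcongr
  · refine le_max_of_le_right (le_trans ?_ (hD (N + s) j k))
    rw [zero_sub, norm_neg, pow_add, mul_assoc]
    -- When j and k are not both in the half-plane, the height of k is at most its distance from j,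
    -- so the off-diagonal decay of f(H) pays for the edge weight.
    have e1 : edgeWt k ≤ dd j k := by
      by_cases hk : 0 < k.2
      · have hj : j.2 ≤ 0 := by
          by_contra hj
          exact hjk ⟨not_le.1 hj, hk⟩
        have h2 := edgeWt_le_add k j
        rw [norm_sub_rev] at h2
        have : (j.2 : ℝ) ≤ 0 := by exact_mod_cast hj
        rw [edgeWt, edgeWt, max_eq_right this] at h2
        rw [edgeWt, dd]
        linarith
      · have : (k.2 : ℝ) ≤ 0 := by exact_mod_cast not_lt.1 hk
        rw [edgeWt, max_eq_right this, add_zero]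
        exact one_le_dd j k
    have e2 : edgeWt k ^ s ≤ dd j k ^ s := by gcongr
    calc _ ≤ ‖ent (funcCalc f H) j k‖ * (dd j k ^ N * dd j k ^ s) := by gcongr
      _ = _ := rfl

theorem loc_lift {r : ℝ} {H : Op} (hH : IsSelfAdjoint H) (h : FinRange id r H) (hr : 1 ≤ r)
    {f : ℝ → ℝ} (hf : ContDiff ℝ ∞ f) :
    Loc (fun _ => 1) (lift (funcCalc f (halfPlane H))) := by
  have h1 := loc_lift_sub hH h hr hf 0
  simp only [pow_zero] at h1
  simpa using h1.add (fun _ => one_pos) (loc_funcCalc hH h hr hf)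

/-- Here f(H) = 0, so only the edge-localized difference remains. As the lift vanishes below the
edge, the one-sided edge weight may be replaced by a two-sided one. -/
theorem loc_lift_of_gap {r : ℝ} {H : Op} (hH : IsSelfAdjoint H) (h : FinRange id r H) (hr : 1 ≤ r)
    {f : ℝ → ℝ} (hf : ContDiff ℝ ∞ f) (hf0 : ∀ x ∈ spectrum ℝ H, f x = 0) (s : ℕ) :
    Loc (fun k => cutWt Prod.snd 0 k ^ s) (lift (funcCalc f (halfPlane H))) := by
  obtain ⟨C, hC⟩ := loc_lift_sub hH h hr hf s
  rw [funcCalc_eq_zero hf0, sub_zero] at hC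
  refine ⟨C, fun N j k => ?_⟩
  by_cases hk : 0 < k.2
  · have : cutWt Prod.snd 0 k = edgeWt k := by
      have : (0 : ℝ) ≤ k.2 := by exact_mod_cast hk.le
      rw [cutWt, edgeWt, sub_zero, abs_of_nonneg this, max_eq_left this]
    simp only [this]
    exact hC N j k
  · rw [ent_lift, dif_neg fun h => hk h.2, norm_zero, zero_mul, zero_mul]
    exact hC.nonneg (edgeWt_pos s) N

theorem norm_restrictUpper_le : ‖restrictUpper‖ ≤ 1 :=
  LinearMap.mkContinuous_norm_le _ zero_le_one _

theorem norm_lift_le (A : Hil UpperSite →L[ℂ] Hil UpperSite) : ‖lift A‖ ≤ ‖A‖ := by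
  have h1 := norm_restrictUpper_le
  have h2 : ‖ContinuousLinearMap.adjoint restrictUpper‖ ≤ 1 := by
    rw [LinearIsometryEquiv.norm_map]; exact h1
  calc ‖lift A‖ ≤ ‖ContinuousLinearMap.adjoint restrictUpper‖ * ‖A ∘L restrictUpper‖ :=
        ContinuousLinearMap.opNorm_comp_le _ _
    _ ≤ 1 * (‖A‖ * 1) := by
        gcongr
        exact (ContinuousLinearMap.opNorm_comp_le _ _).trans (by gcongr)
    _ = ‖A‖ := by ring

theorem finRange_lift {A : Hil UpperSite →L[ℂ] Hil UpperSite} {r : ℝ}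
    (h : FinRange Subtype.val r A) : FinRange id r (lift A) := fun j k hjk => by
  rw [ent_lift]
  split_ifs with hjk'
  · exact h _ _ hjk
  · rfl

/-! ### Finite-range models -/

/-- `U|n⟩` is a multiple of `|n - e⟩` for all `n`. -/
def IsShift (U : Hil Site ≃ₗᵢ[ℂ] Hil Site) (e : Site) : Prop :=
  ∀ n, ∃ c : ℂ, U (ket n) = c • (ket (n - e) : Hil Site)

theorem isShift_phaseShift (u : Site → Circle) (e : Site) :
    IsShift (phaseShift u (Equiv.addRight e)) e := fun n => by
  refine ⟨u (n - e), ?_⟩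
  ext j
  rw [phaseShift_apply]
  change (u j : ℂ) * (ket n : Hil Site) (j + e) = (u (n - e) : ℂ) * (ket (n - e) : Hil Site) j
  rw [ket_apply, ket_apply]
  by_cases h : j = n - e
  · subst h
    rw [sub_add_cancel, if_pos rfl, if_pos rfl]
  · rw [if_neg h, if_neg fun h' => h (eq_sub_of_add_eq h'), mul_zero, mul_zero]

theorem IsShift.mul {U V : Hil Site ≃ₗᵢ[ℂ] Hil Site} {e e' : Site} (h : IsShift U e)
    (h' : IsShift V e') : IsShift (U * V) (e + e') := fun n => by
  obtain ⟨c, hc⟩ := h' n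
  obtain ⟨d, hd⟩ := h (n - e')
  refine ⟨c * d, ?_⟩
  change U (V (ket n)) = _
  rw [hc, map_smul, hd, smul_smul, sub_sub, add_comm e']

theorem IsShift.inv {U : Hil Site ≃ₗᵢ[ℂ] Hil Site} {e : Site} (h : IsShift U e) :
    IsShift U⁻¹ (-e) := fun n => by
  obtain ⟨c, hc⟩ := h (n + e)
  rw [add_sub_cancel_right] at hc
  have hc0 : c ≠ 0 := by
    rintro rfl
    have h1 := U.norm_map (ket (n + e))
    rw [hc, norm_ket, zero_smul, norm_zero] at h1
    exact zero_ne_one h1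
  refine ⟨c⁻¹, ?_⟩
  rw [sub_neg_eq_add]
  apply U.injective
  rw [map_smul, hc, smul_smul, inv_mul_cancel₀ hc0, one_smul]
  exact U.apply_symm_apply _

theorem IsShift.zpow {U : Hil Site ≃ₗᵢ[ℂ] Hil Site} {e : Site} (h : IsShift U e) (k : ℤ) :
    IsShift (U ^ k) (k • e) := by
  induction k with
  | zero => exact fun n => ⟨1, by simp⟩
  | succ k ih =>
    rw [zpow_add_one, add_smul, one_smul]
    exact ih.mul h
  | pred k ih =>
    rw [zpow_sub_one, sub_smul, one_smul, sub_eq_add_neg]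
    exact ih.mul h.inv

theorem S_ket (B : ℝ) (j : Fin 2) (k : ℤ) (n : Site) :
    ∃ c : ℂ, S B j k (ket n) = c • (ket (n - k • unitVec j) : Hil Site) :=
  (isShift_phaseShift _ (unitVec j)).zpow k n

theorem star_S (B : ℝ) (j : Fin 2) (k : ℤ) : star (S B j k) = S B j (-k) := by
  rw [ContinuousLinearMap.star_eq_adjoint, S, LinearIsometryEquiv.adjoint_eq_symm, S, zpow_neg]
  rfl

theorem S_mul_S_neg (B : ℝ) (j : Fin 2) (k : ℤ) : S B j k * S B j (-k) = 1 := by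
  ext ψ : 1
  have h : magTranslation (symGauge B) j ^ k * magTranslation (symGauge B) j ^ (-k) = 1 := by
    rw [← zpow_add, add_neg_cancel, zpow_zero]
  exact DFunLike.congr_fun h ψ

theorem neg_mem_box {R : ℕ} {n : Site} (h : n ∈ box R) : -n ∈ box R := by
  simp only [box, Finset.mem_product, Finset.mem_Icc, Prod.fst_neg, Prod.snd_neg] at h ⊢
  omega

theorem norm_le_of_mem_box {R : ℕ} {n : Site} (h : n ∈ box R) : ‖n‖ ≤ R := by
  simp only [box, Finset.mem_product, Finset.mem_Icc] at h
  rw [norm_prod_le_iff, Int.norm_eq_abs, Int.norm_eq_abs]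
  exact ⟨by exact_mod_cast abs_le.2 h.1, by exact_mod_cast abs_le.2 h.2⟩

section Model

variable {B : ℝ} (M : FiniteRangeModel B)

theorem FiniteRangeModel.isSelfAdjoint_H : IsSelfAdjoint M.H := by
  have hV : star (mulOp (fun n => (M.v n : ℂ)) M.v_bounded)
      = mulOp (fun n => (M.v n : ℂ)) M.v_bounded := by
    rw [star_mulOp _ _ (by simpa using M.v_bounded)]
    congr 1
    funext n
    exact Complex.conj_ofReal _
  rw [IsSelfAdjoint, FiniteRangeModel.H, star_add, hV, star_sum]
  congr 1
  -- The adjoint of the term n is the term -n; this is what the symmetry condition on the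
  -- coefficients expresses.
  refine Finset.sum_nbij' (fun n => -n) (fun n => -n) (fun n => neg_mem_box) (fun n => neg_mem_box)
    (fun n _ => neg_neg n) (fun n _ => neg_neg n) fun n hn => ?_
  rw [star_mul, star_mul, star_S, star_S, M.t_symm n hn, ContinuousLinearMap.star_eq_adjoint,
    Prod.fst_neg, Prod.snd_neg]
  calc _ = S B 1 (-n.2) * S B 0 (-n.1) * ContinuousLinearMap.adjoint (M.t n) := by
        rw [mul_assoc]
    _ = S B 1 (-n.2) * S B 0 (-n.1) * ContinuousLinearMap.adjoint (M.t n)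
        * (S B 1 n.2 * (S B 0 n.1 * S B 0 (-n.1)) * S B 1 (-n.2)) := by
        rw [S_mul_S_neg, mul_one, S_mul_S_neg, mul_one]
    _ = _ := by simp only [mul_assoc]

theorem ent_sum {ι : Type*} (s : Finset ι) (A : ι → Op) (j k : Site) :
    ent (∑ i ∈ s, A i) j k = ∑ i ∈ s, ent (A i) j k := by
  induction s using Finset.cons_induction with
  | empty => simp
  | cons a s ha ih => rw [Finset.sum_cons, Finset.sum_cons, ent_add, ih]

/-- The translations and the coefficient each move a site by at most R. The additional 1 keeps the
range at least 1, as the decay estimates require, even when R = 0. -/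
theorem FiniteRangeModel.finRange_H : FinRange id (2 * M.R + 1) M.H := fun j k hjk => by
  rw [FiniteRangeModel.H, ent_add, ent_mulOp, if_neg, add_zero, ent_sum]
  · refine Finset.sum_eq_zero fun n hn => ?_
    obtain ⟨c, hc⟩ := S_ket B 1 n.2 k
    obtain ⟨d, hd⟩ := S_ket B 0 n.1 (k - n.2 • unitVec 1)
    have he : k - n.2 • unitVec 1 - n.1 • unitVec 0 = k - n := by
      ext <;> simp [unitVec]
    have h1 : (M.t n * S B 0 n.1 * S B 1 n.2) (ket k) = (c * d) • M.t n (ket (k - n)) := by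
      change M.t n (S B 0 n.1 (S B 1 n.2 (ket k))) = _
      rw [hc, map_smul, hd, map_smul, map_smul, smul_smul, he]
    rw [ent, h1]
    change (c * d) * (M.t n (ket (k - n))) j = 0
    rw [← inner_ket, M.t_finite_range n hn, mul_zero]
    intro hmem
    have h2 := norm_le_of_mem_box hmem
    have h3 := norm_le_of_mem_box hn
    have h4 := norm_sub_le (j - (k - n)) n
    have h5 : j - (k - n) - n = j - k := by abel
    rw [h5] at h4
    simp only [id] at hjk
    linarith
  · rintro rfl
    simp at hjk
    linarith [show (0 : ℝ) ≤ M.R from Nat.cast_nonneg _]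

/-- A lifted operator vanishes outside the upper half-plane, so the quarter plane may be replaced by
the left half-plane n₁ ≤ -1. -/
theorem lift_quarterProj_comm (A : Hil UpperSite →L[ℂ] Hil UpperSite) :
    lift (quarterProj * A - A * quarterProj)
      = cutOp Prod.fst (-1) * lift A - lift A * cutOp Prod.fst (-1) := by
  refine ext_ent fun j k => ?_
  rw [ent_cutOp_comm, ent_lift, ent_lift]
  have e : ∀ x : ℤ, x < 0 ↔ x ≤ -1 := fun x => by omega
  by_cases h : 0 < j.2 ∧ 0 < k.2
  · rw [dif_pos h, dif_pos h, ent_sub, quarterProj, ent_mulOp_mul, ent_mul_mulOp]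
    simp only [e]
    ring
  · rw [dif_neg h, dif_neg h, mul_zero]

end Model

/-! ### The edge current as a trace of a function of the projection -/

/-- The commutator with the indicator function of the left half-plane. -/
abbrev dL (A : Op) : Op := cutOp Prod.fst (-1) * A - A * cutOp Prod.fst (-1)

theorem dL_mul (A B : Op) : dL (A * B) = dL A * B + A * dL B := by
  simp only [dL]; noncomm_ring

theorem dL_add (A B : Op) : dL (A + B) = dL A + dL B := by
  simp only [dL]; noncomm_ring

theorem dL_sub (A B : Op) : dL (A - B) = dL A - dL B := by
  simp only [dL]; noncomm_ring

theorem dL_smul (c : ℂ) (A : Op) : dL (c • A) = c • dL A := by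
  simp only [dL, mul_smul_comm, smul_mul_assoc, smul_sub]

theorem tr_dL {A : Op} (h : IsNuc (dL A)) : tr (dL A) = 0 :=
  tr_eq_zero_of_diag h fun j => by rw [ent_cutOp_comm, sub_self, zero_mul]

/-- Integration by parts: `dL` is a derivation, and its values have zero diagonal, hence zero trace
when nuclear. -/
theorem tr_dL_mul {A B : Op} (h : IsNuc (dL A * B)) (h' : IsNuc (A * dL B)) :
    tr (dL A * B) = -tr (A * dL B) := by
  have h1 := tr_dL (A := A * B) (by rw [dL_mul]; exact h.add h')
  rw [dL_mul, tr_add h h'] at h1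
  exact eq_neg_of_add_eq_zero_left h1

theorem abs_fst_le : ∀ j k : Site, |((j.1 - k.1 : ℤ) : ℝ)| ≤ ‖j - k‖ := abs_fst_sub_le
theorem abs_snd_le : ∀ j k : Site, |((j.2 - k.2 : ℤ) : ℝ)| ≤ ‖j - k‖ := abs_snd_sub_le

theorem mod_fst (c : ℤ) (s : ℕ) : Mod s fun k => cutWt Prod.fst c k ^ s :=
  mod_cutWt abs_fst_le c s

theorem mod_snd (c : ℤ) (s : ℕ) : Mod s fun k => cutWt Prod.snd c k ^ s :=
  mod_cutWt abs_snd_le c s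

theorem loc_dL {A : Op} (h : Loc (fun _ => 1) A) (s : ℕ) :
    Loc (fun k => cutWt Prod.fst (-1) k ^ s) (dL A) := by
  simpa only [mul_one] using h.cutOp_comm abs_fst_le (-1) s (fun _ => one_pos)

/-- An operator with this localization is trace class. -/
theorem Loc.absSum_fst_snd {c c' : ℤ} {A : Op}
    (h : Loc (fun k => cutWt Prod.fst c k ^ 2 * cutWt Prod.snd c' k ^ 2) A) : AbsSum A :=
  h.absSum ((mod_fst c 2).mul (mod_snd c' 2)).1 (summable_cutWt c c')

theorem absSum_dL {A : Op} (h : Loc (fun k => cutWt Prod.snd 0 k ^ 2) A) : AbsSum (dL A) :=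
  (h.cutOp_comm abs_fst_le (-1) 2 (mod_snd 0 2).1).absSum_fst_snd

theorem absSum_mul_dL {A B : Op} (h : Loc (fun k => cutWt Prod.snd 0 k ^ 2) A)
    (h' : Loc (fun _ => 1) B) : AbsSum (A * dL B) := by
  refine Loc.absSum_fst_snd (c := -1) (c' := 0) ?_
  have h1 := h.mul (mod_snd 0 2) (mod_fst (-1) 2).1 (loc_dL h' 2)
  simpa only [mul_comm] using h1

/-! ### The chain rule under the trace -/

open Polynomial in
theorem commute_aeval {E : Type} [NormedAddCommGroup E] [InnerProductSpace ℂ E] [CompleteSpace E]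
    {A K : E →L[ℂ] E} (h : Commute A K) (p : ℝ[X]) : Commute A (aeval K p) := by
  induction p using Polynomial.induction_on' with
  | add p q hp hq => rw [map_add]; exact hp.add_right hq
  | monomial n a =>
    rw [aeval_monomial]
    have hc : Commute A (algebraMap ℝ (E →L[ℂ] E) a) := (Algebra.commutes a A).symm
    exact hc.mul_right (h.pow_right n)

theorem commute_funcCalc {E : Type} [NormedAddCommGroup E] [InnerProductSpace ℂ E]
    [CompleteSpace E] {K : E →L[ℂ] E} (hK : IsSelfAdjoint K) {f : ℝ → ℝ} (hf : Continuous f) :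
    Commute (funcCalc f K) K := by
  have hid : funcCalc (fun x => x) K = K := cfc_id' ℝ K
  have h : funcCalc f K * funcCalc (fun x => x) K = funcCalc (fun x => x) K * funcCalc f K := by
    rw [← funcCalc_mul hf continuous_id', ← funcCalc_mul continuous_id' hf]
    simp only [mul_comm]
  rwa [hid] at h

open Polynomial in
theorem loc_lift_aeval {r : ℝ} {H : Op} (hfr : FinRange id r H) (hr : 1 ≤ r) (p : ℝ[X]) :
    Loc (fun _ => 1) (lift (aeval (halfPlane H) p)) := by
  have hr0 : 0 ≤ r := by linarith
  refine loc_of_finRange (r := p.natDegree * r) (by positivity) (finRange_lift fun j k hjk => ?_)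
  exact ent_aeval_eq_zero (finRange_halfPlane hfr) hr0 le_rfl hjk

theorem dL_lift_one : dL (lift 1) = 0 := by
  refine ext_ent fun j k => ?_
  rw [ent_cutOp_comm, ent_lift]
  split_ifs with h1 h2 h3 <;> try simp
  all_goals
    rw [ent_one, if_neg]
    intro h
    have := congrArg (fun n : UpperSite => n.1.1) h
    simp only at this
    omega

open Polynomial in
-- By the Leibniz rule p(K) yields one term for each position of ∂K; all powers of K commute with A
-- and B, and cyclicity collects them into p'(K). The free factor B carries the induction: peeling
-- off one K replaces B by B K.
theorem tr_mul_dL_aeval {r : ℝ} {H : Op} (hfr : FinRange id r H) (hr : 1 ≤ r)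
    {A : Hil UpperSite →L[ℂ] Hil UpperSite}
    (hA : Loc (fun k => cutWt Prod.snd 0 k ^ 2) (lift A)) (hAK : Commute A (halfPlane H))
    (p : ℝ[X]) : ∀ B : Hil UpperSite →L[ℂ] Hil UpperSite, Commute B (halfPlane H) →
      tr (lift B * (lift A * dL (lift (aeval (halfPlane H) p))))
        = tr (lift (aeval (halfPlane H) (derivative p)) * (lift B *
          (lift A * dL (lift (halfPlane H))))) := by
  set K := halfPlane H with hK
  have hloc : ∀ p : ℝ[X], Loc (fun _ => 1) (lift (aeval K p)) := loc_lift_aeval hfr hr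
  have hk : Loc (fun _ => 1) (lift K) := by simpa using hloc X
  have hnuc : ∀ p : ℝ[X], IsNuc (lift A * dL (lift (aeval K p))) :=
    fun p => (absSum_mul_dL hA (hloc p)).isNuc
  have hnuc' : IsNuc (lift A * dL (lift K)) := (absSum_mul_dL hA hk).isNuc
  induction p using Polynomial.induction_on with
  | C a =>
    intro B _
    have e : (aeval K (C a) : Hil UpperSite →L[ℂ] Hil UpperSite) = (a : ℂ) • 1 := by
      rw [aeval_C, Algebra.algebraMap_eq_smul_one]
      rfl
    rw [e, derivative_C, map_zero, lift_smul, dL_smul, dL_lift_one]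
    simp [lift]
  | add p q hp hq =>
    intro B hB
    have e : ∀ p q : ℝ[X], lift (aeval K (p + q)) = lift (aeval K p) + lift (aeval K q) :=
      fun p q => by rw [map_add]; ext ψ : 1; simp [lift]
    rw [derivative_add, e, e, dL_add, mul_add, mul_add, add_mul,
      tr_add ((hnuc p).mul_left _) ((hnuc q).mul_left _),
      tr_add ((hnuc'.mul_left _).mul_left _) ((hnuc'.mul_left _).mul_left _), hp B hB, hq B hB]
  | monomial n a ih =>
    intro B hB
    set q : ℝ[X] := C a * X ^ n with hq
    have e1 : C a * X ^ (n + 1) = X * q := by rw [hq]; ring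
    have hX : ∀ q : ℝ[X], aeval K (X * q) = K * aeval K q := fun q => by rw [map_mul, aeval_X]
    have hKq : lift (aeval K q) * lift A = lift A * lift (aeval K q) := by
      rw [← lift_mul, ← lift_mul]; exact congrArg lift (commute_aeval hAK q).eq.symm
    have hBq : lift (aeval K q) * lift B = lift B * lift (aeval K q) := by
      rw [← lift_mul, ← lift_mul]; exact congrArg lift (commute_aeval hB q).eq.symm
    have e2 : lift B * (lift A * dL (lift (aeval K (X * q))))
        = (lift B * (lift A * dL (lift K))) * lift (aeval K q)
          + lift (B * K) * (lift A * dL (lift (aeval K q))) := by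
      have hAK' : lift A * lift K = lift K * lift A := by
        rw [← lift_mul, ← lift_mul, hAK.eq]
      rw [hX, lift_mul, dL_mul, lift_mul, mul_assoc (lift B) (lift K),
        ← mul_assoc (lift K) (lift A), ← hAK']
      noncomm_ring
    have e3 : lift (aeval K (derivative (X * q))) * (lift B * (lift A * dL (lift K)))
        = lift (aeval K q) * (lift B * (lift A * dL (lift K)))
          + lift (aeval K (derivative q)) * (lift (B * K) * (lift A * dL (lift K))) := by
      have hc : aeval K (derivative (X * q)) = aeval K q + aeval K (derivative q) * K := by
        rw [derivative_mul, derivative_X, one_mul, map_add, hX]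
        exact congrArg _ (commute_aeval (Commute.refl K) _).eq
      have hl : lift (aeval K q + aeval K (derivative q) * K)
          = lift (aeval K q) + lift (aeval K (derivative q)) * lift K := by
        rw [← lift_mul]; ext ψ : 1; simp [lift]
      rw [hc, hl, hB.eq, lift_mul K B]
      noncomm_ring
    rw [e1, e2, e3, tr_add ((hnuc'.mul_left _).mul_right _) ((hnuc q).mul_left _),
      tr_add ((hnuc'.mul_left _).mul_left _) ((hnuc'.mul_left _).mul_left _),
      tr_mul_comm (hnuc'.mul_left _), ih (B * K) (hB.mul_left (Commute.refl K))]

theorem absSum_mul_dL_halfPlane {r : ℝ} {H : Op} (hH : IsSelfAdjoint H) (hfr : FinRange id r H)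
    (hr : 1 ≤ r) {f : ℝ → ℝ} (hf : ContDiff ℝ ∞ f) (hf0 : ∀ x ∈ spectrum ℝ H, f x = 0) :
    AbsSum (lift (funcCalc f (halfPlane H)) * dL (lift (halfPlane H))) := by
  refine absSum_mul_dL (loc_lift_of_gap hH hfr hr hf hf0 2) ?_
  simpa using loc_lift_aeval hfr hr Polynomial.X

open Polynomial in
/-- The chain rule under the trace. -/
theorem tr_dL_funcCalc_mul {r : ℝ} {H : Op} (hH : IsSelfAdjoint H) (hfr : FinRange id r H)
    (hr : 1 ≤ r) {f h : ℝ → ℝ} (hf : ContDiff ℝ ∞ f) (hf0 : ∀ x ∈ spectrum ℝ H, f x = 0)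
    (hh : ContDiff ℝ ∞ h) :
    tr (dL (lift (funcCalc f (halfPlane H))) * lift (funcCalc h (halfPlane H)))
      = -tr (lift (funcCalc (fun x => deriv h x * f x) (halfPlane H))
        * dL (lift (halfPlane H))) := by
  have hK := isSelfAdjoint_halfPlane hH
  have hA := loc_lift_of_gap hH hfr hr hf hf0 2
  have hnuc' := (absSum_mul_dL_halfPlane hH hfr hr hf hf0).isNuc
  have hhd : Continuous (deriv h) := hh.continuous_deriv (by norm_num)
  have hloc : ∀ p : ℝ[X], Loc (fun _ => 1) (lift (aeval (halfPlane H) p)) := loc_lift_aeval hfr hr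
  set K := halfPlane H with hKdef
  set φ := lift (funcCalc f K) with hφ
  have hnuc : IsNuc (dL φ) := (absSum_dL hA).isNuc
  rw [funcCalc_mul hhd hf.continuous, lift_mul, mul_assoc, ← hφ]
  have hpoly : ∀ p : ℝ[X], tr (dL φ * lift (aeval K p))
      = -tr (lift (aeval K (derivative p)) * (φ * dL (lift K))) := fun p => by
    have h1 := tr_mul_dL_aeval hfr hr hA (commute_funcCalc hK hf.continuous) p 1 (Commute.one_left K)
    have e1 : lift (1 : Hil UpperSite →L[ℂ] Hil UpperSite) * φ = φ := by
      rw [hφ, ← lift_mul, one_mul]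
    rw [← mul_assoc (lift 1), ← mul_assoc (lift 1), ← hφ, e1] at h1
    rw [tr_dL_mul (hnuc.mul_right _) (absSum_mul_dL hA (hloc p)).isNuc, h1]
  -- Both sides are traces against fixed nuclear operators, hence continuous in h(K) and h'(K),
  -- which are approximated simultaneously by p(K) and p'(K).
  obtain ⟨C₁, hC₁⟩ := hnuc.exists_norm_tr_mul_le
  obtain ⟨C₂, hC₂⟩ := hnuc'.exists_norm_tr_mul_le
  refine eq_of_forall_dist_le fun ε hε => ?_
  have hδ : 0 < ε / (|C₁| + |C₂| + 1) := by positivity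
  obtain ⟨p, hp⟩ := exists_polynomial_near_deriv hh (c := ‖K‖ + 1) (by positivity) hδ
  have n1 : ‖aeval K p - funcCalc h K‖ ≤ ε / (|C₁| + |C₂| + 1) :=
    norm_aeval_sub_funcCalc_le hK hh.continuous p hδ.le fun x hx => (hp x hx).1
  have n2 : ‖aeval K (derivative p) - funcCalc (deriv h) K‖ ≤ ε / (|C₁| + |C₂| + 1) :=
    norm_aeval_sub_funcCalc_le hK hhd _ hδ.le fun x hx => (hp x hx).2
  have d1 : ‖tr (dL φ * lift (aeval K p)) - tr (dL φ * lift (funcCalc h K))‖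
      ≤ |C₁| * (ε / (|C₁| + |C₂| + 1)) := by
    rw [← tr_sub (hnuc.mul_right _) (hnuc.mul_right _), ← mul_sub, ← lift_sub, ← tr_mul_comm hnuc]
    refine (hC₁ _).trans (mul_le_mul (le_abs_self _) ((norm_lift_le _).trans n1) (norm_nonneg _)
      (abs_nonneg _))
  have d2 : ‖tr (lift (aeval K (derivative p)) * (φ * dL (lift K)))
      - tr (lift (funcCalc (deriv h) K) * (φ * dL (lift K)))‖
      ≤ |C₂| * (ε / (|C₁| + |C₂| + 1)) := by
    rw [← tr_sub (hnuc'.mul_left _) (hnuc'.mul_left _), ← sub_mul, ← lift_sub]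
    refine (hC₂ _).trans (mul_le_mul (le_abs_self _) ((norm_lift_le _).trans n2) (norm_nonneg _)
      (abs_nonneg _))
  have e := hpoly p
  rw [dist_eq_norm]
  have e3 : tr (dL φ * lift (funcCalc h K)) - -tr (lift (funcCalc (deriv h) K) * (φ * dL (lift K)))
      = -(tr (dL φ * lift (aeval K p)) - tr (dL φ * lift (funcCalc h K)))
        - (tr (lift (aeval K (derivative p)) * (φ * dL (lift K)))
          - tr (lift (funcCalc (deriv h) K) * (φ * dL (lift K)))) := by
    rw [e]; ring
  rw [e3]
  refine (norm_sub_le _ _).trans ?_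
  rw [norm_neg]
  refine (add_le_add d1 d2).trans ?_
  rw [← add_mul, mul_div_assoc', div_le_iff₀ (by positivity)]
  nlinarith [abs_nonneg C₁, abs_nonneg C₂]

/-! ### Switch functions and the reduction of the edge trace -/

/-- A switch function in the gap `[a, b]`. -/
structure IsSwitch (g : ℝ → ℝ) (a b : ℝ) : Prop where
  smooth : ContDiff ℝ ∞ g
  left : ∀ x, x < a → g x = 1
  right : ∀ x, b < x → g x = 0

theorem lt_or_lt_of_notMem_Icc {a b x : ℝ} (h : x ∉ Set.Icc a b) : x < a ∨ b < x := by
  rcases lt_or_ge x a with h1 | h1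
  · exact Or.inl h1
  · exact Or.inr (not_le.1 fun h2 => h ⟨h1, h2⟩)

theorem IsSwitch.deriv_eq_zero {g : ℝ → ℝ} {a b : ℝ} (hg : IsSwitch g a b) {x : ℝ}
    (hx : x ∉ Set.Icc a b) : deriv g x = 0 := by
  rcases lt_or_lt_of_notMem_Icc hx with h | h
  · have : g =ᶠ[nhds x] fun _ => 1 :=
      (Iio_mem_nhds h : Set.Iio a ∈ nhds x) |> Filter.mem_of_superset <| hg.left
    rw [this.deriv_eq, deriv_const]
  · have : g =ᶠ[nhds x] fun _ => 0 :=
      (Ioi_mem_nhds h : Set.Ioi b ∈ nhds x) |> Filter.mem_of_superset <| hg.right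
    rw [this.deriv_eq, deriv_const]

theorem IsSwitch.mul_self_sub {g : ℝ → ℝ} {a b : ℝ} (hg : IsSwitch g a b) {x : ℝ}
    (hx : x ∉ Set.Icc a b) : g x * g x - g x = 0 := by
  rcases lt_or_lt_of_notMem_Icc hx with h | h
  · rw [hg.left x h]; norm_num
  · rw [hg.right x h]; norm_num

theorem IsSwitch.smooth_deriv {g : ℝ → ℝ} {a b : ℝ} (hg : IsSwitch g a b) :
    ContDiff ℝ ∞ (deriv g) := (contDiff_infty_iff_deriv.1 hg.smooth).2

/-- The trace of `k'(Ĥ) [Π, Ĥ]` vanishes for smooth `k` supported in the gap. -/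
theorem tr_deriv_mul_dL_eq_zero {r : ℝ} {H : Op} (hH : IsSelfAdjoint H) (hfr : FinRange id r H)
    (hr : 1 ≤ r) {a b : ℝ} (hgap : Disjoint (Set.Icc a b) (spectrum ℝ H)) {k : ℝ → ℝ}
    (hk : ContDiff ℝ ∞ k) (hk0 : ∀ x, x ∉ Set.Icc a b → k x = 0) :
    tr (lift (funcCalc (deriv k) (halfPlane H)) * dL (lift (halfPlane H))) = 0 := by
  have hσ : IsClosed (spectrum ℝ H) := spectrum.isClosed H
  -- A smooth cutoff, 1 on the gap interval and 0 on the spectrum of H, so that k'ρ = k' and ρ'k =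
  -- 0.
  obtain ⟨ρ, hρs, hρr, hρ0, hρ1⟩ := exists_contMDiff_zero_iff_one_iff_of_isClosed
    (n := (⊤ : ℕ∞)) (modelWithCornersSelf ℝ ℝ) hσ (isClosed_Icc (a := a) (b := b)) hgap.symm
  have hρ : ContDiff ℝ ∞ ρ := contMDiff_iff_contDiff.1 hρs
  have hρz : ∀ x ∈ spectrum ℝ H, ρ x = 0 := fun x hx => (hρ0 x).1 hx
  have hkz : ∀ x ∈ spectrum ℝ H, k x = 0 := fun x hx => hk0 x fun h => hgap.le_bot ⟨h, hx⟩
  have hder : ∀ x, deriv k x * ρ x = deriv k x := fun x => by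
    by_cases hx : x ∈ Set.Icc a b
    · rw [(hρ1 x).1 hx, mul_one]
    · have : k =ᶠ[nhds x] fun _ => 0 :=
        Filter.mem_of_superset (isClosed_Icc.isOpen_compl.mem_nhds hx) hk0
      rw [this.deriv_eq, deriv_const, zero_mul]
  have hder2 : ∀ x, deriv ρ x * k x = 0 := fun x => by
    by_cases hx : x ∈ Set.Icc a b
    -- On the interval ρ attains its maximum 1, so its derivative vanishes there, endpoints
    -- included.
    · have : IsLocalMax ρ x := Filter.Eventually.of_forall fun y => by
        rw [(hρ1 x).1 hx]
        exact (hρr ⟨y, rfl⟩).2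
      rw [this.deriv_eq_zero, zero_mul]
    · rw [hk0 x hx, mul_zero]
  -- The chain rule evaluates tr(∂ρ(K) k(K)) as -tr(k'(K) ∂K) and tr(∂k(K) ρ(K)) as 0; integration
  -- by parts identifies them up to sign.
  have h1 := tr_dL_funcCalc_mul hH hfr hr hρ hρz hk
  have h2 := tr_dL_funcCalc_mul hH hfr hr hk hkz hρ
  simp only [hder] at h1
  simp only [hder2] at h2
  have hz : funcCalc (fun _ => (0 : ℝ)) (halfPlane H) = 0 := funcCalc_eq_zero fun _ _ => rfl
  have hl : lift (0 : Hil UpperSite →L[ℂ] Hil UpperSite) = 0 := by ext ψ : 1; simp [lift]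
  rw [hz, hl, zero_mul, tr_zero, neg_zero] at h2
  have n1 := (absSum_dL (loc_lift_of_gap hH hfr hr hρ hρz 2)).isNuc
  have n2 := (absSum_dL (loc_lift_of_gap hH hfr hr hk hkz 2)).isNuc
  rw [tr_dL_mul (n1.mul_right _) (n2.mul_left _), tr_mul_comm n2, h2] at h1
  simpa using h1.symm

/-- The edge current in terms of the switch function of the half-plane operator. -/
theorem tr_edge {r : ℝ} {H : Op} (hH : IsSelfAdjoint H) (hfr : FinRange id r H)
    (hr : 1 ≤ r) {a b : ℝ} (hgap : Disjoint (Set.Icc a b) (spectrum ℝ H)) {g : ℝ → ℝ}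
    (hg : IsSwitch g a b) :
    tr (lift (funcCalc (deriv g) (halfPlane H)) * dL (lift (halfPlane H)))
      = -6 * tr ((lift (funcCalc g (halfPlane H)) * lift (funcCalc g (halfPlane H))
        - lift (funcCalc g (halfPlane H))) * dL (lift (funcCalc g (halfPlane H)))) := by
  have hspec : ∀ x ∈ spectrum ℝ H, x ∉ Set.Icc a b := fun x hx h => hgap.le_bot ⟨h, hx⟩
  have hgs := hg.smooth
  have hgc := hgs.continuous
  have hgd := hg.smooth_deriv
  set z : ℝ → ℝ := fun x => g x * g x - g x with hz
  have hzs : ContDiff ℝ ∞ z := (hgs.mul hgs).sub hgs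
  have hz0 : ∀ x ∈ spectrum ℝ H, z x = 0 := fun x hx => hg.mul_self_sub (hspec x hx)
  have hZ : lift (funcCalc g (halfPlane H)) * lift (funcCalc g (halfPlane H))
      - lift (funcCalc g (halfPlane H)) = lift (funcCalc z (halfPlane H)) := by
    have e1 : funcCalc z (halfPlane H) = _ := funcCalc_sub (hgc.mul hgc) hgc
    have e2 : funcCalc (fun x => g x * g x) (halfPlane H) = _ := funcCalc_mul hgc hgc
    rw [e1, e2, lift_sub, lift_mul]
  rw [hZ]
  have hZl := loc_lift_of_gap hH hfr hr hzs hz0 2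
  have hG : Loc (fun _ => 1) (lift (funcCalc g (halfPlane H))) := loc_lift hH hfr hr hgs
  have n1 := (absSum_dL hZl).isNuc
  have n2 := (absSum_mul_dL hZl hG).isNuc
  have h1 := tr_dL_funcCalc_mul hH hfr hr hzs hz0 hgs
  rw [tr_dL_mul (n1.mul_right _) n2, neg_inj] at h1
  rw [h1]
  -- The polynomial 3y² - 2y³ fixes 0 and 1 and has derivative 6(y - y²). So k vanishes where g is 0
  -- or 1, and the vanishing trace of k'(K) ∂K trades g' for -6 g'(g² - g).
  set k : ℝ → ℝ := fun x => 3 * g x ^ 2 - 2 * g x ^ 3 - g x with hk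
  have hks : ContDiff ℝ ∞ k :=
    ((contDiff_const.mul (hgs.pow 2)).sub (contDiff_const.mul (hgs.pow 3))).sub hgs
  have hk0 : ∀ x, x ∉ Set.Icc a b → k x = 0 := fun x hx => by
    rcases lt_or_lt_of_notMem_Icc hx with h | h
    · simp only [hk, hg.left x h]; norm_num
    · simp only [hk, hg.right x h]; norm_num
  have hdk : deriv k = fun x => -6 * (deriv g x * z x) - deriv g x := by
    funext x
    have hgx : HasDerivAt g (deriv g x) x :=
      (hgs.differentiable (by norm_num)).differentiableAt.hasDerivAt
    have h := (((hgx.pow 2).const_mul 3).sub ((hgx.pow 3).const_mul 2)).sub hgx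
    refine h.deriv.trans ?_
    simp only [hz]
    push_cast
    ring
  have h3 := tr_deriv_mul_dL_eq_zero hH hfr hr hgap hks hk0
  have hmul : ContDiff ℝ ∞ fun x => deriv g x * z x := hgd.mul hzs
  have e1 : funcCalc (fun x => -6 * (deriv g x * z x) - deriv g x) (halfPlane H) = _ :=
    funcCalc_sub (continuous_const.mul hmul.continuous) hgd.continuous
  have e2 : funcCalc (fun x => -6 * (deriv g x * z x)) (halfPlane H) = _ :=
    funcCalc_smul _ hmul.continuous
  rw [hdk, e1, e2, lift_sub, lift_smul, sub_mul, smul_mul_assoc] at h3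
  have m1 := (absSum_mul_dL_halfPlane hH hfr hr hmul fun x hx => by rw [hz0 x hx, mul_zero]).isNuc
  have m2 := (absSum_mul_dL_halfPlane hH hfr hr hgd fun x hx => hg.deriv_eq_zero (hspec x hx)).isNuc
  rw [tr_sub (m1.smul _) m2, tr_smul m1] at h3
  push_cast at h3
  linear_combination -h3

/-! ### From the edge to the bulk -/

open Filter Topology

/-- The commutator with the indicator function of the lower half-plane `{n₂ ≤ L}`. -/
abbrev dB (L : ℤ) (A : Op) : Op := cutOp Prod.snd L * A - A * cutOp Prod.snd L

/-- The Hall conductance of `A` at the height `L`, up to a constant. -/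
def hall (L : ℤ) (A : Op) : ℂ := (1 / 2) * (tr (dL A * dB L A * A) - tr (dB L A * dL A * A))

theorem absSum_dL_mul_dB (L : ℤ) {A B C : Op} (hA : Loc (fun _ => 1) A) (hB : Loc (fun _ => 1) B)
    (hC : Loc (fun _ => 1) C) : AbsSum (dL A * dB L B * C) := by
  have h1 := hA.cutOp_comm abs_fst_le (-1) 2 (fun _ => one_pos)
  have h2 := hB.cutOp_comm abs_snd_le L 2 (fun _ => one_pos)
  simp only [mul_one] at h1 h2
  exact ((h1.mul (mod_fst (-1) 2) (mod_snd L 2).1 h2).mul_one_right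
    ((mod_fst (-1) 2).mul (mod_snd L 2)) hC).absSum_fst_snd

theorem absSum_dB_mul_dL (L : ℤ) {A B C : Op} (hA : Loc (fun _ => 1) A) (hB : Loc (fun _ => 1) B)
    (hC : Loc (fun _ => 1) C) : AbsSum (dB L B * dL A * C) := by
  have h1 := hA.cutOp_comm abs_fst_le (-1) 2 (fun _ => one_pos)
  have h2 := hB.cutOp_comm abs_snd_le L 2 (fun _ => one_pos)
  simp only [mul_one] at h1 h2
  have h3 := (h2.mul (mod_snd L 2) (mod_fst (-1) 2).1 h1).mul_one_right
    ((mod_snd L 2).mul (mod_fst (-1) 2)) hC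
  simp only [mul_comm] at h3
  refine Loc.absSum_fst_snd (c := -1) (c' := L) ?_
  simpa only [mul_comm] using h3

/-! #### Switching between the half-plane and the plane -/

/-- No site is close both to the edge and to the height L. -/
theorem one_add_le_cutWt_mul_edgeWt (L : ℕ) (k : Site) :
    1 + (L : ℝ) ≤ cutWt Prod.snd L k * edgeWt k := by
  simp only [cutWt, edgeWt]
  push_cast
  have h1 := neg_abs_le ((k.2 : ℝ) - L)
  have h2 := le_max_left (k.2 : ℝ) 0
  have h3 := le_max_right (k.2 : ℝ) 0
  nlinarith [abs_nonneg ((k.2 : ℝ) - L), mul_nonneg (abs_nonneg ((k.2 : ℝ) - L)) h3]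

/-- An operator localized near the edge and near `(-1, L)` has small trace for large `L`. -/
theorem LocC.norm_tr_le_div {A : Op} {C : ℕ → ℝ} (L : ℕ)
    (h : LocC (fun k => cutWt Prod.fst (-1) k ^ 2 * (cutWt Prod.snd L k ^ 3 * edgeWt k)) A C) :
    ‖tr A‖ ≤ C 0 * (S2 * S2) / (1 + L) := by
  have hpos : (0 : ℝ) < 1 + L := by positivity
  -- One of the three powers of the vertical weight is traded, together with the edge weight, for 1
  -- + L; the remaining two ensure summability.
  have h' : LocC (fun k => cutWt Prod.fst (-1) k ^ 2 * cutWt Prod.snd L k ^ 2) A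
      fun N => C N / (1 + L) := fun N j k => by
    rw [le_div_iff₀ hpos]
    refine le_trans ?_ (h N j k)
    have h1 := one_add_le_cutWt_mul_edgeWt L k
    have h2 := dd_pos j k
    have h3 := zero_lt_one.trans_le (one_le_cutWt Prod.fst (-1) k)
    have h4 := zero_lt_one.trans_le (one_le_cutWt Prod.snd L k)
    calc _ ≤ ‖ent A j k‖ * dd j k ^ N * (cutWt Prod.fst (-1) k ^ 2 * cutWt Prod.snd L k ^ 2)
          * (cutWt Prod.snd L k * edgeWt k) := by gcongr
      _ = _ := by ring
  have h5 := h'.norm_tr_le ((mod_fst (-1) 2).mul (mod_snd L 2)).1 (summable_cutWt _ _)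
  rw [tsum_cutWt] at h5
  exact h5.trans_eq (by ring)

/-- Exactly one of the three factors is localized at the edge, whichever it is, while the
commutators localize at (-1, L). The constants do not depend on L. -/
theorem exists_norm_tr_le {a b c : ℕ} {A B D : Op} (habc : a + b + c = 1)
    (hA : Loc (fun k => edgeWt k ^ a) A) (hB : Loc (fun k => edgeWt k ^ b) B)
    (hD : Loc (fun k => edgeWt k ^ c) D) :
    ∃ K : ℝ, ∀ L : ℕ, ‖tr (dL A * dB L B * D)‖ ≤ K / (1 + L) ∧
      ‖tr (dB L B * dL A * D)‖ ≤ K / (1 + L) := by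
  obtain ⟨CA, hA⟩ := hA
  obtain ⟨CB, hB⟩ := hB
  obtain ⟨CD, hD⟩ := hD
  have hwA := (mod_fst (-1) 2).mul (mod_edgeWt a)
  have hw : ∀ k : Site, edgeWt k ^ a * edgeWt k ^ b * edgeWt k ^ c = edgeWt k := fun k => by
    rw [← pow_add, ← pow_add, habc, pow_one]
  have h1 := hA.cutOp_comm abs_fst_le (-1) 2 (edgeWt_pos a)
  have e1 : ∀ (L : ℕ) (k : Site), cutWt Prod.fst (-1) k ^ 2 * edgeWt k ^ a
      * (cutWt Prod.snd L k ^ 3 * edgeWt k ^ b) * edgeWt k ^ c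
      = cutWt Prod.fst (-1) k ^ 2 * (cutWt Prod.snd L k ^ 3 * edgeWt k) := fun L k => by
    conv_rhs => rw [← hw k]
    ring
  have e2 : ∀ (L : ℕ) (k : Site), cutWt Prod.snd L k ^ 3 * edgeWt k ^ b
      * (cutWt Prod.fst (-1) k ^ 2 * edgeWt k ^ a) * edgeWt k ^ c
      = cutWt Prod.fst (-1) k ^ 2 * (cutWt Prod.snd L k ^ 3 * edgeWt k) := fun L k => by
    conv_rhs => rw [← hw k]
    ring
  have key : ∃ K₁ K₂ : ℝ, ∀ L : ℕ, ‖tr (dL A * dB L B * D)‖ ≤ K₁ / (1 + L) ∧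
      ‖tr (dB L B * dL A * D)‖ ≤ K₂ / (1 + L) := by
    refine ⟨CA (0 + 2) * CB (0 + (2 + a) + 3 + 3) * S3 * CD (0 + (2 + a + (3 + b)) + 3) * S3
        * (S2 * S2), CB (0 + 3) * CA (0 + (3 + b) + 3 + 2) * S3
        * CD (0 + (3 + b + (2 + a)) + 3) * S3 * (S2 * S2), fun L => ?_⟩
    have hwB := (mod_snd L 3).mul (mod_edgeWt b)
    have h2 := hB.cutOp_comm abs_snd_le L 3 (edgeWt_pos b)
    have h3 := (h1.mul hwA hwB.1 h2).mul (hwA.mul hwB) (edgeWt_pos c) hD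
    have h4 := (h2.mul hwB hwA.1 h1).mul (hwB.mul hwA) (edgeWt_pos c) hD
    simp only [e1] at h3
    simp only [e2] at h4
    exact ⟨h3.norm_tr_le_div L, h4.norm_tr_le_div L⟩
  obtain ⟨K₁, K₂, hK⟩ := key
  refine ⟨max K₁ K₂, fun L => ⟨(hK L).1.trans ?_, (hK L).2.trans ?_⟩⟩
  · gcongr; exact le_max_left _ _
  · gcongr; exact le_max_right _ _

theorem tendsto_tr_zero {a b c : ℕ} {A B D : Op} (habc : a + b + c = 1)
    (hA : Loc (fun k => edgeWt k ^ a) A) (hB : Loc (fun k => edgeWt k ^ b) B)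
    (hD : Loc (fun k => edgeWt k ^ c) D) :
    Tendsto (fun L : ℕ => tr (dL A * dB L B * D)) atTop (𝓝 0) ∧
      Tendsto (fun L : ℕ => tr (dB L B * dL A * D)) atTop (𝓝 0) := by
  obtain ⟨K, hK⟩ := exists_norm_tr_le habc hA hB hD
  have h : Tendsto (fun L : ℕ => K / (1 + (L : ℝ))) atTop (𝓝 0) :=
    tendsto_const_nhds.div_atTop (tendsto_atTop_add_const_left _ _ tendsto_natCast_atTop_atTop)
  exact ⟨squeeze_zero_norm (fun L => (hK L).1) h, squeeze_zero_norm (fun L => (hK L).2) h⟩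

/-- In the telescoping expansion with G = P + D every term except those of P contains one factor D,
which lives near the edge. -/
theorem tendsto_hall_sub {G P : Op} (hG : Loc (fun _ => 1) G) (hP : Loc (fun _ => 1) P)
    (hD : Loc edgeWt (G - P)) :
    Tendsto (fun L : ℕ => hall L G - hall L P) atTop (𝓝 0) := by
  set D := G - P with hDdef
  have hG' : Loc (fun k => edgeWt k ^ 0) G := by simpa only [pow_zero] using hG
  have hP' : Loc (fun k => edgeWt k ^ 0) P := by simpa only [pow_zero] using hP
  have hD' : Loc (fun k => edgeWt k ^ 1) D := by simpa only [pow_one] using hD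
  have hD1 : Loc (fun _ => 1) D := hG.sub (fun _ => one_pos) hP
  have t1 := tendsto_tr_zero (by norm_num) hD' hG' hG'
  have t2 := tendsto_tr_zero (by norm_num) hP' hD' hG'
  have t3 := tendsto_tr_zero (by norm_num) hP' hP' hD'
  have hlim := (((t1.1.add t2.1).add t3.1).sub ((t1.2.add t2.2).add t3.2)).const_mul (1 / 2 : ℂ)
  norm_num at hlim
  refine hlim.congr fun L => ?_
  have hg : G = P + D := by rw [hDdef]; abel
  have e1 : dL G * dB L G * G
      = dL D * dB L G * G + dL P * dB L D * G + dL P * dB L P * D + dL P * dB L P * P := by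
    rw [hg]; simp only [dL, dB]; noncomm_ring
  have e2 : dB L G * dL G * G
      = dB L G * dL D * G + dB L D * dL P * G + dB L P * dL P * D + dB L P * dL P * P := by
    rw [hg]; simp only [dL, dB]; noncomm_ring
  have n1 := (absSum_dL_mul_dB L hD1 hG hG).isNuc
  have n2 := (absSum_dL_mul_dB L hP hD1 hG).isNuc
  have n3 := (absSum_dL_mul_dB L hP hP hD1).isNuc
  have n4 := (absSum_dL_mul_dB L hP hP hP).isNuc
  have m1 := (absSum_dB_mul_dL L hD1 hG hG).isNuc
  have m2 := (absSum_dB_mul_dL L hP hD1 hG).isNuc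
  have m3 := (absSum_dB_mul_dL L hP hP hD1).isNuc
  have m4 := (absSum_dB_mul_dL L hP hP hP).isNuc
  simp only [hall]
  rw [e1, e2, tr_add ((n1.add n2).add n3) n4, tr_add (n1.add n2) n3, tr_add n1 n2,
    tr_add ((m1.add m2).add m3) m4, tr_add (m1.add m2) m3, tr_add m1 m2]
  ring

/-! #### The Hall conductance of a half-plane operator -/

theorem ent_lift_eq_zero {Y : Hil UpperSite →L[ℂ] Hil UpperSite} {j k : Site}
    (h : ¬(0 < j.2 ∧ 0 < k.2)) : ent (lift Y) j k = 0 := by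
  rw [ent_lift, dif_neg h]

/-- Only the strip 0 < n₂ ≤ L survives, so the vertical weight is bounded at a price depending on L.
This is where the half-plane differs from the plane: the cut itself, not just its commutator,
restores nuclearity. -/
theorem absSum_cutOp_mul_lift (L : ℕ) {Y : Hil UpperSite →L[ℂ] Hil UpperSite}
    (h : Loc (fun k => cutWt Prod.fst (-1) k ^ 2) (lift Y)) :
    AbsSum (cutOp Prod.snd L * lift Y) := by
  obtain ⟨C, h⟩ := h
  refine Loc.absSum_fst_snd (c := -1) (c' := 0) ⟨fun N => (1 + L) ^ 2 * C (N + 2), fun N j k => ?_⟩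
  have hC := h.nonneg (mod_fst (-1) 2).1 (N + 2)
  by_cases hj : j.2 ≤ L ∧ 0 < j.2 ∧ 0 < k.2
  · have h1 : cutWt Prod.snd 0 j ≤ 1 + L := by
      have : (j.2 : ℝ) ≤ L := by exact_mod_cast hj.1
      have : (0 : ℝ) < j.2 := by exact_mod_cast hj.2.1
      simp only [cutWt, sub_zero, abs_of_pos this]
      linarith
    have h2 := (mod_snd 0 2).2 k j
    have h0 := one_le_cutWt Prod.snd 0 j
    have hd := dd_pos j k
    rw [dd_comm] at h2
    have h3 : cutWt Prod.snd 0 k ^ 2 ≤ (1 + L) ^ 2 * dd j k ^ 2 := by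
      refine h2.trans ?_
      show cutWt Prod.snd 0 j ^ 2 * _ ≤ _
      gcongr
    rw [cutOp, ent_mulOp_mul, if_pos hj.1, one_mul]
    calc _ ≤ ‖ent (lift Y) j k‖ * dd j k ^ N
          * (cutWt Prod.fst (-1) k ^ 2 * ((1 + L) ^ 2 * dd j k ^ 2)) := by
          show _ * (cutWt Prod.fst (-1) k ^ 2 * cutWt Prod.snd 0 k ^ 2) ≤ _
          have := one_le_cutWt Prod.fst (-1) k
          gcongr
      _ = (1 + L) ^ 2 * (‖ent (lift Y) j k‖ * dd j k ^ (N + 2) * cutWt Prod.fst (-1) k ^ 2) := by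
          ring
      _ ≤ _ := mul_le_mul_of_nonneg_left (h (N + 2) j k) (by positivity)
  · have : ent (cutOp Prod.snd L * lift Y) j k = 0 := by
      rw [cutOp, ent_mulOp_mul]
      by_cases h1 : j.2 ≤ L
      · rw [ent_lift_eq_zero fun h2 => hj ⟨h1, h2⟩, mul_zero]
      · rw [if_neg h1, zero_mul]
    rw [this]
    simp only [norm_zero, zero_mul]
    positivity

theorem absSum_lift_mul_cutOp (L : ℕ) {Y : Hil UpperSite →L[ℂ] Hil UpperSite}
    (h : Loc (fun k => cutWt Prod.fst (-1) k ^ 2) (lift Y)) :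
    AbsSum (lift Y * cutOp Prod.snd L) := by
  obtain ⟨C, h⟩ := h
  refine Loc.absSum_fst_snd (c := -1) (c' := 0) ⟨fun N => (1 + L) ^ 2 * C N, fun N j k => ?_⟩
  have hC := h.nonneg (mod_fst (-1) 2).1 N
  by_cases hj : k.2 ≤ L ∧ 0 < j.2 ∧ 0 < k.2
  · have h1 : cutWt Prod.snd 0 k ≤ 1 + L := by
      have : (k.2 : ℝ) ≤ L := by exact_mod_cast hj.1
      have : (0 : ℝ) < k.2 := by exact_mod_cast hj.2.2
      simp only [cutWt, sub_zero, abs_of_pos this]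
      linarith
    have h0 := one_le_cutWt Prod.snd 0 k
    have hd := dd_pos j k
    rw [cutOp, ent_mul_mulOp, if_pos hj.1, mul_one]
    calc _ ≤ ‖ent (lift Y) j k‖ * dd j k ^ N * (cutWt Prod.fst (-1) k ^ 2 * (1 + L) ^ 2) := by
          show _ * (cutWt Prod.fst (-1) k ^ 2 * cutWt Prod.snd 0 k ^ 2) ≤ _
          have := one_le_cutWt Prod.fst (-1) k
          gcongr
      _ = (1 + L) ^ 2 * (‖ent (lift Y) j k‖ * dd j k ^ N * cutWt Prod.fst (-1) k ^ 2) := by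
          ring
      _ ≤ _ := mul_le_mul_of_nonneg_left (h N j k) (by positivity)
  · have : ent (lift Y * cutOp Prod.snd L) j k = 0 := by
      rw [cutOp, ent_mul_mulOp]
      by_cases h1 : k.2 ≤ L
      · rw [ent_lift_eq_zero fun h2 => hj ⟨h1, h2⟩, zero_mul]
      · rw [if_neg h1, mul_zero]
    rw [this]
    simp only [norm_zero, zero_mul]
    positivity

/-- Neither factor needs to be nuclear here, so cyclicity is read off from the equal diagonals of
the two products. -/
theorem tr_lift_mul_cutOp (L : ℕ) {Y : Hil UpperSite →L[ℂ] Hil UpperSite}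
    (h : Loc (fun k => cutWt Prod.fst (-1) k ^ 2) (lift Y)) :
    tr (lift Y * cutOp Prod.snd L) = tr (cutOp Prod.snd L * lift Y) :=
  tr_congr_diag (absSum_lift_mul_cutOp L h).isNuc (absSum_cutOp_mul_lift L h).isNuc fun j => by
    rw [cutOp, ent_mul_mulOp, ent_mulOp_mul, mul_comm]

theorem tendsto_tr_cutOp_mul {T : Op} (h : IsNuc T) :
    Tendsto (fun L : ℕ => tr (cutOp Prod.snd L * T)) atTop (𝓝 (tr T)) := by
  have hs := h.hasSum_ent
  have e : ∀ L : ℕ, tr (cutOp Prod.snd L * T)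
      = ∑' j : Site, (if j.2 ≤ (L : ℤ) then 1 else 0) * ent T j j := fun L => by
    rw [← (h.mul_left (cutOp Prod.snd L)).hasSum_ent.tsum_eq]
    exact tsum_congr fun j => by rw [cutOp, ent_mulOp_mul]
  simp only [e]
  rw [← hs.tsum_eq]
  refine tendsto_tsum_of_dominated_convergence hs.summable.norm (fun j => ?_)
    (Eventually.of_forall fun L j => ?_)
  · refine tendsto_const_nhds.congr' ?_
    filter_upwards [eventually_ge_atTop j.2.toNat] with L hL
    rw [if_pos (by omega), one_mul]
  · rw [norm_mul]
    refine mul_le_of_le_one_left (norm_nonneg _) ?_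
    split_ifs <;> simp

theorem tr_cutOp_mul_dL {L : ℤ} {A : Op} (h : IsNuc (cutOp Prod.snd L * dL A)) :
    tr (cutOp Prod.snd L * dL A) = 0 :=
  tr_eq_zero_of_diag h fun j => by
    rw [cutOp, ent_mulOp_mul, ent_cutOp_comm, sub_self, zero_mul, mul_zero]

/-- In the strip the commutators with the cut β may be split and cycled, which leaves half the trace
of β (GGW - 2 GWG + WGG). With Z = G² - G and ∂Z = WG + GW - W this is rewritten so that each term
is W, ∂Z or contains the edge-localized Z. -/
theorem hall_lift (L : ℕ) {g : Hil UpperSite →L[ℂ] Hil UpperSite} (hg : Loc (fun _ => 1) (lift g))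
    {Z W : Op} (hZ : Z = lift g * lift g - lift g) (hW : W = dL (lift g)) :
    hall L (lift g) = (1 / 2) * tr (cutOp Prod.snd L
      * (W + dL Z + 3 * (Z * W) + W * Z - 2 * (lift g * dL Z))) := by
  set β := cutOp Prod.snd L with hβ
  set w := quarterProj * g - g * quarterProj with hw
  have hWw : W = lift w := by rw [hW, hw, lift_quarterProj_comm]
  have hWl : Loc (fun k => cutWt Prod.fst (-1) k ^ 2) (lift w) := by
    rw [← hWw, hW]; exact loc_dL hg 2
  have hm := mod_fst (-1) 2
  have hl : ∀ {x : Hil UpperSite →L[ℂ] Hil UpperSite},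
      Loc (fun k => cutWt Prod.fst (-1) k ^ 2) (lift x) →
      Loc (fun k => cutWt Prod.fst (-1) k ^ 2) (lift (g * x)) := fun h => by
    rw [lift_mul]; exact hg.mul_one_left hm.1 h
  have hr : ∀ {x : Hil UpperSite →L[ℂ] Hil UpperSite},
      Loc (fun k => cutWt Prod.fst (-1) k ^ 2) (lift x) →
      Loc (fun k => cutWt Prod.fst (-1) k ^ 2) (lift (x * g)) := fun h => by
    rw [lift_mul]; exact h.mul_one_right hm hg
  have k1 := tr_lift_mul_cutOp L (hl (hl hWl))
  have k2 := tr_lift_mul_cutOp L (hl (hr hWl))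
  have c1 := (absSum_cutOp_mul_lift L (hl (hl hWl))).isNuc
  have c2 := (absSum_cutOp_mul_lift L (hl (hr hWl))).isNuc
  have c3 := (absSum_cutOp_mul_lift L (hr (hr hWl))).isNuc
  have n1 := (absSum_lift_mul_cutOp L hWl).isNuc
  have n2 := (absSum_lift_mul_cutOp L (hr hWl)).isNuc
  have n4 := (absSum_cutOp_mul_lift L (hr hWl)).isNuc
  simp only [lift_mul, ← hWw, ← hβ] at k1 k2 c1 c2 c3 n1 n2 n4
  set G := lift g with hG
  have hdZ : dL Z = W * G + G * W - W := by rw [hZ, dL_sub, dL_mul, ← hW]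
  have e1 : β * (W + dL Z + 3 * (Z * W) + W * Z - 2 * (G * dL Z))
      = β * (G * (G * W)) - (β * (G * (W * G)) + β * (G * (W * G))) + β * (W * G * G) := by
    rw [hdZ, hZ]; noncomm_ring
  have e2 : W * dB L G * G = W * β * (G * G) - W * G * β * G := by
    simp only [dB, ← hβ]; noncomm_ring
  have e3 : dB L G * W * G = β * (G * (W * G)) - G * (β * (W * G)) := by
    simp only [dB, ← hβ]; noncomm_ring
  have t1 : tr (W * β * (G * G)) = tr (β * (G * (G * W))) := by
    rw [← tr_mul_comm n1, ← k1]; congr 1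
  have t2 : tr (W * G * β * G) = tr (β * (G * (W * G))) := by
    rw [← tr_mul_comm n2, ← k2]; congr 1
  have t3 : tr (G * (β * (W * G))) = tr (β * (W * G * G)) := by
    rw [tr_mul_comm n4, mul_assoc β]
  rw [hall, ← hW, e1, e2, e3, tr_sub (n1.mul_right _) (n2.mul_right _), tr_sub c2 (n4.mul_left _),
    tr_add (c1.sub (c2.add c2)) c3, tr_sub c1 (c2.add c2), tr_add c2 c2, t1, t2, t3]
  ring

/-- Under the cut, ∂G and ∂Z have zero diagonal and drop out. The other terms are nuclear without
the cut, which disappears in the limit; integration by parts turns each into a multiple of tr(Z ∂G),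
with total (3 + 1 + 2) / 2 = 3. -/
theorem tendsto_hall_lift {g : Hil UpperSite →L[ℂ] Hil UpperSite} (hg : Loc (fun _ => 1) (lift g))
    (hZ : Loc (fun k => cutWt Prod.snd 0 k ^ 2) (lift g * lift g - lift g)) :
    Tendsto (fun L : ℕ => hall L (lift g)) atTop
      (𝓝 (3 * tr ((lift g * lift g - lift g) * dL (lift g)))) := by
  set G := lift g with hG
  set Z := G * G - G with hZdef
  set W := dL G with hW
  have nZW : IsNuc (Z * W) := (absSum_mul_dL hZ hg).isNuc
  have ndZ : IsNuc (dL Z) := (absSum_dL hZ).isNuc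
  have nWZ : IsNuc (W * Z) := by
    refine (Loc.absSum_fst_snd (c := -1) (c' := 0) ?_).isNuc
    exact (loc_dL hg 2).mul (mod_fst (-1) 2) (mod_snd 0 2).1 hZ
  have nGdZ : IsNuc (G * dL Z) := ndZ.mul_left _
  have i1 : tr (W * Z) = -tr (G * dL Z) := tr_dL_mul nWZ nGdZ
  have i2 : tr (dL Z * G) = -tr (Z * W) := tr_dL_mul (ndZ.mul_right _) nZW
  rw [← tr_mul_comm ndZ] at i2
  have hlim : Tendsto (fun L : ℕ => (1 / 2 : ℂ) * (tr (cutOp Prod.snd L * (Z * W))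
      + tr (cutOp Prod.snd L * (Z * W)) + tr (cutOp Prod.snd L * (Z * W))
      + tr (cutOp Prod.snd L * (W * Z))
      - (tr (cutOp Prod.snd L * (G * dL Z)) + tr (cutOp Prod.snd L * (G * dL Z)))))
      atTop (𝓝 (3 * tr (Z * W))) := by
    have a := tendsto_tr_cutOp_mul nZW
    have b := tendsto_tr_cutOp_mul nGdZ
    have h := ((((a.add a).add a).add (tendsto_tr_cutOp_mul nWZ)).sub (b.add b)).const_mul
      (1 / 2 : ℂ)
    convert h using 2
    rw [i1, i2]
    ring
  refine hlim.congr fun L => ?_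
  have hWl : Loc (fun k => cutWt Prod.fst (-1) k ^ 2)
      (lift (quarterProj * g - g * quarterProj)) := by
    rw [lift_quarterProj_comm]; exact loc_dL hg 2
  have nW : IsNuc (cutOp Prod.snd L * W) := by
    have h := (absSum_cutOp_mul_lift L hWl).isNuc
    rwa [lift_quarterProj_comm] at h
  have e : cutOp Prod.snd L * (W + dL Z + 3 * (Z * W) + W * Z - 2 * (G * dL Z))
      = cutOp Prod.snd L * W + cutOp Prod.snd L * dL Z + (cutOp Prod.snd L * (Z * W)
      + cutOp Prod.snd L * (Z * W) + cutOp Prod.snd L * (Z * W)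
      + cutOp Prod.snd L * (W * Z)
      - (cutOp Prod.snd L * (G * dL Z) + cutOp Prod.snd L * (G * dL Z))) := by
    noncomm_ring
  have a := nZW.mul_left (cutOp Prod.snd L)
  have b := nGdZ.mul_left (cutOp Prod.snd L)
  have c := nWZ.mul_left (cutOp Prod.snd L)
  have d := ndZ.mul_left (cutOp Prod.snd L)
  rw [hall_lift L hg hZdef hW, e, tr_add (nW.add d) ((((a.add a).add a).add c).sub (b.add b)),
    tr_add nW d, tr_sub (((a.add a).add a).add c) (b.add b), tr_add ((a.add a).add a) c,
    tr_add (a.add a) a, tr_add a a, tr_add b b, tr_cutOp_mul_dL nW, tr_cutOp_mul_dL d]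
  ring

/-- If the Hall conductance of the bulk operator does not depend on the height, it is given by the
edge. -/
theorem hall_eq_tr {r : ℝ} {H : Op} (hH : IsSelfAdjoint H) (hfr : FinRange id r H)
    (hr : 1 ≤ r) {a b : ℝ} (hgap : Disjoint (Set.Icc a b) (spectrum ℝ H)) {g : ℝ → ℝ}
    (hg : IsSwitch g a b) {z : ℂ} (hz : ∀ L : ℕ, hall L (funcCalc g H) = z) :
    z = 3 * tr ((lift (funcCalc g (halfPlane H)) * lift (funcCalc g (halfPlane H))
        - lift (funcCalc g (halfPlane H))) * dL (lift (funcCalc g (halfPlane H)))) := by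
  have hgs := hg.smooth
  have hZs : ContDiff ℝ ∞ fun x => g x * g x - g x := (hgs.mul hgs).sub hgs
  have e1 : funcCalc (fun x => g x * g x - g x) (halfPlane H) = _ :=
    funcCalc_sub (hgs.continuous.mul hgs.continuous) hgs.continuous
  have e2 : funcCalc (fun x => g x * g x) (halfPlane H) = _ :=
    funcCalc_mul hgs.continuous hgs.continuous
  have hZ := loc_lift_of_gap hH hfr hr hZs
    (fun x hx => hg.mul_self_sub fun h => hgap.le_bot ⟨h, hx⟩) 2
  rw [e1, e2, lift_sub, lift_mul] at hZ
  have hG := loc_lift hH hfr hr hgs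
  have hD := loc_lift_sub hH hfr hr hgs 1
  simp only [pow_one] at hD
  have h1 := tendsto_hall_lift hG hZ
  have h2 := tendsto_hall_sub hG (loc_funcCalc hH hfr hr hgs) hD
  have h3 := h1.sub h2
  simp only [sub_sub_cancel, hz, sub_zero] at h3
  exact tendsto_nhds_unique tendsto_const_nhds h3

/-! ### The index of a pair of projections -/

section TwoProjections

variable {R : Type*} [Ring R] {P Q : R}

/-- For D = P - Q one has P - PQP = P D², and D² commutes with P and Q. -/
theorem sub_mul_mul_sq (hP : P * P = P) (hQ : Q * Q = Q) :
    (P - P * Q * P) * (P - P * Q * P) = P * ((P - Q) * (P - Q) * (P - Q) * (P - Q)) := by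
  have hP' : ∀ x, P * (P * x) = P * x := fun x => by rw [← mul_assoc, hP]
  simp only [sub_mul, mul_sub, mul_assoc, hP, hQ, hP']
  abel

theorem mul_sub_pow_four (hP : P * P = P) (hQ : Q * Q = Q) :
    Q * ((P - Q) * (P - Q) * (P - Q) * (P - Q)) = (Q - Q * P * Q) * (Q - Q * P * Q) := by
  rw [sub_mul_mul_sq hQ hP]
  noncomm_ring

/-- D³ - D⁵ is the commutator of [D³, Q] with QP, so D³ and D⁵ have the same trace as soon as D³ is
nuclear. -/
theorem sub_pow_three_sub_pow_five (hP : P * P = P) (hQ : Q * Q = Q) :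
    (P - Q) * (P - Q) * (P - Q) - (P - Q) * (P - Q) * (P - Q) * (P - Q) * (P - Q)
      = ((P - Q) * (P - Q) * (P - Q) * Q - Q * ((P - Q) * (P - Q) * (P - Q))) * (Q * P)
        - Q * P * ((P - Q) * (P - Q) * (P - Q) * Q - Q * ((P - Q) * (P - Q) * (P - Q))) := by
  have hP' : ∀ x, P * (P * x) = P * x := fun x => by rw [← mul_assoc, hP]
  have hQ' : ∀ x, Q * (Q * x) = Q * x := fun x => by rw [← mul_assoc, hQ]
  simp only [sub_mul, mul_sub, mul_assoc, hP, hQ, hP', hQ']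
  abel

end TwoProjections

section Compression

variable {I : Type} [DecidableEq I] {P F : Hil I →L[ℂ] Hil I}

theorem completeSpace_range (hP : P * P = P) : CompleteSpace P.range := by
  have h : (P.range : Set (Hil I)) = {ψ | P ψ = ψ} := by
    ext ψ
    constructor
    · rintro ⟨φ, rfl⟩
      exact congrArg (fun A : Hil I →L[ℂ] Hil I => A φ) hP
    · intro h
      exact ⟨ψ, h⟩
  have hc : IsClosed (P.range : Set (Hil I)) := h ▸ isClosed_eq P.continuous continuous_id
  exact hc.completeSpace_coe

/-- Fedosov's formula for the compression of a unitary operator. -/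
theorem index_compression (hP : P * P = P) (hPs : star P = P) (hF : F * star F = 1)
    (hF' : star F * F = 1)
    (h : IsNuc ((P - star F * P * F) * (P - star F * P * F) * (P - star F * P * F))) :
    (compression P F).IsFredholm ∧ ((compression P F).toLinearMap.index : ℂ)
      = tr ((P - star F * P * F) * (P - star F * P * F) * (P - star F * P * F)) := by
  have := completeSpace_range hP
  set G := star F with hG
  set Q := G * P * F with hQdef
  have hQ : Q * Q = Q := by
    rw [hQdef]
    calc G * P * F * (G * P * F) = G * P * (F * G) * (P * F) := by noncomm_ring
      _ = G * (P * P) * F := by rw [hF]; noncomm_ring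
      _ = _ := by rw [hP]
  set D := P - Q with hD
  have hD4 : IsNuc (D * D * D * D) := h.mul_right D
  set A := P - P * Q * P with hA
  set Y := Q - Q * P * Q with hY
  set B := P - P * F * P * G * P with hB
  have eA : A * A = P * (D * D * D * D) := sub_mul_mul_sq hP hQ
  have eY : Q * (D * D * D * D) = Y * Y := mul_sub_pow_four hP hQ
  have hP' : ∀ x, P * (P * x) = P * x := fun x => by rw [← mul_assoc, hP]
  have hFG : ∀ x, F * (G * x) = x := fun x => by rw [← mul_assoc, hF, one_mul]
  have hGF : ∀ x, G * (F * x) = x := fun x => by rw [← mul_assoc, hF', one_mul]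
  -- Conjugation by F turns the defect on the other side into that of the pair with P and Q
  -- exchanged.
  have eB : B = F * (Y * G) := by
    rw [hB, hY, hQdef]
    simp only [sub_mul, mul_sub, mul_assoc, hFG, hF, mul_one]
  have eBB : B * B = F * (Q * (D * D * D * D) * G) := by
    rw [eB, eY]
    simp only [mul_assoc, hGF]
  have nA : IsNuc (A * A) := eA ▸ hD4.mul_left P
  have nQ : IsNuc (Q * (D * D * D * D)) := hD4.mul_left Q
  have nB : IsNuc (B * B) := eBB ▸ (nQ.mul_right G).mul_left F
  have tB : tr (B * B) = tr (Q * (D * D * D * D)) := by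
    rw [eBB, tr_mul_comm (nQ.mul_right G), mul_assoc, hF', mul_one]
  set T := compression P F with hT
  set T' := compression P G with hT'
  have hfix : ∀ ψ : P.range, P (ψ : Hil I) = ψ := by
    rintro ⟨_, φ, rfl⟩
    exact congrArg (fun A : Hil I →L[ℂ] Hil I => A φ) hP
  have cA : ∀ ψ : P.range, (((1 - T' * T) ψ : P.range) : Hil I) = A ψ := fun ψ => by
    have : A ψ = P (ψ : Hil I) - P (G (P (F (P ψ)))) := by
      rw [hA, hQdef]
      change P (ψ : Hil I) - P (G (P (F (P ψ)))) = _
      rfl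
    rw [this, hfix ψ]
    rfl
  have cB : ∀ ψ : P.range, (((1 - T * T') ψ : P.range) : Hil I) = B ψ := fun ψ => by
    have : B ψ = P (ψ : Hil I) - P (F (P (G (P ψ)))) := rfl
    rw [this, hfix ψ]
    rfl
  have rA : NucTr ((1 - T' * T) * (1 - T' * T)) (tr (A * A)) :=
    nucTr_restrict hP hPs (by rw [eA, hP']) nA _ fun ψ => by
      change (((1 - T' * T) ((1 - T' * T) ψ) : P.range) : Hil I) = A (A ψ)
      rw [cA, cA]
  have rB : NucTr ((1 - T * T') * (1 - T * T')) (tr (B * B)) :=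
    nucTr_restrict hP hPs (by rw [hB]; simp only [sub_mul, mul_sub, mul_assoc, hP, hP']) nB _
      fun ψ => by
      change (((1 - T * T') ((1 - T * T') ψ) : P.range) : Hil I) = B (B ψ)
      rw [cB, cB]
  -- The defects of T' are of order D², which is not assumed nuclear. This parametrix squares them,
  -- and D⁴ is nuclear.
  set S := T' + T' - T' * T * T' with hS
  have s1 : 1 - S * T = (1 - T' * T) * (1 - T' * T) := by
    simp only [hS, sub_mul, mul_sub, add_mul, one_mul, mul_one, mul_assoc]
    abel
  have s2 : 1 - T * S = (1 - T * T') * (1 - T * T') := by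
    simp only [hS, sub_mul, mul_sub, mul_add, one_mul, mul_one, mul_assoc]
    abel
  have n1 : IsNuc (1 - S * T) := s1 ▸ rA.isNuc
  have n2 : IsNuc (1 - T * S) := s2 ▸ rB.isNuc
  refine ⟨isFredholm_of_isNuc n1 n2, ?_⟩
  rw [index_eq_tr_sub_tr n1 n2, s1, s2, rA.tr_eq, rB.tr_eq, tB, eA,
    ← tr_sub (hD4.mul_left P) nQ, ← sub_mul, ← hD]
  -- The index is tr(P D⁴) - tr(Q D⁴) = tr(D⁵), which is now lowered to tr(D³).
  have e5 := sub_pow_three_sub_pow_five hP hQ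
  rw [← hD] at e5
  have nE : IsNuc (D * D * D * Q - Q * (D * D * D)) := (h.mul_right Q).sub (h.mul_left Q)
  have h5 := congrArg tr e5
  rw [tr_sub h (hD4.mul_right D), tr_sub (nE.mul_right _) (nE.mul_left _), tr_mul_comm nE,
    sub_self] at h5
  rw [sub_eq_zero.1 h5]
  congr 1

end Compression

/-! ### Cyclic sums over triangles -/

/-- The sum of `φ` along the boundary of a triangle. -/
def cob (φ : Site → Site → ℝ) (p : Site × Site × Site) : ℝ :=
  φ p.1 p.2.1 + φ p.2.1 p.2.2 + φ p.2.2 p.1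

/-- The product of the entries of `P` along a triangle. -/
def cyc (P : Op) (p : Site × Site × Site) : ℂ :=
  ent P p.1 p.2.1 * ent P p.2.1 p.2.2 * ent P p.2.2 p.1

/-- A function of two sites which is localized near the origin and near the diagonal. -/
def LocFun (φ : Site → Site → ℝ) : Prop :=
  ∃ C, ∀ j k, |φ j k| ≤ C * dd j k ^ 3 * ((1 + ‖j‖) ^ 3)⁻¹

theorem summable_cyc_mul {P : Op} (hP : Loc (fun _ => 1) P) {φ : Site → Site → ℝ}
    (hφ : LocFun φ) : Summable fun p : Site × Site × Site => cyc P p * (φ p.1 p.2.1 : ℂ) := by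
  obtain ⟨a, hP⟩ := hP
  obtain ⟨C, hC⟩ := hφ
  have hs := summable_inv_one_add_norm_cube
  have h1 : Summable fun p : Site × Site × Site => ((1 + ‖p.1‖) ^ 3)⁻¹ *
      (((1 + ‖p.2.1‖) ^ 3)⁻¹ * ((1 + ‖p.2.2‖) ^ 3)⁻¹) :=
    hs.mul_of_nonneg (hs.mul_of_nonneg hs (fun _ => by positivity) (fun _ => by positivity))
      (fun _ => by positivity) (fun p => by positivity)
  let e : Site × Site × Site ≃ Site × Site × Site :=
    { toFun := fun p => (p.1, p.1 - p.2.1, p.2.1 - p.2.2)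
      invFun := fun p => (p.1, p.1 - p.2.1, p.1 - p.2.1 - p.2.2)
      left_inv := fun p => by simp
      right_inv := fun p => by simp }
  have h2 := (e.summable_iff.2 h1).mul_left (a 6 * a 3 * a 0 * C)
  refine Summable.of_norm_bounded h2 fun p => ?_
  obtain ⟨j, k, l⟩ := p
  have hkl := dd_pos k l
  have hjk := dd_pos j k
  have i1 := hP.norm_le (fun _ => one_pos) 6 j k
  have i2 := hP.norm_le (fun _ => one_pos) 3 k l
  have i3 := hP.norm_le (fun _ => one_pos) 0 l j
  have a6 := hP.nonneg (fun _ => one_pos) 6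
  have a3 := hP.nonneg (fun _ => one_pos) 3
  have a0 := hP.nonneg (fun _ => one_pos) 0
  rw [inv_one, mul_one] at i1 i2 i3
  rw [pow_zero, inv_one, mul_one] at i3
  simp only [cyc]
  rw [norm_mul, norm_mul, norm_mul, Complex.norm_real, Real.norm_eq_abs]
  calc ‖ent P j k‖ * ‖ent P k l‖ * ‖ent P l j‖ * |φ j k|
      ≤ (a 6 * (dd j k ^ 6)⁻¹) * (a 3 * (dd k l ^ 3)⁻¹) * a 0
        * (C * dd j k ^ 3 * ((1 + ‖j‖) ^ 3)⁻¹) := by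
        gcongr
        exact hC j k
    _ = a 6 * a 3 * a 0 * C * (((1 + ‖j‖) ^ 3)⁻¹ * ((dd j k ^ 3)⁻¹ * (dd k l ^ 3)⁻¹)) := by
        field_simp
    _ = _ := by
        simp only [Function.comp_apply, e, Equiv.coe_fn_mk, dd]

/-- The rotation of triangles. -/
def rotate : Site × Site × Site ≃ Site × Site × Site where
  toFun p := (p.2.1, p.2.2, p.1)
  invFun p := (p.2.2, p.1, p.2.1)
  left_inv _ := rfl
  right_inv _ := rfl

/-- Localized antisymmetric functions do not contribute. -/
theorem hasSum_cyc_cob_zero {P : Op} (hPP : P * P = P) (hP : Loc (fun _ => 1) P)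
    {φ : Site → Site → ℝ} (hφ : LocFun φ) (ha : ∀ j k, φ k j = -φ j k) :
    HasSum (fun p => cyc P p * (cob φ p : ℂ)) 0 := by
  have hs := summable_cyc_mul hP hφ
  set X := ∑' p : Site × Site × Site, cyc P p * (φ p.1 p.2.1 : ℂ) with hX
  have h0 : HasSum (fun p : Site × Site × Site => cyc P p * (φ p.1 p.2.1 : ℂ)) X := hs.hasSum
  -- As P² = P, summing over the third vertex closes the triangle to P_jk P_kj, which is symmetric
  -- in j and k while φ is antisymmetric.
  have h1 : HasSum (fun p : Site × Site => ent P p.1 p.2 * ent P p.2 p.1 * (φ p.1 p.2 : ℂ)) X := by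
    refine ((Equiv.prodAssoc Site Site Site).hasSum_iff.2 h0).prod_fiberwise fun p => ?_
    have h2 := (hasSum_ent_mul P P p.2 p.1).mul_left (ent P p.1 p.2 * (φ p.1 p.2 : ℂ))
    rw [hPP, mul_right_comm] at h2
    refine h2.congr_fun fun l => ?_
    simp only [Function.comp_apply, Equiv.prodAssoc_apply, cyc]
    ring
  have h2 : HasSum (fun p : Site × Site => ent P p.1 p.2 * ent P p.2 p.1 * (φ p.1 p.2 : ℂ)) (-X) := by
    refine ((Equiv.prodComm Site Site).hasSum_iff.2 h1).neg.congr_fun fun p => ?_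
    simp only [Function.comp_apply, Equiv.prodComm_apply, Prod.fst_swap, Prod.snd_swap, ha p.1 p.2]
    push_cast
    ring
  have hX0 : X = 0 := by
    have := h1.unique h2
    linear_combination this / 2
  rw [hX0] at h0
  have h3 := rotate.hasSum_iff.2 h0
  have h4 := rotate.hasSum_iff.2 h3
  have h5 := (h0.add h3).add h4
  rw [add_zero, add_zero] at h5
  refine h5.congr_fun fun p => ?_
  simp only [Function.comp_apply, cyc, cob, rotate, Equiv.coe_fn_mk]
  push_cast
  ring

/-- Two functions of pairs of sites differ by a localized function and a coboundary. -/
def Cohom (φ ψ : Site → Site → ℝ) : Prop :=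
  ∃ θ : Site → ℝ, LocFun fun j k => φ j k - ψ j k - (θ j - θ k)

theorem LocFun.add {φ ψ : Site → Site → ℝ} (h : LocFun φ) (h' : LocFun ψ) :
    LocFun fun j k => φ j k + ψ j k := by
  obtain ⟨C, hC⟩ := h
  obtain ⟨D, hD⟩ := h'
  refine ⟨C + D, fun j k => (abs_add_le _ _).trans ?_⟩
  rw [add_mul, add_mul]
  exact add_le_add (hC j k) (hD j k)

theorem LocFun.const_mul {φ : Site → Site → ℝ} (h : LocFun φ) (c : ℝ) :
    LocFun fun j k => c * φ j k := by
  obtain ⟨C, hC⟩ := h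
  refine ⟨|c| * C, fun j k => ?_⟩
  rw [abs_mul, mul_assoc, mul_assoc, ← mul_assoc C]
  exact mul_le_mul_of_nonneg_left (hC j k) (abs_nonneg c)

theorem Cohom.trans {φ ψ χ : Site → Site → ℝ} (h : Cohom φ ψ) (h' : Cohom ψ χ) : Cohom φ χ := by
  obtain ⟨θ, h⟩ := h
  obtain ⟨η, h'⟩ := h'
  refine ⟨fun j => θ j + η j, ?_⟩
  convert h.add h' using 3
  ring

theorem Cohom.const_mul {φ ψ : Site → Site → ℝ} (h : Cohom φ ψ) (c : ℝ) :
    Cohom (fun j k => c * φ j k) (fun j k => c * ψ j k) := by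
  obtain ⟨θ, h⟩ := h
  refine ⟨fun j => c * θ j, ?_⟩
  convert h.const_mul c using 3
  ring

/-- The coboundary θ j - θ k cancels around each triangle, and the localized remainder is
antisymmetric and sums to zero. -/
theorem Cohom.hasSum {P : Op} (hPP : P * P = P) (hP : Loc (fun _ => 1) P)
    {φ ψ : Site → Site → ℝ} (h : Cohom φ ψ) (hφ : ∀ j k, φ k j = -φ j k)
    (hψ : ∀ j k, ψ k j = -ψ j k) {z : ℂ} (hz : HasSum (fun p => cyc P p * (cob ψ p : ℂ)) z) :
    HasSum (fun p => cyc P p * (cob φ p : ℂ)) z := by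
  obtain ⟨θ, h⟩ := h
  have h1 := hasSum_cyc_cob_zero hPP hP h fun j k => by rw [hφ j k, hψ j k]; ring
  have h2 := h1.add hz
  rw [zero_add] at h2
  refine h2.congr_fun fun p => ?_
  simp only [cob]
  push_cast
  ring

/-! ### The Hall conductance as a cyclic sum -/

/-- The indicator function of `{x : x ≤ c}`. -/
def step (c x : ℤ) : ℝ := if x ≤ c then 1 else 0

/-- The function of pairs of sites which describes a flux at the corner `m`. -/
def corner (m j k : Site) : ℝ :=
  (step m.1 j.1 - step m.1 k.1) * (step m.2 j.2 + step m.2 k.2) / 2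

theorem corner_swap (m j k : Site) : corner m k j = -corner m j k := by
  simp only [corner]; ring

/-- A commutator with a cut multiplies entries by a difference of step functions; the
antisymmetrized product of two such differences is exactly the sum of `corner` around the triangle.
-/
theorem hasSum_hall {P : Op} (hP : Loc (fun _ => 1) P) (L : ℤ) :
    HasSum (fun p => cyc P p * (cob (corner (-1, L)) p : ℂ)) (hall L P) := by
  have h1 := hP.cutOp_comm abs_fst_le (-1) 2 (fun _ => one_pos)
  have h2 := hP.cutOp_comm abs_snd_le L 2 (fun _ => one_pos)
  simp only [mul_one] at h1 h2
  have s1 := summable_cutWt (-1) L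
  have t1 := hasSum_triple (mod_fst (-1) 2) (mod_snd L 2) mod_one (by simpa only [mul_one] using s1)
    h1 h2 hP
  have t2 := hasSum_triple (mod_snd L 2) (mod_fst (-1) 2) mod_one
    (by simpa only [mul_one, mul_comm (cutWt Prod.snd L _ ^ 2)] using s1) h2 h1 hP
  refine ((t1.sub t2).mul_left (1 / 2)).congr_fun fun p => ?_
  have e : ∀ (c x : ℤ), (if x ≤ c then (1 : ℂ) else 0) = ((step c x : ℝ) : ℂ) := fun c x => by
    simp only [step]; split_ifs <;> simp
  simp only [ent_cutOp_comm, e, cyc, cob, corner]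
  push_cast
  ring

theorem LocFun.of_bounded {φ : Site → Site → ℝ} {C K : ℝ} (hK : 0 ≤ K) (hφ : ∀ j k, |φ j k| ≤ C)
    (h : ∀ j k, φ j k ≠ 0 → 1 + ‖j‖ ≤ K * dd j k) : LocFun φ := by
  have hC : 0 ≤ C := (abs_nonneg _).trans (hφ 0 0)
  refine ⟨C * K ^ 3, fun j k => ?_⟩
  have hd := dd_pos j k
  by_cases h0 : φ j k = 0
  · rw [h0, abs_zero]; positivity
  · refine (hφ j k).trans ?_
    rw [← div_eq_mul_inv, le_div_iff₀ (by positivity), mul_assoc, ← mul_pow]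
    have := h j k h0
    gcongr

theorem norm_site_le {j : Site} {c : ℝ} (h1 : |(j.1 : ℝ)| ≤ c) (h2 : |(j.2 : ℝ)| ≤ c) : ‖j‖ ≤ c := by
  rw [Prod.norm_def, Int.norm_eq_abs, Int.norm_eq_abs]
  exact max_le h1 h2

theorem abs_fst_le_norm (j : Site) : |(j.1 : ℝ)| ≤ ‖j‖ := by
  rw [Prod.norm_def, Int.norm_eq_abs, Int.norm_eq_abs]; exact le_max_left _ _

theorem abs_snd_le_norm (j : Site) : |(j.2 : ℝ)| ≤ ‖j‖ := by
  rw [Prod.norm_def, Int.norm_eq_abs, Int.norm_eq_abs]; exact le_max_right _ _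

/-- If the interval between `x` and `y` meets `[-c, c]` then `x` is bounded. -/
theorem abs_le_of_step_ne {c x y : ℤ} (h : step c x ≠ step c y) :
    |(x : ℝ)| ≤ |(c : ℝ)| + |((x - y : ℤ) : ℝ)| + 1 := by
  have : |x| ≤ |c| + |x - y| + 1 := by
    simp only [step] at h
    rcases abs_cases x with h1 | h1 <;> rcases abs_cases c with h2 | h2 <;>
      rcases abs_cases (x - y) with h3 | h3 <;> split_ifs at h <;> first | omega | exact absurd rfl h
  exact_mod_cast this

theorem abs_le_of_step_sub_ne {c d x : ℤ} (h : step c x ≠ step d x) :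
    |(x : ℝ)| ≤ |(c : ℝ)| + |(d : ℝ)| := by
  have : |x| ≤ |c| + |d| := by
    simp only [step] at h
    rcases abs_cases x with h1 | h1 <;> rcases abs_cases c with h2 | h2 <;>
      rcases abs_cases d with h3 | h3 <;> split_ifs at h <;> first | omega | exact absurd rfl h
  exact_mod_cast this

theorem step_mem (c x : ℤ) : 0 ≤ step c x ∧ step c x ≤ 1 := by
  simp only [step]; split_ifs <;> norm_num

/-- The difference is supported on pairs that straddle the vertical line at a and have one point in
the horizontal strip between b and b'. For these, ‖j‖ is controlled by the distance of the pair. -/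
theorem cohom_corner_snd (a b b' : ℤ) : Cohom (corner (a, b)) (corner (a, b')) := by
  refine ⟨0, ?_⟩
  have e : (fun j k => corner (a, b) j k - corner (a, b') j k
      - ((0 : Site → ℝ) j - (0 : Site → ℝ) k)) = fun j k => (step a j.1 - step a k.1)
        * ((step b j.2 - step b' j.2) + (step b k.2 - step b' k.2)) / 2 := by
    funext j k
    simp only [corner, Pi.zero_apply]
    ring
  rw [e]
  refine LocFun.of_bounded (C := 2) (K := |(a : ℝ)| + |(b : ℝ)| + |(b' : ℝ)| + 3) (by positivity)
    (fun j k => ?_) fun j k h => ?_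
  · have h1 := step_mem a j.1; have h2 := step_mem a k.1; have h3 := step_mem b j.2
    have h4 := step_mem b k.2; have h5 := step_mem b' j.2; have h6 := step_mem b' k.2
    rw [abs_div, abs_mul, abs_of_pos (two_pos : (0 : ℝ) < 2), div_le_iff₀ two_pos]
    have i1 : |step a j.1 - step a k.1| ≤ 1 := abs_le.2 ⟨by linarith, by linarith⟩
    have i2 : |step b j.2 - step b' j.2 + (step b k.2 - step b' k.2)| ≤ 4 :=
      abs_le.2 ⟨by linarith, by linarith⟩
    calc _ ≤ (1 : ℝ) * 4 := by gcongr
      _ = _ := by norm_num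
  · have n1 : step a j.1 ≠ step a k.1 := fun h1 => h (by rw [h1]; ring)
    have n2 : step b j.2 ≠ step b' j.2 ∨ step b k.2 ≠ step b' k.2 := by
      by_contra! h1
      exact h (by rw [h1.1, h1.2]; ring)
    have i1 := abs_le_of_step_ne n1
    have i2 := abs_fst_le j k
    have i3 := abs_snd_le j k
    have i4 : |(j.2 : ℝ)| ≤ |(b : ℝ)| + |(b' : ℝ)| + |((j.2 - k.2 : ℤ) : ℝ)| := by
      rcases n2 with n2 | n2
      · have := abs_le_of_step_sub_ne n2
        have := abs_nonneg ((j.2 - k.2 : ℤ) : ℝ)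
        linarith
      · have := abs_le_of_step_sub_ne n2
        have h5 := abs_add_le (k.2 : ℝ) ((j.2 - k.2 : ℤ) : ℝ)
        have h6 : (k.2 : ℝ) + ((j.2 - k.2 : ℤ) : ℝ) = j.2 := by push_cast; ring
        rw [h6] at h5
        linarith
    have ha := abs_nonneg (a : ℝ)
    have hb := abs_nonneg (b : ℝ)
    have hb' := abs_nonneg (b' : ℝ)
    have hn := norm_nonneg (j - k)
    have : ‖j‖ ≤ |(a : ℝ)| + |(b : ℝ)| + |(b' : ℝ)| + 1 + ‖j - k‖ :=
      norm_site_le (by linarith) (by linarith)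
    simp only [dd]
    nlinarith [mul_nonneg ha hn, mul_nonneg hb hn, mul_nonneg hb' hn]

/-- The coboundary of the product of the two step functions exchanges the roles of the coordinates
(discrete Leibniz rule), which reduces a horizontal move to the argument for a vertical one. -/
theorem cohom_corner_fst (a a' b : ℤ) : Cohom (corner (a, b)) (corner (a', b)) := by
  refine ⟨fun j => (step a j.1 - step a' j.1) * step b j.2, ?_⟩
  have e : (fun j k => corner (a, b) j k - corner (a', b) j k
      - ((step a j.1 - step a' j.1) * step b j.2 - (step a k.1 - step a' k.1) * step b k.2))
      = fun j k => (step b k.2 - step b j.2)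
        * ((step a j.1 - step a' j.1) + (step a k.1 - step a' k.1)) / 2 := by
    funext j k
    simp only [corner]
    ring
  rw [e]
  refine LocFun.of_bounded (C := 2) (K := |(b : ℝ)| + |(a : ℝ)| + |(a' : ℝ)| + 3) (by positivity)
    (fun j k => ?_) fun j k h => ?_
  · have h1 := step_mem b j.2; have h2 := step_mem b k.2; have h3 := step_mem a j.1
    have h4 := step_mem a k.1; have h5 := step_mem a' j.1; have h6 := step_mem a' k.1
    rw [abs_div, abs_mul, abs_of_pos (two_pos : (0 : ℝ) < 2), div_le_iff₀ two_pos]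
    have i1 : |step b k.2 - step b j.2| ≤ 1 := abs_le.2 ⟨by linarith, by linarith⟩
    have i2 : |step a j.1 - step a' j.1 + (step a k.1 - step a' k.1)| ≤ 4 :=
      abs_le.2 ⟨by linarith, by linarith⟩
    calc _ ≤ (1 : ℝ) * 4 := by gcongr
      _ = _ := by norm_num
  · have n1 : step b j.2 ≠ step b k.2 := fun h1 => h (by rw [h1]; ring)
    have n2 : step a j.1 ≠ step a' j.1 ∨ step a k.1 ≠ step a' k.1 := by
      by_contra! h1
      exact h (by rw [h1.1, h1.2]; ring)
    have i1 := abs_le_of_step_ne n1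
    have i2 := abs_fst_le j k
    have i3 := abs_snd_le j k
    have i4 : |(j.1 : ℝ)| ≤ |(a : ℝ)| + |(a' : ℝ)| + |((j.1 - k.1 : ℤ) : ℝ)| := by
      rcases n2 with n2 | n2
      · have := abs_le_of_step_sub_ne n2
        have := abs_nonneg ((j.1 - k.1 : ℤ) : ℝ)
        linarith
      · have := abs_le_of_step_sub_ne n2
        have h5 := abs_add_le (k.1 : ℝ) ((j.1 - k.1 : ℤ) : ℝ)
        have h6 : (k.1 : ℝ) + ((j.1 - k.1 : ℤ) : ℝ) = j.1 := by push_cast; ring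
        rw [h6] at h5
        linarith
    have ha := abs_nonneg (a : ℝ)
    have hb := abs_nonneg (b : ℝ)
    have ha' := abs_nonneg (a' : ℝ)
    have hn := norm_nonneg (j - k)
    have : ‖j‖ ≤ |(b : ℝ)| + |(a : ℝ)| + |(a' : ℝ)| + 1 + ‖j - k‖ :=
      norm_site_le (by linarith) (by linarith)
    simp only [dd]
    nlinarith [mul_nonneg ha hn, mul_nonneg hb hn, mul_nonneg ha' hn]

theorem cohom_corner (m m' : Site) : Cohom (corner m) (corner m') :=
  (cohom_corner_fst m.1 m'.1 m.2).trans (cohom_corner_snd m'.1 m.2 m'.2)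

/-! ### The index of the phase operator -/

/-- The symbol of the phase operator. -/
def phase (m n : Site) : ℂ := -(fluxCoord m n / (‖fluxCoord m n‖ : ℂ))

/-- The angle of the site `n`, seen from the flux, with a cut downwards. -/
def ang (m n : Site) : ℝ := Complex.arg (-Complex.I * fluxCoord m n)

theorem fluxCoord_re (m n : Site) : (fluxCoord m n).re = n.1 - m.1 - 1 / 2 := by
  simp [fluxCoord]; ring

theorem fluxCoord_im (m n : Site) : (fluxCoord m n).im = n.2 - m.2 - 1 / 2 := by
  simp [fluxCoord]; ring

theorem fluxCoord_ne_zero (m n : Site) : fluxCoord m n ≠ 0 := fun h => by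
  have h1 := congrArg Complex.re h
  rw [fluxCoord_re, Complex.zero_re] at h1
  have h2 : (2 * (n.1 - m.1) : ℤ) = 1 := by
    have : ((2 * (n.1 - m.1) : ℤ) : ℝ) = 1 := by push_cast; linarith
    exact_mod_cast this
  omega

theorem phase_eq (m n : Site) : phase m n = -Complex.I * Complex.exp (ang m n * Complex.I) := by
  have h0 : (‖fluxCoord m n‖ : ℂ) ≠ 0 := by
    exact_mod_cast norm_ne_zero_iff.2 (fluxCoord_ne_zero m n)
  have h := Complex.norm_mul_exp_arg_mul_I (-Complex.I * fluxCoord m n)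
  rw [norm_mul, norm_neg, Complex.norm_I, one_mul] at h
  rw [phase, ang, ← neg_div, div_eq_iff h0]
  linear_combination Complex.I * h - fluxCoord m n * Complex.I_mul_I

theorem norm_phase (m n : Site) : ‖phase m n‖ = 1 := by
  rw [phase_eq, norm_mul, Complex.norm_exp_ofReal_mul_I, norm_neg, Complex.norm_I, one_mul]

theorem conj_phase_mul_phase (m j k : Site) : (starRingEnd ℂ) (phase m j) * phase m k
    = Complex.exp (((ang m k - ang m j : ℝ) : ℂ) * Complex.I) := by
  rw [phase_eq, phase_eq, map_mul, ← Complex.exp_conj, map_mul, Complex.conj_ofReal, map_neg,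
    Complex.conj_I, Complex.ofReal_sub, sub_mul, sub_eq_add_neg, Complex.exp_add, mul_neg, neg_neg]
  linear_combination -(Complex.exp (ang m k * Complex.I) * Complex.exp (-(ang m j * Complex.I)))
    * Complex.I_mul_I

theorem one_add_norm_le (m n : Site) : 1 + ‖n‖ ≤ (4 + 2 * ‖m‖) * ‖fluxCoord m n‖ := by
  have h1 := Complex.abs_re_le_norm (fluxCoord m n)
  have h2 := Complex.abs_im_le_norm (fluxCoord m n)
  rw [fluxCoord_re] at h1
  rw [fluxCoord_im] at h2
  have h3 : 1 / 2 ≤ |(n.1 - m.1 - 1 / 2 : ℝ)| := by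
    rcases le_or_gt n.1 m.1 with h | h
    · have : (n.1 : ℝ) ≤ m.1 := by exact_mod_cast h
      rw [abs_of_neg (by linarith)]; linarith
    · have : (m.1 : ℝ) + 1 ≤ n.1 := by exact_mod_cast h
      rw [abs_of_nonneg (by linarith)]; linarith
  have a1 := abs_fst_le_norm m
  have a2 := abs_snd_le_norm m
  have e : ∀ x y : ℝ, |x| ≤ |x - y - 1 / 2| + |y| + 1 / 2 := fun x y => by
    have i1 := abs_add_le (x - y - 1 / 2) (y + 1 / 2)
    have i2 := abs_add_le y (1 / 2)
    rw [abs_of_pos (by norm_num : (0 : ℝ) < 1 / 2)] at i2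
    have i3 : x - y - 1 / 2 + (y + 1 / 2) = x := by ring
    rw [i3] at i1
    linarith
  have h4 : ‖n‖ ≤ ‖fluxCoord m n‖ + ‖m‖ + 1 / 2 :=
    norm_site_le (by linarith [e n.1 m.1]) (by linarith [e n.2 m.2])
  nlinarith [norm_nonneg m]

theorem norm_fluxCoord_sub_le (m j k : Site) : ‖fluxCoord m j - fluxCoord m k‖ ≤ 2 * ‖j - k‖ := by
  refine (Complex.norm_le_abs_re_add_abs_im _).trans ?_
  rw [Complex.sub_re, Complex.sub_im, fluxCoord_re, fluxCoord_im, fluxCoord_re, fluxCoord_im]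
  have h1 := abs_fst_le j k
  have h2 := abs_snd_le j k
  push_cast at h1 h2
  have e1 : (j.1 - m.1 - 1 / 2 - (k.1 - m.1 - 1 / 2) : ℝ) = j.1 - k.1 := by ring
  have e2 : (j.2 - m.2 - 1 / 2 - (k.2 - m.2 - 1 / 2) : ℝ) = j.2 - k.2 := by ring
  rw [e1, e2]
  linarith

/-- Normalizing z and w changes their difference to at most 2|z - w| / |z|, and the half-integer
offset of the flux keeps |z| comparable to 1 + ‖j‖. -/
theorem norm_phase_sub_le (m j k : Site) :
    ‖phase m j - phase m k‖ ≤ (16 + 8 * ‖m‖) * dd j k * (1 + ‖j‖)⁻¹ := by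
  set z := fluxCoord m j with hz
  set w := fluxCoord m k with hw
  have hz0 : 0 < ‖z‖ := norm_pos_iff.2 (fluxCoord_ne_zero m j)
  have hw0 : 0 < ‖w‖ := norm_pos_iff.2 (fluxCoord_ne_zero m k)
  have hzc : (‖z‖ : ℂ) ≠ 0 := by exact_mod_cast hz0.ne'
  have hwc : (‖w‖ : ℂ) ≠ 0 := by exact_mod_cast hw0.ne'
  have e : phase m j - phase m k
      = (w - z) / ‖z‖ + w / ‖w‖ * (((‖z‖ - ‖w‖ : ℝ) : ℂ) / ‖z‖) := by
    rw [phase, phase, ← hz, ← hw, Complex.ofReal_sub]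
    field_simp
    ring
  have h1 : ‖(w - z) / (‖z‖ : ℂ)‖ = ‖z - w‖ / ‖z‖ := by
    rw [norm_div, norm_sub_rev, Complex.norm_real, norm_norm]
  have h2 : ‖w / (‖w‖ : ℂ) * (((‖z‖ - ‖w‖ : ℝ) : ℂ) / ‖z‖)‖ ≤ ‖z - w‖ / ‖z‖ := by
    rw [norm_mul, norm_div, norm_div, Complex.norm_real, Complex.norm_real, Complex.norm_real,
      norm_norm, norm_norm, div_self hw0.ne', one_mul, Real.norm_eq_abs]
    gcongr
    exact abs_norm_sub_norm_le z w
  have h3 : ‖z - w‖ ≤ 2 * dd j k :=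
    (norm_fluxCoord_sub_le m j k).trans (by simp only [dd]; linarith)
  have h4 := one_add_norm_le m j
  have hd := dd_pos j k
  have hm := norm_nonneg m
  have hj : 0 < 1 + ‖j‖ := by positivity
  calc ‖phase m j - phase m k‖ ≤ 2 * (‖z - w‖ / ‖z‖) := by
        rw [e]; refine (norm_add_le _ _).trans ?_; rw [h1]; linarith
    _ ≤ 2 * (2 * dd j k / ‖z‖) := by gcongr
    _ = 4 * dd j k * ‖z‖⁻¹ := by ring
    _ ≤ 4 * dd j k * ((4 + 2 * ‖m‖) * (1 + ‖j‖)⁻¹) := by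
        gcongr
        rw [← div_eq_mul_inv, inv_le_comm₀ hz0 (by positivity), inv_div, div_le_iff₀ (by positivity)]
        linarith
    _ = _ := by ring

theorem norm_exp_sub_one (m j k : Site) :
    ‖Complex.exp (((ang m k - ang m j : ℝ) : ℂ) * Complex.I) - 1‖ = ‖phase m j - phase m k‖ := by
  rw [← conj_phase_mul_phase]
  have h : (starRingEnd ℂ) (phase m j) * phase m j = 1 := by
    rw [Complex.conj_mul', norm_phase]; norm_num
  rw [← h, ← mul_sub, norm_mul, RCLike.norm_conj, norm_phase, one_mul, norm_sub_rev]

/-! #### The angles -/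

theorem ang_left {m n : Site} (h : n.1 ≤ m.1) : 0 < ang m n ∧ ang m n < Real.pi := by
  have h' : (n.1 : ℝ) ≤ m.1 := by exact_mod_cast h
  have h1 : 0 < (-Complex.I * fluxCoord m n).im := by
    simp [fluxCoord_re]; linarith
  refine ⟨(Complex.arg_nonneg_iff.2 h1.le).lt_of_ne fun h2 => ?_,
    (Complex.arg_le_pi _).lt_of_ne fun h2 => ?_⟩
  · exact h1.ne' (Complex.arg_eq_zero_iff.1 h2.symm).2
  · exact h1.ne' (Complex.arg_eq_pi_iff.1 h2).2

theorem ang_right {m n : Site} (h : ¬n.1 ≤ m.1) : -Real.pi < ang m n ∧ ang m n < 0 := by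
  have h' : (m.1 : ℝ) + 1 ≤ n.1 := by exact_mod_cast not_le.1 h
  refine ⟨Complex.neg_pi_lt_arg _, Complex.arg_neg_iff.2 ?_⟩
  simp [fluxCoord_re]; linarith

theorem re_rotate (m n : Site) : (-Complex.I * fluxCoord m n).re = n.2 - m.2 - 1 / 2 := by
  rw [← fluxCoord_im]; simp

theorem ang_upper {m n : Site} (h : ¬n.2 ≤ m.2) :
    -(Real.pi / 2) ≤ ang m n ∧ ang m n ≤ Real.pi / 2 := by
  have h' : (m.2 : ℝ) + 1 ≤ n.2 := by exact_mod_cast not_le.1 h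
  refine abs_le.1 (Complex.abs_arg_le_pi_div_two_iff.2 ?_)
  rw [re_rotate]; linarith

theorem ang_left_lower {m n : Site} (h1 : n.1 ≤ m.1) (h2 : n.2 ≤ m.2) :
    Real.pi / 2 < ang m n := by
  have h' : (n.2 : ℝ) ≤ m.2 := by exact_mod_cast h2
  by_contra! h
  rcases Complex.arg_le_pi_div_two_iff.1 h with h3 | h3
  · rw [re_rotate] at h3; linarith
  · exact absurd (ang_left h1).1 (Complex.arg_neg_iff.2 h3).not_gt

theorem ang_right_lower {m n : Site} (h1 : ¬n.1 ≤ m.1) (h2 : n.2 ≤ m.2) :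
    ang m n < -(Real.pi / 2) := by
  have h' : (n.2 : ℝ) ≤ m.2 := by exact_mod_cast h2
  by_contra! h
  rcases Complex.neg_pi_div_two_le_arg_iff.1 h with h3 | h3
  · rw [re_rotate] at h3; linarith
  · exact absurd (ang_right h1).2 (Complex.arg_nonneg_iff.2 h3).not_gt

/-- The angle jumps by 2π across the ray going down from the flux, and `corner` counts the signed
crossings of that ray, so the corrected difference is a representative in [-π, π]. Pairs separated
by both lines are excluded: there `corner` is ±1/2. -/
theorem ang_sub_add_corner {m j k : Site}
    (h : (j.1 ≤ m.1 ↔ k.1 ≤ m.1) ∨ (j.2 ≤ m.2 ↔ k.2 ≤ m.2)) :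
    |ang m k - ang m j + 2 * Real.pi * corner m j k| ≤ Real.pi ∧
      ∃ n : ℤ, corner m j k = n := by
  by_cases hj : j.1 ≤ m.1 <;> by_cases hk : k.1 ≤ m.1
  · have hc : corner m j k = 0 := by simp [corner, step, hj, hk]
    rw [hc, mul_zero, add_zero, abs_le]
    have := ang_left hj; have := ang_left hk
    exact ⟨⟨by linarith, by linarith⟩, ⟨0, by simp⟩⟩
  · have h' : j.2 ≤ m.2 ↔ k.2 ≤ m.2 := h.resolve_left fun h1 => hk (h1.1 hj)
    by_cases h2 : j.2 ≤ m.2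
    · have h3 := h'.1 h2
      have hc : corner m j k = 1 := by simp [corner, step, hj, hk, h2, h3]
      rw [hc, mul_one, abs_le]
      have := ang_left hj; have := ang_right hk
      have := ang_left_lower hj h2; have := ang_right_lower hk h3
      exact ⟨⟨by linarith, by linarith⟩, ⟨1, by simp⟩⟩
    · have h3 : ¬k.2 ≤ m.2 := fun h3 => h2 (h'.2 h3)
      have hc : corner m j k = 0 := by simp [corner, step, h2, h3]
      rw [hc, mul_zero, add_zero, abs_le]
      have := ang_upper h2; have := ang_upper h3
      exact ⟨⟨by linarith, by linarith⟩, ⟨0, by simp⟩⟩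
  · have h' : j.2 ≤ m.2 ↔ k.2 ≤ m.2 := h.resolve_left fun h1 => hj (h1.2 hk)
    by_cases h2 : j.2 ≤ m.2
    · have h3 := h'.1 h2
      have hc : corner m j k = -1 := by simp [corner, step, hj, hk, h2, h3]
      rw [hc, mul_neg_one, abs_le]
      have := ang_right hj; have := ang_left hk
      have := ang_right_lower hj h2; have := ang_left_lower hk h3
      exact ⟨⟨by linarith, by linarith⟩, ⟨-1, by simp⟩⟩
    · have h3 : ¬k.2 ≤ m.2 := fun h3 => h2 (h'.2 h3)
      have hc : corner m j k = 0 := by simp [corner, step, h2, h3]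
      rw [hc, mul_zero, add_zero, abs_le]
      have := ang_upper h2; have := ang_upper h3
      exact ⟨⟨by linarith, by linarith⟩, ⟨0, by simp⟩⟩
  · have hc : corner m j k = 0 := by simp [corner, step, hj, hk]
    rw [hc, mul_zero, add_zero, abs_le]
    have := ang_right hj; have := ang_right hk
    exact ⟨⟨by linarith, by linarith⟩, ⟨0, by simp⟩⟩

theorem abs_le_norm_exp_sub_one {x : ℝ} (h : |x| ≤ Real.pi) :
    |x| ≤ 2 * ‖Complex.exp ((x : ℂ) * Complex.I) - 1‖ := by
  have h1 := Real.mul_abs_le_abs_sin (x := x / 2) (by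
    rw [abs_div, abs_of_pos (two_pos : (0 : ℝ) < 2)]; linarith)
  rw [mul_comm (x : ℂ), Complex.norm_exp_I_mul_ofReal_sub_one, norm_mul, Real.norm_eq_abs,
    Real.norm_eq_abs, abs_of_pos (two_pos : (0 : ℝ) < 2)]
  rw [abs_div, abs_of_pos (two_pos : (0 : ℝ) < 2)] at h1
  have hpi := Real.pi_pos
  have h2 : 2 / Real.pi * (|x| / 2) = |x| / Real.pi := by field_simp
  rw [h2, div_le_iff₀ hpi] at h1
  nlinarith [Real.pi_le_four, abs_nonneg (Real.sin (x / 2))]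

theorem LocFun.of_cases {φ : Site → Site → ℝ} (p : Site → Site → Prop)
    (h : ∃ C, ∀ j k, p j k → |φ j k| ≤ C * dd j k ^ 3 * ((1 + ‖j‖) ^ 3)⁻¹)
    (h' : ∃ C, ∀ j k, ¬p j k → |φ j k| ≤ C * dd j k ^ 3 * ((1 + ‖j‖) ^ 3)⁻¹) : LocFun φ := by
  obtain ⟨C, hC⟩ := h
  obtain ⟨D, hD⟩ := h'
  refine ⟨max C D, fun j k => ?_⟩
  have := dd_pos j k
  by_cases hp : p j k
  · refine (hC j k hp).trans ?_
    gcongr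
    exact le_max_left _ _
  · refine (hD j k hp).trans ?_
    gcongr
    exact le_max_right _ _

/-- With θ = -ang the difference is sin α - α for the corrected angle difference α. It is cubic in
α, and α is of order `dd j k / (1 + ‖j‖)`, which is precisely the decay asked by `LocFun`. For pairs
separated by both lines, boundedness suffices, since ‖j‖ is then controlled by their distance. -/
theorem cohom_sin (m : Site) : Cohom (fun j k => Real.sin (ang m k - ang m j))
    fun j k => 2 * Real.pi * corner m j k := by
  refine ⟨fun j => -ang m j, ?_⟩
  refine LocFun.of_cases
    (fun j k => (j.1 ≤ m.1 ↔ k.1 ≤ m.1) ∨ (j.2 ≤ m.2 ↔ k.2 ≤ m.2)) ?_ ?_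
  · refine ⟨(2 * (16 + 8 * ‖m‖)) ^ 3 / 6, fun j k h => ?_⟩
    obtain ⟨h1, n, hn⟩ := ang_sub_add_corner h
    set α := ang m k - ang m j + 2 * Real.pi * corner m j k with hα
    have hα' : α = ang m k - ang m j + n * (2 * Real.pi) := by rw [hα, hn]; ring
    have hs : Real.sin (ang m k - ang m j) = Real.sin α := by
      rw [hα', Real.sin_add_int_mul_two_pi]
    have he : Complex.exp (((ang m k - ang m j : ℝ) : ℂ) * Complex.I)
        = Complex.exp ((α : ℂ) * Complex.I) := by
      refine Complex.exp_eq_exp_iff_exists_int.2 ⟨-n, ?_⟩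
      rw [hα']
      push_cast
      ring
    have e : Real.sin (ang m k - ang m j) - 2 * Real.pi * corner m j k - (-ang m j - -ang m k)
        = Real.sin α - α := by rw [hs, hα]; ring
    have h2 := abs_le_norm_exp_sub_one h1
    rw [← he, norm_exp_sub_one] at h2
    have h3 := norm_phase_sub_le m j k
    have h4 : |α| ≤ 2 * (16 + 8 * ‖m‖) * dd j k * (1 + ‖j‖)⁻¹ := by linarith
    show |Real.sin (ang m k - ang m j) - 2 * Real.pi * corner m j k - (-ang m j - -ang m k)| ≤ _
    rw [e]
    rw [abs_sub_comm]
    refine (Real.abs_sub_sin_le α).trans ?_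
    calc |α| ^ 3 / 6 ≤ (2 * (16 + 8 * ‖m‖) * dd j k * (1 + ‖j‖)⁻¹) ^ 3 / 6 := by gcongr
      _ = _ := by rw [mul_pow, mul_pow, inv_pow]; ring
  · refine ⟨(1 + 2 * Real.pi + 2 * Real.pi) * (‖m‖ + 2) ^ 3, fun j k h => ?_⟩
    push Not at h
    have hpi := Real.pi_pos
    have hd := one_le_dd j k
    have n1 : step m.1 j.1 ≠ step m.1 k.1 := by
      simp only [step]; split_ifs <;> first | (exfalso; omega) | norm_num
    have n2 : step m.2 j.2 ≠ step m.2 k.2 := by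
      simp only [step]; split_ifs <;> first | (exfalso; omega) | norm_num
    have i1 := abs_le_of_step_ne n1
    have i2 := abs_le_of_step_ne n2
    have j1 := abs_fst_le j k
    have j2 := abs_snd_le j k
    have m1 := abs_fst_le_norm m
    have m2 := abs_snd_le_norm m
    have hj : ‖j‖ ≤ ‖m‖ + ‖j - k‖ + 1 := norm_site_le (by linarith) (by linarith)
    have h1 : 1 + ‖j‖ ≤ (‖m‖ + 2) * dd j k := by
      simp only [dd]
      nlinarith [mul_nonneg (norm_nonneg m) (norm_nonneg (j - k)), norm_nonneg (j - k)]
    have hc : |corner m j k| ≤ 1 := by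
      have h1 := step_mem m.1 j.1; have h2 := step_mem m.1 k.1
      have h3 := step_mem m.2 j.2; have h4 := step_mem m.2 k.2
      rw [corner, abs_div, abs_mul, abs_of_pos (two_pos : (0 : ℝ) < 2), div_le_iff₀ two_pos]
      calc _ ≤ (1 : ℝ) * 2 := mul_le_mul (abs_le.2 ⟨by linarith, by linarith⟩)
            (abs_le.2 ⟨by linarith, by linarith⟩) (abs_nonneg _) zero_le_one
        _ = _ := by norm_num
    have a1 : |ang m j| ≤ Real.pi := Complex.abs_arg_le_pi _
    have a2 : |ang m k| ≤ Real.pi := Complex.abs_arg_le_pi _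
    have hb : |Real.sin (ang m k - ang m j) - 2 * Real.pi * corner m j k
        - (-ang m j - -ang m k)| ≤ 1 + 2 * Real.pi + 2 * Real.pi := by
      have s1 := abs_le.1 (Real.abs_sin_le_one (ang m k - ang m j))
      have s2 := abs_le.1 a1
      have s3 := abs_le.1 a2
      have s4 := abs_le.1 hc
      refine abs_le.2 ⟨by nlinarith, by nlinarith⟩
    refine hb.trans ?_
    rw [← div_eq_mul_inv, le_div_iff₀ (by positivity), mul_assoc, ← mul_pow]
    gcongr

/-! #### The index -/

theorem phaseOp_eq (m : Site) : phaseOp m = mulOp (phase m) ⟨1, fun n => (norm_phase m n).le⟩ := rfl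

theorem star_phaseOp (m : Site) : star (phaseOp m) = mulOp (fun n => (starRingEnd ℂ) (phase m n))
    ⟨1, fun n => by rw [RCLike.norm_conj]; exact (norm_phase m n).le⟩ := by
  rw [phaseOp_eq]
  exact star_mulOp _ _ _

theorem conj_phase_mul_self (m n : Site) : (starRingEnd ℂ) (phase m n) * phase m n = 1 := by
  rw [Complex.conj_mul', norm_phase]; norm_num

theorem star_phaseOp_mul (m : Site) : star (phaseOp m) * phaseOp m = 1 := by
  refine ext_ent fun j k => ?_
  rw [star_phaseOp, phaseOp_eq, ent_mulOp_mul, ent_mulOp, ent_one]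
  split_ifs with h
  · subst h; exact conj_phase_mul_self m j
  · exact mul_zero _

theorem phaseOp_mul_star (m : Site) : phaseOp m * star (phaseOp m) = 1 := by
  refine ext_ent fun j k => ?_
  rw [star_phaseOp, phaseOp_eq, ent_mulOp_mul, ent_mulOp, ent_one]
  split_ifs with h
  · subst h; rw [mul_comm]; exact conj_phase_mul_self m j
  · exact mul_zero _

theorem ent_sub_conj (P : Op) (m j k : Site) :
    ent (P - star (phaseOp m) * P * phaseOp m) j k
      = ent P j k * (1 - Complex.exp (((ang m k - ang m j : ℝ) : ℂ) * Complex.I)) := by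
  rw [← conj_phase_mul_phase, ent_sub, star_phaseOp, phaseOp_eq, ent_mul_mulOp, ent_mulOp_mul]
  ring

theorem mod_norm : Mod 1 fun k => 1 + ‖k‖ := by
  have h := mod_pow (u := fun k => 1 + ‖k‖) (fun j => by simp)
    (fun j k => by linarith [norm_sub_norm_le j k]) 1
  simpa only [pow_one] using h

/-- Each factor P - F*PF gains one power of 1 + ‖k‖. Three factors exceed the dimension 2, so the
cube is nuclear. -/
theorem loc_sub_conj {P : Op} (hP : Loc (fun _ => 1) P) (m : Site) :
    Loc (fun k => 1 + ‖k‖) (P - star (phaseOp m) * P * phaseOp m) := by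
  obtain ⟨C, hC⟩ := hP
  refine ⟨fun N => (16 + 8 * ‖m‖) * C (N + 1), fun N j k => ?_⟩
  have h1 := norm_phase_sub_le m k j
  rw [norm_sub_rev, dd_comm, ← norm_exp_sub_one, norm_sub_rev, ← div_eq_mul_inv,
    le_div_iff₀ (by positivity)] at h1
  have h2 := hC (N + 1) j k
  have hd := dd_pos j k
  rw [ent_sub_conj, norm_mul]
  calc _ = ‖ent P j k‖ * dd j k ^ N
        * (‖1 - Complex.exp (((ang m k - ang m j : ℝ) : ℂ) * Complex.I)‖ * (1 + ‖k‖)) := by ring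
    _ ≤ ‖ent P j k‖ * dd j k ^ N * ((16 + 8 * ‖m‖) * dd j k) := by gcongr
    _ = (16 + 8 * ‖m‖) * (‖ent P j k‖ * dd j k ^ (N + 1) * 1) := by ring
    _ ≤ _ := mul_le_mul_of_nonneg_left h2 (by positivity)

/-- The three exponentials have product 1, so the constants cancel and each product of two is the
inverse of the third; the terms pair up to sines. -/
theorem one_sub_exp_mul (x y z : ℝ) (h : x + y + z = 0) :
    (1 - Complex.exp ((x : ℂ) * Complex.I)) * (1 - Complex.exp ((y : ℂ) * Complex.I))
      * (1 - Complex.exp ((z : ℂ) * Complex.I))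
      = -2 * Complex.I * ((Real.sin x + Real.sin y + Real.sin z : ℝ) : ℂ) := by
  obtain rfl : z = -(x + y) := by linarith
  have e1 : Complex.exp ((x : ℂ) * Complex.I) * Complex.exp (-(x : ℂ) * Complex.I) = 1 := by
    rw [← Complex.exp_add]; simp
  have e2 : Complex.exp ((y : ℂ) * Complex.I) * Complex.exp (-(y : ℂ) * Complex.I) = 1 := by
    rw [← Complex.exp_add]; simp
  have e3 : Complex.exp (((-(x + y) : ℝ) : ℂ) * Complex.I)
      = Complex.exp (-(x : ℂ) * Complex.I) * Complex.exp (-(y : ℂ) * Complex.I) := by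
    rw [← Complex.exp_add]; push_cast; ring_nf
  have e4 : Complex.exp (-((-(x + y) : ℝ) : ℂ) * Complex.I)
      = Complex.exp ((x : ℂ) * Complex.I) * Complex.exp ((y : ℂ) * Complex.I) := by
    rw [← Complex.exp_add]; push_cast; ring_nf
  rw [Complex.ofReal_add, Complex.ofReal_add, Complex.ofReal_sin, Complex.ofReal_sin,
    Complex.ofReal_sin, Complex.sin, Complex.sin, Complex.sin, e3, e4]
  generalize Complex.exp ((x : ℂ) * Complex.I) = X at *
  generalize Complex.exp (-(x : ℂ) * Complex.I) = X' at *
  generalize Complex.exp ((y : ℂ) * Complex.I) = Y at *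
  generalize Complex.exp (-(y : ℂ) * Complex.I) = Y' at *
  linear_combination Y' * e1 + X' * e2 - Y * Y' * e1 - e2
    + (X' - X + Y' - Y + X * Y - X' * Y') * Complex.I_mul_I

theorem summable_norm_cube : Summable fun k : Site => ((1 + ‖k‖) * (1 + ‖k‖) * (1 + ‖k‖))⁻¹ := by
  refine summable_inv_one_add_norm_cube.congr fun k => ?_
  ring

/-- The index of the compression of the phase operator is given by the Hall conductance. -/
theorem index_phaseOp {P : Op} (hPP : P * P = P) (hPs : star P = P) (hP : Loc (fun _ => 1) P)
    (m : Site) (L : ℤ) :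
    (compression P (phaseOp m)).IsFredholm ∧ ((compression P (phaseOp m)).toLinearMap.index : ℂ)
      = -4 * Real.pi * Complex.I * hall L P := by
  have hD := loc_sub_conj hP m
  have hw := mod_norm
  have hnuc := (((hD.mul hw hw.1 hD).mul (hw.mul hw) hw.1 hD).absSum ((hw.mul hw).mul hw).1
    summable_norm_cube).isNuc
  have hmain := index_compression hPP hPs (phaseOp_mul_star m) (star_phaseOp_mul m) hnuc
  refine ⟨hmain.1, hmain.2.trans ?_⟩
  have h1 := hasSum_triple hw hw hw summable_norm_cube hD hD hD
  have h2 : HasSum (fun p => cyc P p * (cob (fun j k => 2 * Real.pi * corner (-1, L) j k) p : ℂ))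
      (2 * Real.pi * hall L P) := by
    refine ((hasSum_hall hP L).mul_left (2 * Real.pi : ℂ)).congr_fun fun p => ?_
    simp only [cob]
    push_cast
    ring
  -- The sine is traded for the corner at m, and that corner is moved to (-1, L).
  have h3 := ((cohom_sin m).trans ((cohom_corner m (-1, L)).const_mul (2 * Real.pi))).hasSum hPP hP
    (fun j k => by rw [← Real.sin_neg]; congr 1; ring)
    (fun j k => by rw [corner_swap]; ring) h2
  have h4 := (h3.mul_left (-2 * Complex.I)).congr_fun (g := fun p : Site × Site × Site =>
    ent (P - star (phaseOp m) * P * phaseOp m) p.1 p.2.1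
      * ent (P - star (phaseOp m) * P * phaseOp m) p.2.1 p.2.2
      * ent (P - star (phaseOp m) * P * phaseOp m) p.2.2 p.1) fun p => by
    have e := one_sub_exp_mul (ang m p.2.1 - ang m p.1) (ang m p.2.2 - ang m p.2.1)
      (ang m p.1 - ang m p.2.2) (by ring)
    simp only [ent_sub_conj, cyc, cob]
    linear_combination (ent P p.1 p.2.1 * ent P p.2.1 p.2.2 * ent P p.2.2 p.1) * e
  rw [h1.unique h4]
  ring

/-! ### The bulk-edge correspondence -/

theorem fermiProjection_eq {H : Op} {a b μ : ℝ} (hgap : Disjoint (Set.Icc a b) (spectrum ℝ H))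
    (hμ : μ ∈ Set.Icc a b) {g : ℝ → ℝ} (hg : IsSwitch g a b) :
    fermiProjection H μ = funcCalc g H := by
  refine cfc_congr fun x hx => ?_
  rcases lt_or_lt_of_notMem_Icc (fun h => hgap.le_bot ⟨h, hx⟩ : x ∉ Set.Icc a b) with h | h
  · rw [Set.indicator_of_mem (Set.mem_Iic.2 (h.le.trans hμ.1)), hg.left x h]; rfl
  · rw [Set.indicator_of_notMem (fun h' => absurd (hμ.2.trans_lt h) (Set.mem_Iic.1 h').not_gt),
      hg.right x h]

theorem funcCalc_mul_self {H : Op} {a b : ℝ} (hgap : Disjoint (Set.Icc a b) (spectrum ℝ H))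
    {g : ℝ → ℝ} (hg : IsSwitch g a b) : funcCalc g H * funcCalc g H = funcCalc g H := by
  have hc := hg.smooth.continuous
  have e1 : funcCalc (fun x => g x * g x - g x) H = _ := funcCalc_sub (hc.mul hc) hc
  have e2 : funcCalc (fun x => g x * g x) H = _ := funcCalc_mul hc hc
  rw [funcCalc_eq_zero fun x hx => hg.mul_self_sub fun h => hgap.le_bot ⟨h, hx⟩, e2] at e1
  exact (sub_eq_zero.1 e1.symm)

theorem bulk_edge {B : ℝ} (M : FiniteRangeModel B) {a b μ : ℝ}
    (hgap : Disjoint (Set.Icc a b) (spectrum ℝ M.H)) (hμ : μ ∈ Set.Icc a b) {g : ℝ → ℝ}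
    (hg : IsSwitch g a b) (m : Site) :
    (compression (fermiProjection M.H μ) (phaseOp m)).IsFredholm ∧
    HasTrace (funcCalc (deriv g) M.Hhat * M.edgeCurrent) (1 / (2 * Real.pi) *
      ((compression (fermiProjection M.H μ) (phaseOp m)).toLinearMap.index : ℂ)) := by
  have hH := M.isSelfAdjoint_H
  have hfr := M.finRange_H
  have hr : (1 : ℝ) ≤ 2 * M.R + 1 := by linarith [show (0 : ℝ) ≤ M.R from Nat.cast_nonneg _]
  have hP := loc_funcCalc hH hfr hr hg.smooth
  have hPP := funcCalc_mul_self hgap hg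
  have hPs : star (funcCalc g M.H) = funcCalc g M.H := isSelfAdjoint_funcCalc g M.H
  rw [fermiProjection_eq hgap hμ hg]
  have hind := index_phaseOp hPP hPs hP m
  refine ⟨(hind 0).1, ?_⟩
  -- The index does not involve L, so neither does the Hall conductance.
  have hhall : ∀ L : ℕ, hall L (funcCalc g M.H) = hall 0 (funcCalc g M.H) := fun L => by
    have h := (hind L).2.symm.trans (hind 0).2
    refine mul_left_cancel₀ ?_ h
    simp [Real.pi_ne_zero]
  have h3 := hall_eq_tr hH hfr hr hgap hg hhall
  have h4 := tr_edge hH hfr hr hgap hg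
  have habs := absSum_mul_dL_halfPlane hH hfr hr hg.smooth_deriv
    fun x hx => hg.deriv_eq_zero fun h => hgap.le_bot ⟨h, hx⟩
  set T := funcCalc (deriv g) M.Hhat * (quarterProj * M.Hhat - M.Hhat * quarterProj) with hT
  have hlift : lift T = lift (funcCalc (deriv g) (halfPlane M.H)) * dL (lift (halfPlane M.H)) := by
    rw [hT, lift_mul, lift_quarterProj_comm]
    rfl
  rw [← hlift] at habs h4
  have hE : funcCalc (deriv g) M.Hhat * M.edgeCurrent = Complex.I • T := by
    rw [FiniteRangeModel.edgeCurrent, mul_smul_comm]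
  have habs' : AbsSum (Complex.I • T) := by
    have h := AbsSum.of_lift habs
    simpa only [AbsSum, ent_smul, norm_mul, Complex.norm_I, one_mul] using h
  have hval : tr (Complex.I • T) = 1 / (2 * Real.pi) *
      ((compression (funcCalc g M.H) (phaseOp m)).toLinearMap.index : ℂ) := by
    have hpi : (Real.pi : ℂ) ≠ 0 := Complex.ofReal_ne_zero.2 Real.pi_ne_zero
    -- With τ = tr((G² - G) ∂G), both sides become -6i τ.
    rw [tr_smul (AbsSum.of_lift habs).isNuc, ← tr_lift habs, (hind 0).2, h3, h4]
    field_simp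
    ring
  rw [hE, ← hval]
  have : Infinite UpperSite :=
    Infinite.of_injective (fun n : ℤ => (⟨(n, 1), by norm_num⟩ : UpperSite)) fun x y h => by
      simpa using h
  obtain ⟨hd⟩ := nonempty_denumerable UpperSite
  exact habs'.hasTrace

end BulkEdge

end

theorem mainTheorem2 (B : ℝ) (M : BulkEdge.FiniteRangeModel B) (a b μ : ℝ)
    (hgap : Disjoint (Set.Icc a b) (spectrum ℝ M.H)) (hμ : μ ∈ Set.Icc a b)
    (g : ℝ → ℝ) (hg_smooth : ContDiff ℝ ∞ g) (hg_anti : Antitone g)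
    (hg_mem : ∀ x, g x ∈ Set.Icc (0 : ℝ) 1)
    (hg_left : ∀ x, x < a → g x = 1) (hg_right : ∀ x, b < x → g x = 0)
    (m : BulkEdge.Site) :
    (BulkEdge.compression (BulkEdge.fermiProjection M.H μ) (BulkEdge.phaseOp m)).IsFredholm ∧
    BulkEdge.HasTrace (BulkEdge.funcCalc (deriv g) M.Hhat * M.edgeCurrent)
      (1 / (2 * Real.pi) *
        ((BulkEdge.compression (BulkEdge.fermiProjection M.H μ)
          (BulkEdge.phaseOp m)).toLinearMap.index : ℂ)) :=
  BulkEdge.bulk_edge M hgap hμ ⟨hg_smooth, hg_left, hg_right⟩ m
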